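/- For a bounded open set $\Omega\subset\mathbb R^n$ let $-\Delta$ be the Dirichlet Laplacian on the real space $L^2(\Omega)$, with orthonormal basis of eigenfunctions $(\varphi_k)_{k\ge 1}$, $\varphi_k\in H^1_0(\Omega)$, $-\Delta\varphi_k=\lambda_k\varphi_k$, and for $\Lambda>0$ let $\Pi_\Lambda u=\sum_{\lambda_k\le\Lambda}\langle u,\varphi_k\rangle_{L^2}\,\varphi_k$. For $\omega\subset\Omega$, $C>0$ and $\beta>0$, we say that $\mathrm{spec}(\Omega,\omega,C,\beta)$ holds if $$\|\Pi_\Lambda u\|_{L^2(\Omega)}\le C\exp(C\Lambda^\beta)\,\sup_{x\in\omega}|\Pi_\Lambda u(x)|\qquad\text{for all }\Lambda>0,\ u\in L^2(\Omega).$$ For $T>0$ and $u_0\in L^2(\Omega)$, the solution of the heat equation on $(0,T)\times\Omega$ with initial datum $u_0$ is the weak solution $u\in C([0,T];L^2(\Omega))\cap L^2(0,T;H^1_0(\Omega))\cap H^1(0,T;H^{-1}(\Omega))$ of $\partial_t u-\Delta u=0$ in $(0,T)\times\Omega$, $u=0$ on $(0,T)\times\partial\Omega$, $u(0,\cdot)=u_0$.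 The functions $\Pi_\Lambda u$ and $u(t,\cdot)$, $t>0$, are evaluated at points of $\Omega$ through their continuous representatives, and suprema and integrals below are taken in $[0,\infty]$. **Proposition.** For $j=1,2$ let $\Omega_j\subset\mathbb R^{n_j}$ be a bounded open set and $\omega_j\subset\Omega_j$. Let $\beta\in(0,1)$, $\alpha=\frac{\beta}{1-\beta}$, $C_1,C_2>0$, and assume that $\mathrm{spec}(\Omega_2,\omega_2,C_2,\beta)$ holds. Then there exists $C>0$ (depending on $\Omega_j,\omega_j,\beta,C_1,C_2$, but not on $T$) such that the following holds for every $T>0$. If for every $v_0\in L^2(\Omega_1)$ the solution $v$ of the heat equation on $(0,T)\times\Omega_1$ with initial datum $v_0$ satisfies $$\|v(\tau,\cdot)\|^2_{L^2(\Omega_1)}\le C_1\exp\Big(\frac{C_1}{\tau^\alpha}\Big)\int_0^\tau\sup_{x\in\omega_1}|v(t,x)|^2\,dt\qquad\text{for all }0<\tau\le T,$$ then for every $u_0\in L^2(\Omega_1\times\Omega_2)$ the solution $u$ of the heat equation on $(0,T)\times(\Omega_1\times\Omega_2)$ with initial datum $u_0$ satisfies $$\|u(T,\cdot)\|^2_{L^2(\Omega_1\times\Omega_2)}\le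 C\exp\Big(\frac{C}{T^\alpha}\Big)\int_0^T\sup_{(x,y)\in\omega_1\times\omega_2}|u(t,x,y)|^2\,dt.$$ -/

import Mathlib

open MeasureTheory Set
open scoped ENNReal RealInnerProductSpace

noncomputable section

namespace HeatObs

/-- Euclidean space with coordinates indexed by `ι`; `Eu (Fin n)` is `ℝⁿ`. -/
abbrev Eu (ι : Type) [Fintype ι] : Type := EuclideanSpace ℝ ι

/-- The real Hilbert space `L²(Ω)`. -/
abbrev L2 {ι : Type} [Fintype ι] (Ω : Set (Eu ι)) : Type :=
  Lp ℝ 2 ((volume : Measure (Eu ι)).restrict Ω)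

/-- The real Hilbert space `L²(Ω; ℝⁿ)` of vector fields. -/
abbrev L2Vec {ι : Type} [Fintype ι] (Ω : Set (Eu ι)) : Type :=
  Lp (Eu ι) 2 ((volume : Measure (Eu ι)).restrict Ω)

/-- The Sobolev space `H¹₀(Ω)`: the closure of `C_c^∞(Ω)` in the norm
`(‖φ‖²_{L²} + ‖∇φ‖²_{L²})^{1/2}`. A Sobolev function is recorded with its weak gradient, as the pair
`(f, ∇f)` in `L²(Ω) × L²(Ω; ℝⁿ)`. (The spanning set is already a linear subspace.) -/
def H10 {ι : Type} [Fintype ι] (Ω : Set (Eu ι)) : Submodule ℝ (WithLp 2 (L2 Ω × L2Vec Ω)) :=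
  (Submodule.span ℝ {w : WithLp 2 (L2 Ω × L2Vec Ω) |
    ∃ φ : Eu ι → ℝ, ContDiff ℝ (⊤ : ℕ∞) φ ∧ HasCompactSupport φ ∧ tsupport φ ⊆ Ω ∧
      (w.fst : Eu ι → ℝ) =ᵐ[volume.restrict Ω] φ ∧
      (w.snd : Eu ι → Eu ι) =ᵐ[volume.restrict Ω] gradient φ}).topologicalClosure

/-- The underlying `L²` function of an element of `H¹₀(Ω)`. -/
def h10Fn {ι : Type} [Fintype ι] {Ω : Set (Eu ι)} (w : H10 Ω) : L2 Ω := w.1.fst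

/-- The weak gradient of an element of `H¹₀(Ω)`. -/
def h10Grad {ι : Type} [Fintype ι] {Ω : Set (Eu ι)} (w : H10 Ω) : L2Vec Ω := w.1.snd

/-- The space `H⁻¹(Ω)`, the topological dual of `H¹₀(Ω)`. -/
abbrev Hm1 {ι : Type} [Fintype ι] (Ω : Set (Eu ι)) : Type := H10 Ω →L[ℝ] ℝ

/-- The canonical embedding `L²(Ω) → H⁻¹(Ω)`, `f ↦ (v ↦ ∫_Ω f v)`. -/
def toHm1 {ι : Type} [Fintype ι] {Ω : Set (Eu ι)} (f : L2 Ω) : Hm1 Ω :=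
  (innerSL ℝ f).comp ((WithLp.fstL 2 ℝ (L2 Ω) (L2Vec Ω)).comp (H10 Ω).subtypeL)

/-- `f ∈ H¹₀(Ω)` and `-Δ f = lam f` weakly in `Ω`: `f` is zero or a Dirichlet eigenfunction with
eigenvalue `lam`. -/
def IsDirichletEigen {ι : Type} [Fintype ι] (Ω : Set (Eu ι)) (lam : ℝ) (f : L2 Ω) : Prop :=
  ∃ w : H10 Ω, h10Fn w = f ∧ ∀ v : H10 Ω, ⟪h10Grad w, h10Grad v⟫ = lam * ⟪h10Fn w, h10Fn v⟫

/-- The closed linear span in `L²(Ω)` of the Dirichlet eigenfunctions with eigenvalue at most `Λ`. -/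
def lowFreq {ι : Type} [Fintype ι] (Ω : Set (Eu ι)) (Λ : ℝ) : Submodule ℝ (L2 Ω) :=
  (Submodule.span ℝ {f : L2 Ω | ∃ lam ≤ Λ, IsDirichletEigen Ω lam f}).topologicalClosure

instance {ι : Type} [Fintype ι] (Ω : Set (Eu ι)) (Λ : ℝ) : CompleteSpace (lowFreq Ω Λ) :=
  inferInstanceAs (CompleteSpace (Submodule.topologicalClosure _))

/-- The spectral projector `Π_Λ u = ∑_{λ_k ≤ Λ} ⟨u, φ_k⟩ φ_k`, i.e. the orthogonal projection of
`L²(Ω)` onto the span of the eigenfunctions with eigenvalue at most `Λ`. -/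
def specProj {ι : Type} [Fintype ι] (Ω : Set (Eu ι)) (Λ : ℝ) (u : L2 Ω) : L2 Ω :=
  (lowFreq Ω Λ).starProjection u

open Classical in
/-- The representative of `f ∈ L²(Ω)` that is continuous on the open set `Ω` (unique on `Ω`), used
to evaluate `f` at points of `Ω`. Finite combinations of eigenfunctions, and solutions of the heat
equation at positive times, have one by interior regularity. If there is none the value is `0`. -/
def contRep {ι : Type} [Fintype ι] {Ω : Set (Eu ι)} (f : L2 Ω) : Eu ι → ℝ :=
  if h : ∃ g : Eu ι → ℝ, ContinuousOn g Ω ∧ (f : Eu ι → ℝ) =ᵐ[volume.restrict Ω] g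
  then h.choose else 0

/-- `sup_{x ∈ ω} |f(x)|`, as an element of `[0, ∞]`. -/
def supOn {ι : Type} [Fintype ι] {Ω : Set (Eu ι)} (ω : Set (Eu ι)) (f : L2 Ω) : ℝ≥0∞ :=
  ⨆ x ∈ ω, ‖contRep f x‖ₑ

/-- `spec(Ω, ω, C, β)`:
`‖Π_Λ u‖_{L²(Ω)} ≤ C exp(C Λ^β) sup_{x ∈ ω} |Π_Λ u(x)|` for all `Λ > 0` and `u ∈ L²(Ω)`. -/
def Spec {ι : Type} [Fintype ι] (Ω ω : Set (Eu ι)) (C β : ℝ) : Prop :=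
  ∀ Λ : ℝ, 0 < Λ → ∀ u : L2 Ω,
    ‖specProj Ω Λ u‖ₑ ≤ ENNReal.ofReal (C * Real.exp (C * Λ ^ β)) * supOn ω (specProj Ω Λ u)

/-- `u` is the weak solution on `(0, T) × Ω` of `∂ₜu - Δu = 0`, `u = 0` on the boundary,
`u(0) = u₀`: `u ∈ C([0,T]; L²(Ω)) ∩ L²(0,T; H¹₀(Ω)) ∩ H¹(0,T; H⁻¹(Ω))`, and for a.e. `t`,
`⟨u'(t), v⟩ + ∫_Ω ∇u(t)·∇v = 0` for all `v ∈ H¹₀(Ω)`. That `u ∈ H¹(0,T; H⁻¹(Ω))` with derivative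
`u' = dU` and initial value `u₀` is expressed by `u(t) = u₀ + ∫₀ᵗ u'(s) ds` in `H⁻¹(Ω)`. -/
structure IsHeatSolution {ι : Type} [Fintype ι] (Ω : Set (Eu ι)) (T : ℝ) (u₀ : L2 Ω)
    (u : ℝ → L2 Ω) : Prop where
  continuousOn : ContinuousOn u (Icc 0 T)
  initial : u 0 = u₀
  weak : ∃ (U : ℝ → H10 Ω) (dU : ℝ → Hm1 Ω),
    MemLp U 2 (volume.restrict (Ioo 0 T)) ∧
    MemLp dU 2 (volume.restrict (Ioo 0 T)) ∧
    (∀ᵐ t ∂(volume.restrict (Ioo 0 T)), h10Fn (U t) = u t) ∧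
    (∀ t ∈ Icc 0 T, toHm1 (u t) = toHm1 u₀ + ∫ s in (0 : ℝ)..t, dU s) ∧
    (∀ᵐ t ∂(volume.restrict (Ioo 0 T)), ∀ v : H10 Ω, dU t v + ⟪h10Grad (U t), h10Grad v⟫ = 0)

/-- The product `A × B` as a subset of `ℝ^{n₁} × ℝ^{n₂} = ℝ^{n₁ + n₂}`. -/
def prodSet {ι κ : Type} [Fintype ι] [Fintype κ] (A : Set (Eu ι)) (B : Set (Eu κ)) :
    Set (Eu (ι ⊕ κ)) :=
  {z | WithLp.toLp 2 (fun i => z (Sum.inl i)) ∈ A ∧ WithLp.toLp 2 (fun j => z (Sum.inr j)) ∈ B}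

/-- The solution `u` satisfies, at time `τ`,
`‖u(τ)‖²_{L²(Ω)} ≤ C exp(C / τ^α) ∫₀^τ sup_{x ∈ ω} |u(t, x)|² dt`. -/
def ObsIneq {ι : Type} [Fintype ι] {Ω : Set (Eu ι)} (ω : Set (Eu ι)) (C α τ : ℝ)
    (u : ℝ → L2 Ω) : Prop :=
  ‖u τ‖ₑ ^ 2 ≤ ENNReal.ofReal (C * Real.exp (C / τ ^ α)) *
    ∫⁻ t in Ioo 0 τ, supOn ω (u t) ^ 2

end HeatObs

end

/-! Products φ_j ⊗ ψ_k of Dirichlet eigenfunctions of the two factors form an eigenbasis of the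
product, with eigenvalues λ_j + μ_k. Let u be a heat solution with coefficients c_jk(t). For fixed
k, v_k(t,x) = ∑_j c_jk(t) φ_j(x) is e^{-μ_k t} times a heat solution on Ω₁, so the observability
hypothesis controls it by its supremum over ω₁. For frozen (t,x), the numbers v_k(t,x) with μ_k ≤ Λ
are coefficients of a low-frequency function on Ω₂, and the spectral inequality bounds them by the
supremum over y ∈ ω₂ of ∑_k v_k(t,x) ψ_k(y), at the price exp(CΛ^β). Truncated at λ_j, μ_k ≤ Λ, this
double sum is u(t,x,y) minus a high-frequency remainder, which smoothing over a time τ makes of size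
exp(-cΛτ)‖u‖ up to powers of 1/τ. Both hypotheses are applied to finite sums of eigenfunctions only.

The outcome is `exists_heat_step`: ‖u(t+τ)‖² is bounded by a cost times the observation on (t, t+τ),
plus a small multiple of ‖u(t)‖². The cutoff Λ = M τ^{-(1+α)} balances the two: (1+α)β = α gives Λ^β
= M^β τ^{-α}, while Λτ = M τ^{-α}. As β < 1, a large M makes the gain beat the cost
(`exists_exp_bounds`, `exists_large_cutoff`). Steps from τ to 2τ, suitably weighted, telescope along
the times T/2^k (`le_lintegral_of_forall_step`), and the remainder vanishes because ‖u‖ stays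
bounded while the weights tend to zero.

The spectral theory of a rough open set comes from one mollifier. Mollification is Hilbert–Schmidt
and differs from the identity by at most s‖∇w‖ at scale s (`exists_sum_norm_sq_jOp_le`,
`norm_sub_jOp_le`), which yields the compact embedding, an eigenbasis and a polynomial bound on the
number of eigenvalues. Squares of eigenfunctions, extended by zero, have almost monotone averages
(`exists_mAvg_sq_le`), hence a global sup bound without boundary regularity. In the interior the
averages are uniformly Cauchy (`abs_jAvg_sub_le`), hence a continuous representative. Boundedness of
the domains matters only through finite volume. -/

open MeasureTheory Set
open scoped ENNReal RealInnerProductSpace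

noncomputable section

namespace HeatObs

/-! ### Test functions and the space H¹₀ -/

section

variable {ι : Type} [Fintype ι]

/-- Smooth functions with compact support contained in `Ω`. -/
def IsTest (Ω : Set (Eu ι)) (φ : Eu ι → ℝ) : Prop :=
  ContDiff ℝ (⊤ : ℕ∞) φ ∧ HasCompactSupport φ ∧ tsupport φ ⊆ Ω

lemma continuous_gradient {φ : Eu ι → ℝ} (h : ContDiff ℝ (⊤ : ℕ∞) φ) :
    Continuous (gradient φ) := by
  unfold gradient
  exact (LinearIsometryEquiv.continuous _).comp (h.continuous_fderiv (by simp))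

lemma hasCompactSupport_gradient {φ : Eu ι → ℝ} (h : HasCompactSupport φ) :
    HasCompactSupport (gradient φ) := by
  have := (h.fderiv ℝ).comp_left (g := (InnerProductSpace.toDual ℝ (Eu ι)).symm) (map_zero _)
  exact this

lemma gradient_add_smul {φ ψ : Eu ι → ℝ} {x : Eu ι} (hφ : DifferentiableAt ℝ φ x)
    (hψ : DifferentiableAt ℝ ψ x) (c : ℝ) :
    gradient (fun y => φ y + c * ψ y) x = gradient φ x + c • gradient ψ x := by
  simp only [gradient]
  rw [fderiv_fun_add hφ (hψ.const_mul c), fderiv_const_mul hψ]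
  simp

lemma gradient_mul {φ ψ : Eu ι → ℝ} {x : Eu ι} (hφ : DifferentiableAt ℝ φ x)
    (hψ : DifferentiableAt ℝ ψ x) :
    gradient (fun y => φ y * ψ y) x = φ x • gradient ψ x + ψ x • gradient φ x := by
  simp only [gradient]
  rw [fderiv_fun_mul hφ hψ]
  simp

namespace IsTest

variable {Ω : Set (Eu ι)} {φ ψ : Eu ι → ℝ}

lemma differentiable (h : IsTest Ω φ) : Differentiable ℝ φ := h.1.differentiable (by simp)

lemma continuous (h : IsTest Ω φ) : Continuous φ := h.1.continuous

lemma memLp (h : IsTest Ω φ) : MemLp φ 2 (volume.restrict Ω) :=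
  (h.continuous.memLp_of_hasCompactSupport h.2.1).restrict _

lemma memLp_gradient (h : IsTest Ω φ) : MemLp (gradient φ) 2 (volume.restrict Ω) :=
  ((continuous_gradient h.1).memLp_of_hasCompactSupport
    (hasCompactSupport_gradient h.2.1)).restrict _

lemma eq_zero_of_notMem (h : IsTest Ω φ) {x : Eu ι} (hx : x ∉ Ω) : φ x = 0 :=
  image_eq_zero_of_notMem_tsupport fun h' => hx (h.2.2 h')

lemma gradient_eq_zero_of_notMem (h : IsTest Ω φ) {x : Eu ι} (hx : x ∉ Ω) :
    gradient φ x = 0 := by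
  have : fderiv ℝ φ x = 0 := by
    by_contra h'
    exact hx (h.2.2 (support_fderiv_subset ℝ h'))
  simp [gradient, this]

lemma add_smul (h : IsTest Ω φ) (h' : IsTest Ω ψ) (c : ℝ) :
    IsTest Ω (fun x => φ x + c * ψ x) := by
  have h2 : HasCompactSupport (fun x => c * ψ x) := h'.2.1.mul_left
  refine ⟨h.1.add (contDiff_const.mul h'.1), h.2.1.add h2, ?_⟩
  refine (tsupport_add φ (fun x => c * ψ x)).trans (union_subset h.2.2 ?_)
  exact (tsupport_mul_subset_right (f := fun _ => c) (g := ψ)).trans h'.2.2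

lemma mul_left (h : IsTest Ω φ) {η : Eu ι → ℝ} (hη : ContDiff ℝ (⊤ : ℕ∞) η) :
    IsTest Ω (fun x => η x * φ x) :=
  ⟨hη.mul h.1, h.2.1.mul_left, (tsupport_mul_subset_right (f := η) (g := φ)).trans h.2.2⟩

/-- A test function as an element of `L² × L²`. -/
def pair (h : IsTest Ω φ) : WithLp 2 (L2 Ω × L2Vec Ω) :=
  WithLp.toLp 2 (h.memLp.toLp φ, h.memLp_gradient.toLp (gradient φ))

/-- A test function as an element of `H¹₀`. -/
def toH10 (h : IsTest Ω φ) : H10 Ω :=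
  ⟨h.pair, Submodule.le_topologicalClosure _ <| Submodule.subset_span
    ⟨φ, h.1, h.2.1, h.2.2, h.memLp.coeFn_toLp, h.memLp_gradient.coeFn_toLp⟩⟩

lemma h10Fn_toH10 (h : IsTest Ω φ) : h10Fn h.toH10 = h.memLp.toLp φ := rfl

lemma h10Grad_toH10 (h : IsTest Ω φ) :
    h10Grad h.toH10 = h.memLp_gradient.toLp (gradient φ) := rfl

lemma coeFn_h10Fn (h : IsTest Ω φ) : h10Fn h.toH10 =ᵐ[volume.restrict Ω] φ :=
  h.memLp.coeFn_toLp

lemma coeFn_h10Grad (h : IsTest Ω φ) :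
    h10Grad h.toH10 =ᵐ[volume.restrict Ω] gradient φ :=
  h.memLp_gradient.coeFn_toLp

end IsTest

variable {Ω : Set (Eu ι)}

lemma isTest_zero : IsTest Ω (fun _ : Eu ι => (0 : ℝ)) :=
  ⟨contDiff_const, HasCompactSupport.zero, by simp [tsupport, Function.support]⟩

/-- Test functions already form a linear space, so the span in the definition of `H10` adds nothing.
This is what allows density arguments with a single test function in place of a linear combination.
-/
lemma mem_span_test {w : WithLp 2 (L2 Ω × L2Vec Ω)}
    (hw : w ∈ Submodule.span ℝ {w : WithLp 2 (L2 Ω × L2Vec Ω) |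
    ∃ φ : Eu ι → ℝ, ContDiff ℝ (⊤ : ℕ∞) φ ∧ HasCompactSupport φ ∧ tsupport φ ⊆ Ω ∧
      (w.fst : Eu ι → ℝ) =ᵐ[volume.restrict Ω] φ ∧
      (w.snd : Eu ι → Eu ι) =ᵐ[volume.restrict Ω] gradient φ}) :
    ∃ (φ : Eu ι → ℝ) (h : IsTest Ω φ), w = h.pair := by
  have key : ∀ (w : WithLp 2 (L2 Ω × L2Vec Ω)) (φ : Eu ι → ℝ) (h : IsTest Ω φ),
      (w.fst : Eu ι → ℝ) =ᵐ[volume.restrict Ω] φ →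
      (w.snd : Eu ι → Eu ι) =ᵐ[volume.restrict Ω] gradient φ → w = h.pair := by
    intro w φ h h1 h2
    apply (WithLp.equiv 2 _).injective
    refine Prod.ext (Lp.ext (h1.trans h.memLp.coeFn_toLp.symm))
      (Lp.ext (h2.trans h.memLp_gradient.coeFn_toLp.symm))
  have comb : ∀ (φ ψ : Eu ι → ℝ) (h : IsTest Ω φ) (h' : IsTest Ω ψ) (c : ℝ),
      h.pair + c • h'.pair = (h.add_smul h' c).pair := by
    intro φ ψ h h' c
    apply key
    · have e1 : (h.pair + c • h'.pair).fst = h.memLp.toLp φ + c • h'.memLp.toLp ψ := rfl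
      rw [e1]
      filter_upwards [Lp.coeFn_add (h.memLp.toLp φ) (c • h'.memLp.toLp ψ),
        Lp.coeFn_smul c (h'.memLp.toLp ψ), h.memLp.coeFn_toLp, h'.memLp.coeFn_toLp]
        with x a1 a2 a3 a4
      rw [a1, Pi.add_apply, a2, Pi.smul_apply, a3, a4, smul_eq_mul]
    · have e1 : (h.pair + c • h'.pair).snd = h.memLp_gradient.toLp (gradient φ) +
        c • h'.memLp_gradient.toLp (gradient ψ) := rfl
      rw [e1]
      filter_upwards [Lp.coeFn_add (h.memLp_gradient.toLp (gradient φ))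
          (c • h'.memLp_gradient.toLp (gradient ψ)),
        Lp.coeFn_smul c (h'.memLp_gradient.toLp (gradient ψ)), h.memLp_gradient.coeFn_toLp,
        h'.memLp_gradient.coeFn_toLp] with x a1 a2 a3 a4
      rw [a1, Pi.add_apply, a2, Pi.smul_apply, a3, a4,
        gradient_add_smul (h.differentiable x) (h'.differentiable x)]
  have zero : (0 : WithLp 2 (L2 Ω × L2Vec Ω)) = (isTest_zero (Ω := Ω)).pair := by
    apply key
    · exact (Lp.coeFn_zero ..)
    · refine (Lp.coeFn_zero ..).trans ?_
      filter_upwards with x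
      simp [gradient]
  induction hw using Submodule.span_induction with
  | mem x hx =>
    obtain ⟨φ, h1, h2, h3, h4, h5⟩ := hx
    exact ⟨φ, ⟨h1, h2, h3⟩, key _ _ _ h4 h5⟩
  | zero => exact ⟨_, isTest_zero, zero⟩
  | add x y _ _ hx hy =>
    obtain ⟨φ, h, rfl⟩ := hx
    obtain ⟨ψ, h', rfl⟩ := hy
    refine ⟨_, h.add_smul h' 1, ?_⟩
    rw [← comb, one_smul]
  | smul c x _ hx =>
    obtain ⟨φ, h, rfl⟩ := hx
    refine ⟨_, isTest_zero.add_smul h c, ?_⟩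
    rw [← comb _ _ isTest_zero h, ← zero, zero_add]

/-- A closed property that holds for test functions holds on `H¹₀`. -/
lemma H10.induction {p : H10 Ω → Prop} (hp : IsClosed {w | p w})
    (h : ∀ (φ : Eu ι → ℝ) (hφ : IsTest Ω φ), p hφ.toH10) (w : H10 Ω) : p w := by
  obtain ⟨x, hx⟩ := w
  obtain ⟨s, hs, hlim⟩ := mem_closure_iff_seq_limit.1 hx
  choose φ hφ hsφ using fun n => mem_span_test (hs n)
  refine hp.mem_of_tendsto (b := Filter.atTop) (f := fun n => (hφ n).toH10) ?_
    (Filter.Eventually.of_forall fun n => h _ _)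
  rw [tendsto_subtype_rng]
  convert hlim using 2 with n
  exact (hsφ n).symm

/-- Every element of `H¹₀` is a limit of test functions. -/
lemma H10.exists_seq (w : H10 Ω) : ∃ (φ : ℕ → Eu ι → ℝ) (hφ : ∀ n, IsTest Ω (φ n)),
    Filter.Tendsto (fun n => (hφ n).toH10) Filter.atTop (nhds w) := by
  obtain ⟨x, hx⟩ := w
  obtain ⟨s, hs, hlim⟩ := mem_closure_iff_seq_limit.1 hx
  choose φ hφ hsφ using fun n => mem_span_test (hs n)
  refine ⟨φ, hφ, ?_⟩
  rw [tendsto_subtype_rng]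
  convert hlim using 2 with n
  exact (hsφ n).symm

instance : CompleteSpace (H10 Ω) :=
  inferInstanceAs (CompleteSpace (Submodule.topologicalClosure _))

/-- The function part of an element of `H¹₀`, as a continuous linear map. -/
def fnL (Ω : Set (Eu ι)) : H10 Ω →L[ℝ] L2 Ω :=
  (WithLp.fstL 2 ℝ (L2 Ω) (L2Vec Ω)).comp (H10 Ω).subtypeL

/-- The gradient part of an element of `H¹₀`, as a continuous linear map. -/
def gradL (Ω : Set (Eu ι)) : H10 Ω →L[ℝ] L2Vec Ω :=
  (WithLp.sndL 2 ℝ (L2 Ω) (L2Vec Ω)).comp (H10 Ω).subtypeL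

@[simp] lemma fnL_apply (w : H10 Ω) : fnL Ω w = h10Fn w := rfl

lemma continuous_h10Fn : Continuous (h10Fn (Ω := Ω)) := (fnL Ω).continuous

lemma continuous_h10Grad : Continuous (h10Grad (Ω := Ω)) := (gradL Ω).continuous

lemma inner_H10 (w v : H10 Ω) : ⟪w, v⟫ = ⟪h10Fn w, h10Fn v⟫ + ⟪h10Grad w, h10Grad v⟫ := by
  rw [Submodule.coe_inner, WithLp.prod_inner_apply]; rfl

end

/-! ### A radial bump, its mollifier, and averages at scale s -/

section

variable {ι : Type} [Fintype ι]

lemma hasDerivAt_expNegInvGlue (x : ℝ) :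
    HasDerivAt expNegInvGlue ((x⁻¹) ^ 2 * expNegInvGlue x) x := by
  simpa using expNegInvGlue.hasDerivAt_polynomial_eval_inv_mul 1 x

/-- A radial bump function supported in the unit ball. -/
def bump (y : Eu ι) : ℝ := expNegInvGlue (1 - ‖y‖ ^ 2)

/-- The (unnormalised) mollifier `ρ ≥ 0` determined by `∇ bump y = -ρ(y) y`. -/
def moll (y : Eu ι) : ℝ := 2 * (((1 - ‖y‖ ^ 2)⁻¹) ^ 2 * expNegInvGlue (1 - ‖y‖ ^ 2))

lemma contDiff_bump : ContDiff ℝ (⊤ : ℕ∞) (bump (ι := ι)) :=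
  expNegInvGlue.contDiff.comp (contDiff_const.sub (contDiff_norm_sq ℝ))

lemma contDiff_moll : ContDiff ℝ (⊤ : ℕ∞) (moll (ι := ι)) := by
  have h := expNegInvGlue.contDiff_polynomial_eval_inv_mul (n := ⊤) (Polynomial.X ^ 2)
  simp only [Polynomial.eval_pow, Polynomial.eval_X] at h
  exact contDiff_const.mul (h.comp (contDiff_const.sub (contDiff_norm_sq ℝ)))

lemma bump_nonneg (y : Eu ι) : 0 ≤ bump y := expNegInvGlue.nonneg _

lemma moll_nonneg (y : Eu ι) : 0 ≤ moll y :=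
  mul_nonneg zero_le_two (mul_nonneg (sq_nonneg _) (expNegInvGlue.nonneg _))

lemma bump_eq_zero {y : Eu ι} (hy : 1 ≤ ‖y‖) : bump y = 0 :=
  expNegInvGlue.zero_of_nonpos (by nlinarith)

lemma moll_eq_zero {y : Eu ι} (hy : 1 ≤ ‖y‖) : moll y = 0 := by
  rw [moll, expNegInvGlue.zero_of_nonpos (by nlinarith)]; simp

/-- Inside the unit ball (1 - ‖y‖²)⁻¹ ≥ 1. The inequality turns the mass term ∫ bump · φ², which
appears on testing the eigenvalue equation, back into an average of φ², and so closes a differential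
inequality in s. -/
lemma two_mul_bump_le_moll (y : Eu ι) : 2 * bump y ≤ moll y := by
  unfold bump moll
  rcases le_or_gt (1 - ‖y‖ ^ 2) 0 with h | h
  · simp [expNegInvGlue.zero_of_nonpos h]
  · have h1 : 1 ≤ (1 - ‖y‖ ^ 2)⁻¹ := (one_le_inv₀ h).2 (by nlinarith [sq_nonneg ‖y‖])
    have h2 : 1 ≤ ((1 - ‖y‖ ^ 2)⁻¹) ^ 2 := one_le_pow₀ h1
    nlinarith [expNegInvGlue.nonneg (1 - ‖y‖ ^ 2)]

lemma hasCompactSupport_of_eq_zero {f : Eu ι → ℝ} (h : ∀ y, 1 ≤ ‖y‖ → f y = 0) :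
    HasCompactSupport f := by
  refine HasCompactSupport.intro (isCompact_closedBall (0 : Eu ι) 1) fun x hx => h x ?_
  rw [mem_closedBall_zero_iff, not_le] at hx
  exact hx.le

lemma hasCompactSupport_moll : HasCompactSupport (moll (ι := ι)) :=
  hasCompactSupport_of_eq_zero fun _ => moll_eq_zero

lemma continuous_moll : Continuous (moll (ι := ι)) := contDiff_moll.continuous

lemma integrable_moll : Integrable (moll (ι := ι)) :=
  continuous_moll.integrable_of_hasCompactSupport hasCompactSupport_moll

variable (ι) in
/-- The mass of the mollifier. -/
def mollMass : ℝ := ∫ y : Eu ι, moll y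

variable (ι) in
lemma mollMass_pos : 0 < mollMass ι := by
  refine continuous_moll.integral_pos_of_hasCompactSupport_nonneg_nonzero
    hasCompactSupport_moll moll_nonneg (x := 0) ?_
  simp only [moll, norm_zero]
  norm_num

variable (ι) in
lemma exists_moll_le : ∃ R : ℝ, 0 < R ∧ ∀ y : Eu ι, moll y ≤ R := by
  obtain ⟨R, hR⟩ := hasCompactSupport_moll.exists_bound_of_continuous (continuous_moll (ι := ι))
  exact ⟨max R 1, by positivity, fun y => (le_abs_self _).trans ((hR y).trans (le_max_left _ _))⟩

/-- The reason for this pair of profiles: differentiating a `moll`-average in the scale produces the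
factor `moll y • y`, which is a gradient and can be used to test the weak equation. -/
lemma gradient_bump (y : Eu ι) : gradient bump y = -(moll y • y) := by
  refine HasGradientAt.gradient ?_
  rw [hasGradientAt_iff_hasFDerivAt]
  have h1 : HasFDerivAt (fun y : Eu ι => 1 - ‖y‖ ^ 2) (-(2 • innerSL ℝ y)) y := by
    simpa using! (hasStrictFDerivAt_norm_sq y).hasFDerivAt.const_sub 1
  have h2 := (hasDerivAt_expNegInvGlue (1 - ‖y‖ ^ 2)).comp_hasFDerivAt y h1
  refine h2.congr_fderiv ?_
  ext v
  simp [moll]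
  ring

/-- The bump function centred at `x` of radius `s`. -/
def bumpAt (x : Eu ι) (s : ℝ) (z : Eu ι) : ℝ := bump (s⁻¹ • (z - x))

lemma bumpAt_nonneg (x : Eu ι) (s : ℝ) (z : Eu ι) : 0 ≤ bumpAt x s z := bump_nonneg _

lemma contDiff_bumpAt (x : Eu ι) (s : ℝ) : ContDiff ℝ (⊤ : ℕ∞) (bumpAt x s) :=
  contDiff_bump.comp ((contDiff_id.sub contDiff_const).const_smul s⁻¹)

lemma gradient_bumpAt (x : Eu ι) (s : ℝ) (z : Eu ι) :
    gradient (bumpAt x s) z = -(s⁻¹ * moll (s⁻¹ • (z - x))) • (s⁻¹ • (z - x)) := by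
  refine HasGradientAt.gradient ?_
  rw [hasGradientAt_iff_hasFDerivAt]
  have h1 : HasFDerivAt (fun z : Eu ι => s⁻¹ • (z - x)) (s⁻¹ • ContinuousLinearMap.id ℝ (Eu ι)) z :=
    ((hasFDerivAt_id z).sub_const x).const_smul s⁻¹
  have h0 : HasGradientAt (bump (ι := ι)) (gradient bump (s⁻¹ • (z - x))) (s⁻¹ • (z - x)) :=
    (contDiff_bump.differentiable (by simp) _).hasGradientAt
  rw [hasGradientAt_iff_hasFDerivAt] at h0
  refine (h0.comp z h1).congr_fderiv ?_
  rw [gradient_bump]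
  ext v
  simp
  ring

lemma bumpAt_eq_zero {x z : Eu ι} {s : ℝ} (hs : 0 < s) (h : s ≤ dist z x) : bumpAt x s z = 0 := by
  refine bump_eq_zero ?_
  rw [norm_smul, norm_inv, Real.norm_of_nonneg hs.le, ← dist_eq_norm, inv_mul_eq_div, one_le_div hs]
  exact h

lemma moll_smul_sub_eq_zero {x z : Eu ι} {s : ℝ} (hs : 0 < s) (h : s ≤ dist z x) :
    moll (s⁻¹ • (z - x)) = 0 := by
  refine moll_eq_zero ?_
  rw [norm_smul, norm_inv, Real.norm_of_nonneg hs.le, ← dist_eq_norm, inv_mul_eq_div, one_le_div hs]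
  exact h

lemma isTest_bumpAt {Ω : Set (Eu ι)} {x : Eu ι} {s : ℝ} (hs : 0 < s)
    (h : Metric.closedBall x s ⊆ Ω) : IsTest Ω (bumpAt x s) := by
  have hsub : tsupport (bumpAt x s) ⊆ Metric.closedBall x s := by
    refine closure_minimal (fun z hz => ?_) Metric.isClosed_closedBall
    by_contra h'
    rw [Metric.mem_closedBall, not_le] at h'
    exact hz (bumpAt_eq_zero hs h'.le)
  exact ⟨contDiff_bumpAt x s, (isCompact_closedBall x s).of_isClosed_subset
    (isClosed_tsupport _) hsub, hsub.trans h⟩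

/-- Change of variables `z = x + s y`. -/
lemma integral_comp_add_smul (F : Eu ι → ℝ) (x : Eu ι) {s : ℝ} (hs : 0 < s) :
    ∫ y, F (x + s • y) = (s ^ Fintype.card ι)⁻¹ * ∫ z, F z := by
  have h := Measure.integral_comp_smul (volume : Measure (Eu ι)) (fun y => F (x + y)) s
  rw [h, integral_add_left_eq_self, finrank_euclideanSpace, abs_of_pos (by positivity), smul_eq_mul]

/-- The unnormalised average of `g` near `x` at scale `s`. -/
def mAvg (g : Eu ι → ℝ) (x : Eu ι) (s : ℝ) : ℝ := ∫ y, moll y * g (x + s • y)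

lemma mAvg_eq (g : Eu ι → ℝ) (x : Eu ι) {s : ℝ} (hs : 0 < s) :
    mAvg g x s = (s ^ Fintype.card ι)⁻¹ * ∫ z, moll (s⁻¹ • (z - x)) * g z := by
  rw [← integral_comp_add_smul _ x hs]
  simp [mAvg, smul_smul, inv_mul_cancel₀ hs.ne']

lemma hasDerivAt_mAvg {g : Eu ι → ℝ} (hg : ContDiff ℝ (⊤ : ℕ∞) g) (hc : HasCompactSupport g)
    (x : Eu ι) (s : ℝ) :
    HasDerivAt (mAvg g x) (∫ y, moll y * ⟪gradient g (x + s • y), y⟫) s := by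
  obtain ⟨B, hB⟩ := (hasCompactSupport_gradient hc).exists_bound_of_continuous
    (continuous_gradient hg)
  have hB0 : 0 ≤ B := (norm_nonneg _).trans (hB 0)
  refine (hasDerivAt_integral_of_dominated_loc_of_deriv_le (μ := volume)
    (F := fun s y => moll y * g (x + s • y))
    (F' := fun s y => moll y * ⟪gradient g (x + s • y), y⟫)
    (bound := fun y => moll y * B) (s := univ) Filter.univ_mem ?_ ?_ ?_ ?_ ?_ ?_).2
  · refine Filter.Eventually.of_forall fun t => Continuous.aestronglyMeasurable ?_
    exact continuous_moll.mul (hg.continuous.comp (by fun_prop))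
  · refine Continuous.integrable_of_hasCompactSupport ?_ hasCompactSupport_moll.mul_right
    exact continuous_moll.mul (hg.continuous.comp (by fun_prop))
  · refine Continuous.aestronglyMeasurable ?_
    exact continuous_moll.mul (((continuous_gradient hg).comp (by fun_prop)).inner continuous_id)
  · refine Filter.Eventually.of_forall fun y t _ => ?_
    rw [norm_mul, Real.norm_of_nonneg (moll_nonneg y)]
    rcases le_or_gt 1 ‖y‖ with h | h
    · simp [moll_eq_zero h]
    · refine mul_le_mul_of_nonneg_left ?_ (moll_nonneg y)
      calc _ ≤ ‖gradient g (x + t • y)‖ * ‖y‖ := norm_inner_le_norm _ _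
        _ ≤ B * 1 := mul_le_mul (hB _) h.le (norm_nonneg _) hB0
        _ = B := mul_one B
  · exact integrable_moll.mul_const B
  · refine Filter.Eventually.of_forall fun y t _ => ?_
    have h1 : HasFDerivAt g (fderiv ℝ g (x + t • y)) (x + t • y) :=
      (hg.differentiable (by simp) _).hasFDerivAt
    have h2 : HasDerivAt (fun t : ℝ => x + t • y) y t := by
      simpa using ((hasDerivAt_id t).smul_const y).const_add x
    have := (h1.comp_hasDerivAt t h2).const_mul (moll y)
    rwa [← inner_gradient_left] at this

/-- Change of variables z = x + s y together with `gradient_bumpAt`. Together with `hasDerivAt_mAvg`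
it expresses the scale derivative of an average as a Dirichlet form against a rescaled bump. -/
lemma integral_moll_inner_gradient (G : Eu ι → Eu ι) (x : Eu ι) {s : ℝ} (hs : 0 < s) :
    ∫ y, moll y * ⟪G (x + s • y), y⟫ =
      -(s * (s ^ Fintype.card ι)⁻¹ * ∫ z, ⟪G z, gradient (bumpAt x s) z⟫) := by
  have h := integral_comp_add_smul (fun z => ⟪G z, gradient (bumpAt x s) z⟫) x hs
  rw [mul_assoc, ← h, ← integral_const_mul, ← integral_neg]
  congr 1 with y
  rw [gradient_bumpAt]
  simp only [add_sub_cancel_left, smul_smul, inv_mul_cancel₀ hs.ne', one_smul,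
    real_inner_smul_right, neg_smul, inner_neg_right]
  field_simp

end

/-! ### L² inequalities and the mollification error -/

section

section general

variable {X : Type*} [MeasurableSpace X] {μ : Measure X} {E : Type*} [NormedAddCommGroup E]

lemma sq_lintegral_le {f : X → ℝ≥0∞} (hf : AEMeasurable f μ) :
    (∫⁻ x, f x ∂μ) ^ 2 ≤ μ univ * ∫⁻ x, f x ^ 2 ∂μ := by
  have h := ENNReal.lintegral_mul_le_Lp_mul_Lq μ (p := 2) (q := 2)
    Real.HolderConjugate.two_two hf (aemeasurable_const (b := (1 : ℝ≥0∞)))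
  simp only [Pi.mul_apply, mul_one, lintegral_const, ENNReal.rpow_ofNat, one_pow,
    one_mul] at h
  calc _ ≤ ((∫⁻ x, f x ^ 2 ∂μ) ^ (1 / 2 : ℝ) * (μ univ) ^ (1 / 2 : ℝ)) ^ 2 := by gcongr
    _ = _ := by
      rw [mul_pow, ← ENNReal.rpow_natCast, ← ENNReal.rpow_natCast, ← ENNReal.rpow_mul,
        ← ENNReal.rpow_mul]
      norm_num
      rw [mul_comm]

/-- Cauchy–Schwarz against the constant 1, for the measure with density `w`. -/
lemma sq_lintegral_mul_le {w f : X → ℝ≥0∞} (hw : Measurable w) (hf : Measurable f) :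
    (∫⁻ x, w x * f x ∂μ) ^ 2 ≤ (∫⁻ x, w x ∂μ) * ∫⁻ x, w x * f x ^ 2 ∂μ := by
  have h := sq_lintegral_le (μ := μ.withDensity w) hf.aemeasurable
  rw [lintegral_withDensity_eq_lintegral_mul _ hw hf,
    lintegral_withDensity_eq_lintegral_mul _ hw (hf.pow_const 2),
    withDensity_apply _ MeasurableSet.univ, setLIntegral_univ] at h
  exact h

lemma enorm_sq_L2 (f : Lp E 2 μ) : ‖f‖ₑ ^ 2 = ∫⁻ x, ‖f x‖ₑ ^ 2 ∂μ := by
  rw [Lp.enorm_def, eLpNorm_eq_lintegral_rpow_enorm_toReal (by norm_num) (by norm_num),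
    ← ENNReal.rpow_natCast, ← ENNReal.rpow_mul]
  norm_num

lemma enorm_sq_toLp {g : X → E} (hg : MemLp g 2 μ) :
    ‖hg.toLp g‖ₑ ^ 2 = ∫⁻ x, ‖g x‖ₑ ^ 2 ∂μ := by
  rw [enorm_sq_L2]
  refine lintegral_congr_ae ?_
  filter_upwards [hg.coeFn_toLp] with x hx
  rw [hx]

lemma enorm_le_of_sq_le {E F : Type*} [NormedAddCommGroup E] [NormedAddCommGroup F] {a : E} {b : F}
    {c : ℝ} (hc : 0 ≤ c) (h : ‖a‖ₑ ^ 2 ≤ ENNReal.ofReal c ^ 2 * ‖b‖ₑ ^ 2) : ‖a‖ ≤ c * ‖b‖ := by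
  rw [← mul_pow, ← ofReal_norm, ← ofReal_norm, ← ENNReal.ofReal_mul hc,
    ← ENNReal.ofReal_pow (by positivity), ← ENNReal.ofReal_pow (by positivity),
    ENNReal.ofReal_le_ofReal_iff (by positivity)] at h
  exact le_of_sq_le_sq h (by positivity)

variable [InnerProductSpace ℝ E]

lemma inner_toLp {f g : X → E} (hf : MemLp f 2 μ) (hg : MemLp g 2 μ) :
    ⟪hf.toLp f, hg.toLp g⟫ = ∫ x, ⟪f x, g x⟫ ∂μ := by
  rw [L2.inner_def]
  refine integral_congr_ae ?_
  filter_upwards [hf.coeFn_toLp, hg.coeFn_toLp] with x h1 h2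
  rw [h1, h2]

lemma inner_toLp_right {g : X → E} (f : Lp E 2 μ) (hg : MemLp g 2 μ) :
    ⟪f, hg.toLp g⟫ = ∫ x, ⟪f x, g x⟫ ∂μ := by
  rw [L2.inner_def]
  refine integral_congr_ae ?_
  filter_upwards [hg.coeFn_toLp] with x h2
  rw [h2]

lemma norm_sq_toLp {g : X → ℝ} (hg : MemLp g 2 μ) :
    ‖hg.toLp g‖ ^ 2 = ∫ x, g x ^ 2 ∂μ := by
  rw [← real_inner_self_eq_norm_sq, inner_toLp]
  simp [pow_two]

end general

variable {ι : Type} [Fintype ι]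

/-- Write the increment as an integral of the gradient along the segment, apply Cauchy–Schwarz in
the parameter, and exchange integrals; translation invariance removes the shift. -/
lemma lintegral_sub_translate_le {g : Eu ι → ℝ} (hg : ContDiff ℝ (⊤ : ℕ∞) g) (v : Eu ι) :
    ∫⁻ x, ‖g (x + v) - g x‖ₑ ^ 2 ≤ ‖v‖ₑ ^ 2 * ∫⁻ x, ‖gradient g x‖ₑ ^ 2 := by
  have hcg := continuous_gradient hg
  have h1 : ∀ x, ‖g (x + v) - g x‖ₑ ^ 2 ≤
      ∫⁻ t in Ioc (0 : ℝ) 1, (‖gradient g (x + t • v)‖ₑ * ‖v‖ₑ) ^ 2 := by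
    intro x
    have hd : ∀ t : ℝ, HasDerivAt (fun t : ℝ => g (x + t • v)) ⟪gradient g (x + t • v), v⟫ t := by
      intro t
      have h1 : HasFDerivAt g (fderiv ℝ g (x + t • v)) (x + t • v) :=
        (hg.differentiable (by simp) _).hasFDerivAt
      have h2 : HasDerivAt (fun t : ℝ => x + t • v) v t := by
        simpa using ((hasDerivAt_id t).smul_const v).const_add x
      have := h1.comp_hasDerivAt t h2
      rwa [← inner_gradient_left] at this
    have hcont : Continuous (fun t : ℝ => ⟪gradient g (x + t • v), v⟫) :=
      (hcg.comp (by fun_prop)).inner continuous_const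
    have h2 : g (x + v) - g x = ∫ t in Ioc (0 : ℝ) 1, ⟪gradient g (x + t • v), v⟫ := by
      rw [← intervalIntegral.integral_of_le zero_le_one,
        intervalIntegral.integral_eq_sub_of_hasDerivAt (fun t _ => hd t)
          (hcont.intervalIntegrable _ _)]
      simp
    have h3 : ‖g (x + v) - g x‖ₑ ≤ ∫⁻ t in Ioc (0 : ℝ) 1, ‖gradient g (x + t • v)‖ₑ * ‖v‖ₑ := by
      rw [h2]
      refine (enorm_integral_le_lintegral_enorm _).trans (lintegral_mono fun t => ?_)
      rw [← enorm_norm (gradient g _), ← enorm_norm v, ← enorm_mul]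
      rw [enorm_le_iff_norm_le, norm_mul, norm_norm, norm_norm]
      exact norm_inner_le_norm _ _
    calc _ ≤ (∫⁻ t in Ioc (0 : ℝ) 1, ‖gradient g (x + t • v)‖ₑ * ‖v‖ₑ) ^ 2 := by gcongr
      _ ≤ _ := by
        refine (sq_lintegral_le ?_).trans ?_
        · have : Continuous (fun t : ℝ => gradient g (x + t • v)) := hcg.comp (by fun_prop)
          exact (this.enorm.measurable.mul_const _).aemeasurable
        · simp
  calc ∫⁻ x, ‖g (x + v) - g x‖ₑ ^ 2
      ≤ ∫⁻ x, ∫⁻ t in Ioc (0 : ℝ) 1, (‖gradient g (x + t • v)‖ₑ * ‖v‖ₑ) ^ 2 := lintegral_mono h1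
    _ = ∫⁻ t in Ioc (0 : ℝ) 1, ∫⁻ x, (‖gradient g (x + t • v)‖ₑ * ‖v‖ₑ) ^ 2 := by
        refine lintegral_lintegral_swap ?_
        have : Continuous (fun p : Eu ι × ℝ => gradient g (p.1 + p.2 • v)) :=
          hcg.comp (by fun_prop)
        exact ((this.enorm.measurable.mul_const _).pow_const 2).aemeasurable
    _ = ∫⁻ t in Ioc (0 : ℝ) 1, ‖v‖ₑ ^ 2 * ∫⁻ x, ‖gradient g x‖ₑ ^ 2 := by
        refine lintegral_congr fun t => ?_
        rw [← lintegral_add_right_eq_self (fun x => ‖gradient g x‖ₑ ^ 2) (t • v),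
          ← lintegral_const_mul']
        · simp_rw [mul_pow, mul_comm]
        · simp
    _ = _ := by simp

lemma lintegral_moll : ∫⁻ y : Eu ι, ENNReal.ofReal (moll y) = ENNReal.ofReal (mollMass ι) :=
  (ofReal_integral_eq_lintegral_ofReal integrable_moll
    (Filter.Eventually.of_forall moll_nonneg)).symm

/-- The mollification error is controlled by the gradient. -/
lemma lintegral_mAvg_sub_le {g : Eu ι → ℝ} (hg : ContDiff ℝ (⊤ : ℕ∞) g) {s : ℝ} (hs : 0 ≤ s) :
    ∫⁻ x, ‖g x - (mollMass ι)⁻¹ * mAvg g x s‖ₑ ^ 2 ≤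
      ENNReal.ofReal s ^ 2 * ∫⁻ x, ‖gradient g x‖ₑ ^ 2 := by
  have hm := mollMass_pos ι
  have hmm : Measurable fun y : Eu ι => ENNReal.ofReal (moll y) :=
    continuous_moll.measurable.ennreal_ofReal
  have h1 : ∀ x, ‖g x - (mollMass ι)⁻¹ * mAvg g x s‖ₑ ^ 2 ≤ ENNReal.ofReal (mollMass ι)⁻¹ *
      ∫⁻ y, ENNReal.ofReal (moll y) * ‖g (x + s • y) - g x‖ₑ ^ 2 := by
    intro x
    have e1 : g x - (mollMass ι)⁻¹ * mAvg g x s =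
        -((mollMass ι)⁻¹ * ∫ y, moll y * (g (x + s • y) - g x)) := by
      simp_rw [mul_sub]
      rw [integral_sub, integral_mul_const, ← mollMass, ← mAvg]
      · field_simp; ring
      · refine Continuous.integrable_of_hasCompactSupport ?_ hasCompactSupport_moll.mul_right
        exact continuous_moll.mul (hg.continuous.comp (by fun_prop))
      · exact integrable_moll.mul_const _
    have e2 : ‖∫ y, moll y * (g (x + s • y) - g x)‖ₑ ^ 2 ≤ ENNReal.ofReal (mollMass ι) *
        ∫⁻ y, ENNReal.ofReal (moll y) * ‖g (x + s • y) - g x‖ₑ ^ 2 := by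
      rw [← lintegral_moll]
      refine le_trans ?_ (sq_lintegral_mul_le hmm ?_)
      · gcongr
        refine (enorm_integral_le_lintegral_enorm _).trans_eq (lintegral_congr fun y => ?_)
        rw [enorm_mul, Real.enorm_of_nonneg (moll_nonneg y)]
      · have : Continuous fun y : Eu ι => g (x + s • y) - g x :=
          (hg.continuous.comp (by fun_prop)).sub continuous_const
        exact this.enorm.measurable
    rw [e1, enorm_neg, enorm_mul, mul_pow, Real.enorm_of_nonneg (by positivity)]
    calc _ ≤ ENNReal.ofReal (mollMass ι)⁻¹ ^ 2 * (ENNReal.ofReal (mollMass ι) *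
        ∫⁻ y, ENNReal.ofReal (moll y) * ‖g (x + s • y) - g x‖ₑ ^ 2) := by gcongr
      _ = _ := by
        rw [← mul_assoc, ← ENNReal.ofReal_pow (by positivity), ← ENNReal.ofReal_mul (by positivity)]
        congr 2
        field_simp
  calc _ ≤ ∫⁻ x, ENNReal.ofReal (mollMass ι)⁻¹ *
      ∫⁻ y, ENNReal.ofReal (moll y) * ‖g (x + s • y) - g x‖ₑ ^ 2 := lintegral_mono h1
    _ = ENNReal.ofReal (mollMass ι)⁻¹ *
      ∫⁻ y, ENNReal.ofReal (moll y) * ∫⁻ x, ‖g (x + s • y) - g x‖ₑ ^ 2 := by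
        rw [lintegral_const_mul' _ _ ENNReal.ofReal_ne_top, lintegral_lintegral_swap]
        · congr 2 with y
          rw [lintegral_const_mul' _ _ ENNReal.ofReal_ne_top]
        · have : Continuous fun p : Eu ι × Eu ι => g (p.1 + s • p.2) - g p.1 :=
            (hg.continuous.comp (by fun_prop)).sub (hg.continuous.comp continuous_fst)
          exact ((hmm.comp measurable_snd).mul (this.enorm.measurable.pow_const 2)).aemeasurable
    _ ≤ ENNReal.ofReal (mollMass ι)⁻¹ * ∫⁻ y : Eu ι, ENNReal.ofReal (moll y) *
          (ENNReal.ofReal s ^ 2 * ∫⁻ x, ‖gradient g x‖ₑ ^ 2) := by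
        refine mul_le_mul_right (lintegral_mono fun y => ?_) _
        rcases le_or_gt 1 ‖y‖ with h | h
        · simp [moll_eq_zero h]
        · refine mul_le_mul_right ((lintegral_sub_translate_le hg (s • y)).trans ?_) _
          gcongr
          rw [← ofReal_norm, norm_smul, Real.norm_of_nonneg hs]
          exact ENNReal.ofReal_le_ofReal (mul_le_of_le_one_right hs h.le)
    _ = _ := by
        rw [lintegral_mul_const _ hmm, lintegral_moll, ← mul_assoc,
          ← ENNReal.ofReal_mul (by positivity), inv_mul_cancel₀ hm.ne']
        simp

end

/-! ### Mollification as an operator on L²(Ω) -/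

section

variable {ι : Type} [Fintype ι]

/-- The mollification kernel. -/
def kerFn (x : Eu ι) (s : ℝ) (z : Eu ι) : ℝ :=
  (mollMass ι)⁻¹ * (s ^ Fintype.card ι)⁻¹ * moll (s⁻¹ • (z - x))

lemma kerFn_nonneg (x : Eu ι) {s : ℝ} (hs : 0 < s) (z : Eu ι) : 0 ≤ kerFn x s z := by
  have := mollMass_pos ι
  have := moll_nonneg (s⁻¹ • (z - x))
  unfold kerFn; positivity

lemma continuous_kerFn_left (s : ℝ) (z : Eu ι) : Continuous fun x : Eu ι => kerFn x s z := by
  unfold kerFn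
  exact continuous_const.mul (continuous_moll.comp (by fun_prop))

lemma continuous_kerFn_right (x : Eu ι) (s : ℝ) : Continuous (kerFn x s) := by
  unfold kerFn
  exact continuous_const.mul (continuous_moll.comp (by fun_prop))

variable (ι) in
lemma exists_kerFn_le : ∃ R : ℝ, 0 < R ∧ ∀ (x : Eu ι) (s : ℝ), 0 < s → ∀ z,
    kerFn x s z ≤ R * (s ^ Fintype.card ι)⁻¹ := by
  obtain ⟨R, hR, h⟩ := exists_moll_le ι
  have hm := mollMass_pos ι
  refine ⟨(mollMass ι)⁻¹ * R, by positivity, fun x s hs z => ?_⟩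
  unfold kerFn
  calc _ ≤ (mollMass ι)⁻¹ * (s ^ Fintype.card ι)⁻¹ * R := by gcongr; exact h _
    _ = _ := by ring

lemma integral_kerFn_mul (g : Eu ι → ℝ) (x : Eu ι) {s : ℝ} (hs : 0 < s) :
    ∫ z, kerFn x s z * g z = (mollMass ι)⁻¹ * mAvg g x s := by
  rw [mAvg_eq g x hs, ← mul_assoc, ← integral_const_mul]
  simp [kerFn, mul_assoc]

variable (Ω : Set (Eu ι)) [IsFiniteMeasure ((volume : Measure (Eu ι)).restrict Ω)]

lemma memLp_kerFn (x : Eu ι) {s : ℝ} (hs : 0 < s) (p : ℝ≥0∞) :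
    MemLp (kerFn x s) p (volume.restrict Ω) := by
  obtain ⟨R, hR, h⟩ := exists_kerFn_le ι
  refine MemLp.of_bound (continuous_kerFn_right x s).aestronglyMeasurable
    (R * (s ^ Fintype.card ι)⁻¹) (Filter.Eventually.of_forall fun z => ?_)
  rw [Real.norm_of_nonneg (kerFn_nonneg x hs z)]
  exact h x s hs z

/-- The mollification of `f`, extended by zero outside `Ω`. -/
def jAvg (s : ℝ) (f : L2 Ω) (x : Eu ι) : ℝ := ∫ z in Ω, kerFn x s z * f z

variable {Ω}

lemma jAvg_eq_inner {s : ℝ} (hs : 0 < s) (f : L2 Ω) (x : Eu ι) :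
    jAvg Ω s f x = ⟪(memLp_kerFn Ω x hs 2).toLp (kerFn x s), f⟫ := by
  rw [real_inner_comm, inner_toLp_right]
  simp [jAvg]

lemma continuous_jAvg {s : ℝ} (hs : 0 < s) (f : L2 Ω) : Continuous (jAvg Ω s f) := by
  obtain ⟨R, hR, h⟩ := exists_kerFn_le ι
  have hf : Integrable f (volume.restrict Ω) := (Lp.memLp f).integrable (by norm_num)
  refine continuous_of_dominated (bound := fun z => R * (s ^ Fintype.card ι)⁻¹ * ‖f z‖) ?_ ?_ ?_ ?_
  · exact fun x => (continuous_kerFn_right x s).aestronglyMeasurable.mul hf.1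
  · refine fun x => Filter.Eventually.of_forall fun z => ?_
    rw [norm_mul, Real.norm_of_nonneg (kerFn_nonneg x hs z)]
    exact mul_le_mul_of_nonneg_right (h x s hs z) (norm_nonneg _)
  · exact hf.norm.const_mul _
  · exact Filter.Eventually.of_forall fun z => (continuous_kerFn_left s z).mul continuous_const

variable (Ω) in
lemma exists_norm_kerL2_le : ∃ A : ℝ, 0 < A ∧ ∀ (x : Eu ι) (s : ℝ) (hs : 0 < s),
    ‖(memLp_kerFn Ω x hs 2).toLp (kerFn x s)‖ ≤ A * (s ^ Fintype.card ι)⁻¹ := by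
  obtain ⟨R, hR, h⟩ := exists_kerFn_le ι
  set V := (measureUnivNNReal ((volume : Measure (Eu ι)).restrict Ω) : ℝ) ^ (2 : ℝ≥0∞).toReal⁻¹
  have hV : 0 ≤ V := by positivity
  refine ⟨(V + 1) * R, by positivity, fun x s hs => ?_⟩
  have := Lp.norm_le_of_ae_bound (f := (memLp_kerFn Ω x hs 2).toLp (kerFn x s))
    (C := R * (s ^ Fintype.card ι)⁻¹) (by positivity) (by
      filter_upwards [(memLp_kerFn Ω x hs 2).coeFn_toLp] with z hz
      rw [hz, Real.norm_of_nonneg (kerFn_nonneg x hs z)]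
      exact h x s hs z)
  refine this.trans ?_
  rw [mul_assoc]
  gcongr
  change V ≤ V + 1
  linarith

lemma memLp_jAvg {s : ℝ} (hs : 0 < s) (f : L2 Ω) : MemLp (jAvg Ω s f) 2 (volume.restrict Ω) := by
  obtain ⟨A, hA, h⟩ := exists_norm_kerL2_le Ω
  refine MemLp.of_bound (continuous_jAvg hs f).aestronglyMeasurable
    (A * (s ^ Fintype.card ι)⁻¹ * ‖f‖) (Filter.Eventually.of_forall fun x => ?_)
  rw [jAvg_eq_inner hs]
  exact (norm_inner_le_norm _ _).trans (by gcongr; exact h x s hs)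

variable (Ω) in
/-- Mollification as an operator on `L²(Ω)`. -/
def jOp {s : ℝ} (hs : 0 < s) : L2 Ω →L[ℝ] L2 Ω :=
  LinearMap.mkContinuousOfExistsBound
    { toFun := fun f => (memLp_jAvg hs f).toLp (jAvg Ω s f)
      map_add' := fun f g => by
        rw [← MemLp.toLp_add]
        refine MemLp.toLp_congr _ _ (Filter.Eventually.of_forall fun x => ?_)
        simp only [jAvg_eq_inner hs, inner_add_right, Pi.add_apply]
      map_smul' := fun c f => by
        rw [RingHom.id_apply, ← MemLp.toLp_const_smul]
        refine MemLp.toLp_congr _ _ (Filter.Eventually.of_forall fun x => ?_)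
        simp only [jAvg_eq_inner hs, inner_smul_right, Pi.smul_apply, smul_eq_mul] }
    (by
      obtain ⟨A, hA, h⟩ := exists_norm_kerL2_le Ω
      refine ⟨(measureUnivNNReal ((volume : Measure (Eu ι)).restrict Ω) : ℝ) ^
        (2 : ℝ≥0∞).toReal⁻¹ * (A * (s ^ Fintype.card ι)⁻¹), fun f => ?_⟩
      have := Lp.norm_le_of_ae_bound (f := (memLp_jAvg hs f).toLp (jAvg Ω s f))
        (C := A * (s ^ Fintype.card ι)⁻¹ * ‖f‖) (by positivity) (by
          filter_upwards [(memLp_jAvg hs f).coeFn_toLp] with x hx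
          rw [hx, jAvg_eq_inner hs]
          exact (norm_inner_le_norm _ _).trans (by gcongr; exact h x s hs))
      rw [mul_assoc]
      exact this)

lemma jOp_apply {s : ℝ} (hs : 0 < s) (f : L2 Ω) :
    jOp Ω hs f = (memLp_jAvg hs f).toLp (jAvg Ω s f) := rfl

variable (Ω) in
/-- Hilbert–Schmidt bound for the mollification operators. -/
lemma exists_sum_norm_sq_jOp_le : ∃ A : ℝ, 0 < A ∧ ∀ (s : ℝ) (hs : 0 < s) {κ : Type}
    (e : κ → L2 Ω) (_ : Orthonormal ℝ e) (F : Finset κ),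
    ∑ i ∈ F, ‖jOp Ω hs (e i)‖ ^ 2 ≤ A * ((s ^ Fintype.card ι)⁻¹) ^ 2 := by
  obtain ⟨A, hA, h⟩ := exists_norm_kerL2_le Ω
  set V := (volume.restrict Ω).real (univ : Set (Eu ι))
  have hV : 0 ≤ V := measureReal_nonneg
  refine ⟨(V + 1) * A ^ 2, by positivity, fun s hs κ e he F => ?_⟩
  have hint : ∀ i ∈ F, Integrable (fun x => jAvg Ω s (e i) x ^ 2) (volume.restrict Ω) :=
    fun i _ => (memLp_jAvg hs (e i)).integrable_sq
  calc ∑ i ∈ F, ‖jOp Ω hs (e i)‖ ^ 2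
      = ∫ x in Ω, ∑ i ∈ F, jAvg Ω s (e i) x ^ 2 := by
        rw [integral_finsetSum _ hint]
        simp_rw [jOp_apply, norm_sq_toLp]
    _ ≤ ∫ x in Ω, (A * (s ^ Fintype.card ι)⁻¹) ^ 2 := by
        refine integral_mono (integrable_finsetSum _ hint) (integrable_const _) fun x => ?_
        -- For each x the values of the mollified e_i are the inner products of e_i with the kernel
        -- at x. Bessel's inequality bounds their square sum by the squared norm of that kernel.
        refine le_trans ?_ (pow_le_pow_left₀ (norm_nonneg _) (h x s hs) 2)
        refine le_trans (le_of_eq ?_) (he.sum_inner_products_le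
          ((memLp_kerFn Ω x hs 2).toLp (kerFn x s)) (s := F))
        refine Finset.sum_congr rfl fun i _ => ?_
        rw [jAvg_eq_inner hs, real_inner_comm, Real.norm_eq_abs, sq_abs]
    _ = V * A ^ 2 * ((s ^ Fintype.card ι)⁻¹) ^ 2 := by
        rw [integral_const, smul_eq_mul]; ring
    _ ≤ _ := by gcongr; linarith

omit [IsFiniteMeasure ((volume : Measure (Eu ι)).restrict Ω)] in
lemma IsTest.jAvg_eq {φ : Eu ι → ℝ} (h : IsTest Ω φ) {s : ℝ} (hs : 0 < s) (x : Eu ι) :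
    jAvg Ω s (h10Fn h.toH10) x = (mollMass ι)⁻¹ * mAvg φ x s := by
  rw [← integral_kerFn_mul _ _ hs, jAvg]
  refine Eq.trans (integral_congr_ae ?_) (setIntegral_eq_integral_of_forall_compl_eq_zero
    (s := Ω) (fun z hz => by rw [h.eq_zero_of_notMem hz, mul_zero]))
  filter_upwards [h.coeFn_h10Fn] with z hz
  rw [hz]

/-- A test function extended by zero is smooth on the whole space, where its mollification error is
known. Density then reaches all of H¹₀ with no condition on the boundary. -/
lemma norm_sub_jOp_le {s : ℝ} (hs : 0 < s) (w : H10 Ω) :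
    ‖h10Fn w - jOp Ω hs (h10Fn w)‖ ≤ s * ‖h10Grad w‖ := by
  induction w using H10.induction with
  | hp =>
    exact isClosed_le (continuous_h10Fn.sub ((jOp Ω hs).continuous.comp continuous_h10Fn)).norm
      (continuous_const.mul continuous_h10Grad.norm)
  | h φ h =>
    refine enorm_le_of_sq_le hs.le ?_
    have e : h10Fn h.toH10 - jOp Ω hs (h10Fn h.toH10) = (h.memLp.sub
        (memLp_jAvg hs (h10Fn h.toH10))).toLp _ := by
      rw [MemLp.toLp_sub h.memLp (memLp_jAvg hs (h10Fn h.toH10))]; rfl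
    rw [e, enorm_sq_toLp, h.h10Grad_toH10, enorm_sq_toLp]
    calc _ ≤ ∫⁻ x, ‖φ x - (mollMass ι)⁻¹ * mAvg φ x s‖ₑ ^ 2 := by
          refine (lintegral_mono fun x => ?_).trans (setLIntegral_le_lintegral Ω _)
          simp only [Pi.sub_apply, h.jAvg_eq hs]; rfl
      _ ≤ _ := lintegral_mAvg_sub_le h.1 hs.le
      _ = _ := by
        congr 1
        refine (setLIntegral_eq_of_support_subset ?_).symm
        intro x hx
        by_contra h'
        simp [h.gradient_eq_zero_of_notMem h'] at hx

end

/-! ### Compact embedding, eigenbasis and eigenvalue counting -/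

section

section abstract_spectral

variable {H : Type} [NormedAddCommGroup H] [InnerProductSpace ℝ H] [CompleteSpace H]

omit [CompleteSpace H] in
lemma norm_sum_inner_smul_le {κ : Type} {e : κ → H} (he : Orthonormal ℝ e) (g : κ → H)
    (F : Finset κ) {ε : ℝ} (hε : 0 ≤ ε) (hF : ∑ i ∈ F, ‖g i‖ ^ 2 ≤ ε ^ 2) (f : H) :
    ‖∑ i ∈ F, ⟪e i, f⟫ • g i‖ ≤ ε * ‖f‖ := by
  have h1 : ‖∑ i ∈ F, ⟪e i, f⟫ • g i‖ ≤ ∑ i ∈ F, ‖⟪e i, f⟫‖ * ‖g i‖ :=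
    (norm_sum_le _ _).trans (Finset.sum_le_sum fun i _ => (norm_smul _ _).le)
  have h2 : (∑ i ∈ F, ‖⟪e i, f⟫‖ * ‖g i‖) ^ 2 ≤ (ε * ‖f‖) ^ 2 := by
    refine (Finset.sum_mul_sq_le_sq_mul_sq F _ _).trans ?_
    rw [mul_pow, mul_comm]
    exact mul_le_mul hF (he.sum_inner_products_le f) (Finset.sum_nonneg fun i _ => sq_nonneg _)
      (sq_nonneg _)
  exact h1.trans (le_of_sq_le_sq h2 (by positivity))

/-- The finite-rank truncations along a Hilbert basis converge in operator norm: by Cauchy–Schwarz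
and Bessel the error is governed by tails of the convergent series ∑ ‖K b_i‖². -/
lemma isCompactOperator_of_hilbertSchmidt (K : H →L[ℝ] H) {A : ℝ}
    (h : ∀ {κ : Type} (e : κ → H) (_ : Orthonormal ℝ e) (F : Finset κ),
      ∑ i ∈ F, ‖K (e i)‖ ^ 2 ≤ A) : IsCompactOperator K := by
  classical
  obtain ⟨w, b, -⟩ := exists_hilbertBasis ℝ H
  have hsum : Summable fun i => ‖K (b i)‖ ^ 2 :=
    summable_of_sum_le (fun i => sq_nonneg _) (h b b.orthonormal)
  let P : Finset w → H →L[ℝ] H := fun F => ∑ i ∈ F, (innerSL ℝ (b i)).smulRight (K (b i))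
  have hP : ∀ F f, P F f = ∑ i ∈ F, ⟪b i, f⟫ • K (b i) := fun F f => by
    simp [P]
  have hPc : ∀ F, IsCompactOperator (P F) := by
    intro F
    induction F using Finset.cons_induction with
    | empty => simpa [P] using isCompactOperator_zero
    | cons i F hi ih =>
      have h1 : IsCompactOperator ((innerSL ℝ (b i)).smulRight (K (b i))) :=
        (isCompactOperator_of_locallyCompactSpace_rng
          (ContinuousLinearMap.toSpanSingleton ℝ (K (b i)))).comp_clm (innerSL ℝ (b i))
      have h2 : P (Finset.cons i F hi) = (innerSL ℝ (b i)).smulRight (K (b i)) + P F :=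
        Finset.sum_cons hi
      rw [h2]
      exact h1.add ih
  refine isCompactOperator_of_tendsto (l := Filter.atTop) (F := P) ?_
    (Filter.Eventually.of_forall hPc)
  refine tendsto_iff_norm_sub_tendsto_zero.2 ?_
  rw [Metric.tendsto_atTop]
  intro ε hε
  obtain ⟨s, hs⟩ := summable_iff_vanishing_norm.1 hsum ((ε / 2) ^ 2) (by positivity)
  refine ⟨s, fun F hF => ?_⟩
  rw [dist_zero_right, norm_norm, norm_sub_rev]
  refine lt_of_le_of_lt (ContinuousLinearMap.opNorm_le_bound _ (by positivity) fun f => ?_)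
    (half_lt_self hε)
  have hlim : Filter.Tendsto (fun G => ‖P G f - P F f‖) Filter.atTop (nhds ‖(K - P F) f‖) := by
    have h1 := (b.hasSum_repr f).mapL K
    simp only [b.repr_apply_apply, map_smul] at h1
    refine (Filter.Tendsto.sub_const ?_ _).norm
    simpa only [hP] using! h1
  refine le_of_tendsto hlim ?_
  filter_upwards [Filter.eventually_ge_atTop F] with G hG
  rw [hP, hP, ← Finset.sum_sdiff hG, add_sub_cancel_right]
  refine norm_sum_inner_smul_le b.orthonormal _ _ (by positivity) ?_ f
  have := hs (G \ F) (Finset.disjoint_left.2 fun i hi hi' => (Finset.mem_sdiff.1 hi).2 (hF hi'))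
  exact (le_abs_self _).trans this.le

variable {V : Type} [NormedAddCommGroup V] [InnerProductSpace ℝ V] [CompleteSpace V]

/-- The eigenbasis of a compactly embedded form domain. -/
lemma exists_hilbertBasis_of_compact (j : V →L[ℝ] H) (hj : IsCompactOperator j)
    (hd : ∀ f : H, (∀ v, ⟪f, j v⟫ = 0) → f = 0) :
    ∃ (κ : Type) (b : HilbertBasis κ ℝ H) (W : κ → V) (lam : κ → ℝ),
      (∀ i, j (W i) = b i) ∧ ∀ i v, ⟪W i, v⟫ = lam i * ⟪b i, j v⟫ := by
  -- T = j j* is compact and symmetric, and injective because the range of j is dense. Its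
  -- eigenvectors therefore span, and μ⁻¹ j* v is a preimage of an eigenvector v in the form domain.
  let T : H →L[ℝ] H := j.comp (ContinuousLinearMap.adjoint j)
  have hTc : IsCompactOperator T := hj.comp_clm _
  have hTs : T.IsSymmetric := by
    intro x y
    change ⟪j _, y⟫ = ⟪x, j _⟫
    rw [← ContinuousLinearMap.adjoint_inner_left, ← ContinuousLinearMap.adjoint_inner_right]
    rfl
  have hT0 : ∀ f, T f = 0 → f = 0 := by
    intro f hf
    have h1 : ContinuousLinearMap.adjoint j f = 0 := by
      rw [← inner_self_eq_zero (𝕜 := ℝ), ContinuousLinearMap.adjoint_inner_right]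
      change ⟪T f, f⟫ = 0
      rw [hf, inner_zero_left]
    refine hd f fun v => ?_
    rw [← ContinuousLinearMap.adjoint_inner_left, h1, inner_zero_left]
  let E : ℝ → Submodule ℝ H := fun μ => Module.End.eigenspace (T : Module.End ℝ H) μ
  have hE : ∀ μ x, x ∈ E μ ↔ T x = μ • x := fun μ x => Module.End.mem_eigenspace_iff
  have hEc : ∀ μ, CompleteSpace (E μ) := by
    intro μ
    have : IsClosed (E μ : Set H) := by
      have h1 : (E μ : Set H) = {x | T x = μ • x} := by ext x; exact hE μ x
      rw [h1]
      exact isClosed_eq T.continuous (continuous_const_smul μ)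
    exact this.completeSpace_coe
  choose w B hB using fun μ => exists_hilbertBasis ℝ (E μ)
  -- The index runs over every real μ; a μ that is not an eigenvalue has the zero eigenspace and
  -- contributes no basis vector.
  let κ : Type := Σ μ, w μ
  let v : κ → H := fun a => (B a.1 a.2 : H)
  have hv : Orthonormal ℝ v :=
    hTs.orthogonalFamily_eigenspaces.orthonormal_sigma_orthonormal
      (v_family := fun μ (i : w μ) => B μ i) fun μ => (B μ).orthonormal
  have htot : (Submodule.span ℝ (Set.range v))ᗮ = ⊥ := by
    rw [Submodule.eq_bot_iff]
    intro x hx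
    rw [Submodule.mem_orthogonal'] at hx
    have h1 : x ∈ (⨆ μ, E μ)ᗮ := by
      rw [Submodule.mem_orthogonal]
      intro u hu
      refine Submodule.iSup_induction E (motive := fun u => ⟪u, x⟫ = 0) hu ?_ (by simp) ?_
      · intro μ y hy
        have h2 := ((B μ).hasSum_repr ⟨y, hy⟩).mapL ((innerSL ℝ x).comp (E μ).subtypeL)
        have h3 : (fun i => ((innerSL ℝ x).comp (E μ).subtypeL)
            (((B μ).repr ⟨y, hy⟩) i • B μ i)) = fun _ => 0 := by
          funext i
          have h4 : ⟪x, (B μ i : H)⟫ = 0 := hx _ (Submodule.subset_span ⟨⟨μ, i⟩, rfl⟩)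
          rw [map_smul]
          simp [h4]
        rw [h3] at h2
        have h5 := h2.unique hasSum_zero
        rw [real_inner_comm]
        exact h5
      · intro a b ha hb
        rw [inner_add_left, ha, hb, add_zero]
    have h2 := ContinuousLinearMap.orthogonalComplement_iSup_eigenspaces_eq_bot hTc hTs
    change (⨆ μ, E μ)ᗮ = ⊥ at h2
    rw [h2] at h1
    exact h1
  let b := HilbertBasis.mkOfOrthogonalEqBot hv htot
  have hb : ∀ a, b a = v a := fun a => by
    rw [HilbertBasis.coe_mkOfOrthogonalEqBot]
  have hTv : ∀ a : κ, T (v a) = a.1 • v a := fun a => (hE _ _).1 (B a.1 a.2).2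
  have hμ : ∀ a : κ, a.1 ≠ 0 := by
    intro a ha
    have h1 := hT0 (v a) (by rw [hTv, ha, zero_smul])
    have h2 := hv.1 a
    rw [h1, norm_zero] at h2
    exact zero_ne_one h2
  refine ⟨κ, b, fun a => a.1⁻¹ • ContinuousLinearMap.adjoint j (v a), fun a => a.1⁻¹, ?_, ?_⟩
  · intro a
    rw [map_smul, hb]
    change a.1⁻¹ • T (v a) = v a
    rw [hTv, smul_smul, inv_mul_cancel₀ (hμ a), one_smul]
  · intro a u
    rw [real_inner_smul_left, ContinuousLinearMap.adjoint_inner_left, hb]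

end abstract_spectral

variable {ι : Type} [Fintype ι] {Ω : Set (Eu ι)}
  [IsFiniteMeasure ((volume : Measure (Eu ι)).restrict Ω)]

/-- Mollification at scale 1/(n+1) is Hilbert–Schmidt on L²(Ω), and on H¹₀ it is within 1/(n+1) of
the embedding in operator norm. A norm limit of compact operators is compact. -/
lemma isCompactOperator_fnL : IsCompactOperator (fnL Ω) := by
  obtain ⟨A, hA, h⟩ := exists_sum_norm_sq_jOp_le Ω
  have hpos : ∀ n : ℕ, (0 : ℝ) < 1 / ((n : ℝ) + 1) := fun n => by positivity
  refine isCompactOperator_of_tendsto (l := Filter.atTop)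
    (F := fun n : ℕ => (jOp Ω (hpos n)).comp (fnL Ω)) ?_ (Filter.Eventually.of_forall fun n =>
      (isCompactOperator_of_hilbertSchmidt _ (h _ (hpos n))).comp_clm (fnL Ω))
  refine (tendsto_iff_norm_sub_tendsto_zero (E := H10 Ω →L[ℝ] L2 Ω)).2 ?_
  refine squeeze_zero (fun n => norm_nonneg ((jOp Ω (hpos n)).comp (fnL Ω) - fnL Ω)) (fun n => ?_)
    tendsto_one_div_add_atTop_nhds_zero_nat
  refine ContinuousLinearMap.opNorm_le_bound _ (hpos n).le fun w => ?_
  change ‖jOp Ω (hpos n) (h10Fn w) - h10Fn w‖ ≤ _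
  rw [norm_sub_rev]
  refine (norm_sub_jOp_le (hpos n) w).trans ?_
  gcongr
  refine le_of_sq_le_sq ?_ (norm_nonneg w)
  rw [← real_inner_self_eq_norm_sq w, inner_H10, real_inner_self_eq_norm_sq,
    real_inner_self_eq_norm_sq]
  nlinarith [sq_nonneg ‖h10Fn w‖]

lemma eq_zero_of_inner_h10Fn_eq_zero (hΩ : IsOpen Ω) (f : L2 Ω)
    (h : ∀ v : H10 Ω, ⟪f, h10Fn v⟫ = 0) : f = 0 := by
  have hf : Integrable f (volume.restrict Ω) := (Lp.memLp f).integrable (by norm_num)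
  have h1 := hΩ.ae_eq_zero_of_integral_contDiff_smul_eq_zero (μ := volume) (f := f)
    (IntegrableOn.locallyIntegrableOn hf) (fun g hg hc hs => by
      have ht : IsTest Ω g := ⟨hg, hc, hs⟩
      have h2 := h ht.toH10
      rw [ht.h10Fn_toH10, inner_toLp_right] at h2
      rw [← setIntegral_eq_integral_of_forall_compl_eq_zero (s := Ω)
        (fun z hz => by rw [ht.eq_zero_of_notMem hz, zero_smul]), ← h2]
      rfl)
  rw [Lp.eq_zero_iff_ae_eq_zero]
  exact (ae_restrict_iff' hΩ.measurableSet).2 h1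

/-- A Dirichlet eigenbasis. -/
structure EigenBasis (Ω : Set (Eu ι)) where
  /-- the index set -/
  κ : Type
  /-- the eigenfunctions -/
  b : HilbertBasis κ ℝ (L2 Ω)
  /-- the eigenfunctions with their weak gradients -/
  W : κ → H10 Ω
  /-- the eigenvalues -/
  lam : κ → ℝ
  fn_W : ∀ i, h10Fn (W i) = b i
  eigen : ∀ i v, ⟪h10Grad (W i), h10Grad v⟫ = lam i * ⟪b i, h10Fn v⟫

lemma exists_eigenBasis (hΩ : IsOpen Ω) : Nonempty (EigenBasis Ω) := by
  obtain ⟨κ, b, W, lam, h1, h2⟩ := exists_hilbertBasis_of_compact (fnL Ω) isCompactOperator_fnL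
    (eq_zero_of_inner_h10Fn_eq_zero hΩ)
  -- The H¹₀ inner product contains the L² term besides the Dirichlet form, so the Dirichlet
  -- eigenvalue is the abstract one minus 1.
  refine ⟨⟨κ, b, W, fun i => lam i - 1, h1, fun i v => ?_⟩⟩
  have h3 := h2 i v
  have h4 : h10Fn (W i) = b i := h1 i
  rw [inner_H10, h4, fnL_apply] at h3
  linarith

namespace EigenBasis

omit [IsFiniteMeasure ((volume : Measure (Eu ι)).restrict Ω)]

variable (S : EigenBasis Ω)

lemma norm_sq_grad (i : S.κ) : ‖h10Grad (S.W i)‖ ^ 2 = S.lam i := by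
  rw [← real_inner_self_eq_norm_sq, S.eigen, S.fn_W, real_inner_self_eq_norm_sq,
    S.b.orthonormal.1 i]
  ring

lemma lam_nonneg (i : S.κ) : 0 ≤ S.lam i := by
  rw [← S.norm_sq_grad]; positivity

end EigenBasis

/-- Polynomial bound for the eigenvalue counting function. -/
lemma EigenBasis.exists_card_le (S : EigenBasis Ω) : ∃ C : ℝ, 0 < C ∧
    ∀ (Λ : ℝ) (F : Finset S.κ), 0 ≤ Λ → (∀ i ∈ F, S.lam i ≤ Λ) →
      (F.card : ℝ) ≤ C * (1 + Λ) ^ Fintype.card ι := by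
  obtain ⟨A, hA, h⟩ := exists_sum_norm_sq_jOp_le Ω
  refine ⟨4 * A * 4 ^ Fintype.card ι, by positivity, fun Λ F hΛ hF => ?_⟩
  have hr : 0 < √(1 + Λ) := Real.sqrt_pos.2 (by linarith)
  -- At this scale s one has s‖∇b_i‖ ≤ 1/2 whenever λ_i ≤ Λ, so each mollified b_i keeps norm at
  -- least 1/2. The Hilbert–Schmidt bound then limits how many such i there are.
  have hs : 0 < (2 * √(1 + Λ))⁻¹ := by positivity
  have h1 := h _ hs S.b S.b.orthonormal F
  have h2 : ∀ i ∈ F, (1 / 4 : ℝ) ≤ ‖jOp Ω hs (S.b i)‖ ^ 2 := by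
    intro i hi
    have h3 := norm_sub_jOp_le hs (S.W i)
    rw [S.fn_W] at h3
    have h4 : ‖h10Grad (S.W i)‖ ≤ √(1 + Λ) :=
      Real.le_sqrt_of_sq_le (by rw [S.norm_sq_grad]; linarith [hF i hi])
    have h5 : (2 * √(1 + Λ))⁻¹ * ‖h10Grad (S.W i)‖ ≤ 1 / 2 := by
      calc _ ≤ (2 * √(1 + Λ))⁻¹ * √(1 + Λ) := by gcongr
        _ = 1 / 2 := by field_simp
    have h6 := norm_sub_norm_le (S.b i) (jOp Ω hs (S.b i))
    rw [S.b.orthonormal.1 i] at h6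
    nlinarith
  have h7 : (F.card : ℝ) * (1 / 4) ≤ ∑ i ∈ F, ‖jOp Ω hs (S.b i)‖ ^ 2 := by
    rw [← nsmul_eq_mul]
    exact Finset.card_nsmul_le_sum _ _ _ h2
  have h8 : ((((2 * √(1 + Λ))⁻¹) ^ Fintype.card ι)⁻¹) ^ 2 =
      4 ^ Fintype.card ι * (1 + Λ) ^ Fintype.card ι := by
    rw [← inv_pow, inv_inv, ← pow_mul, mul_comm _ 2, pow_mul, mul_pow, Real.sq_sqrt (by linarith),
      ← mul_pow]
    norm_num
  rw [h8] at h1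
  linarith

/-- Group the eigenvalues by their ceiling m. A group has at most C(1+m)^n members, n the dimension,
so exponent n + 2 leaves the convergent series ∑ (1+m)⁻². -/
lemma EigenBasis.summable_inv_pow (S : EigenBasis Ω) :
    Summable fun i => ((1 + S.lam i) ^ (Fintype.card ι + 2))⁻¹ := by
  obtain ⟨C, hC, h⟩ := S.exists_card_le
  set n := Fintype.card ι
  have hs : Summable fun m : ℕ => ((1 + (m : ℝ)) ^ 2)⁻¹ := by
    have := (summable_nat_add_iff 1).2 (Real.summable_nat_pow_inv.2 (one_lt_two))
    refine this.congr fun m => ?_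
    push_cast
    rw [add_comm]
  refine summable_of_sum_le (c := 2 ^ (n + 2) * (C * ∑' m : ℕ, ((1 + (m : ℝ)) ^ 2)⁻¹))
    (fun i => by have := S.lam_nonneg i; positivity) fun F => ?_
  have h1 : ∀ i, ((1 + S.lam i) ^ (n + 2))⁻¹ ≤
      2 ^ (n + 2) * ((1 + (⌈S.lam i⌉₊ : ℝ)) ^ (n + 2))⁻¹ := by
    intro i
    have h0 := S.lam_nonneg i
    have h2 : 1 + (⌈S.lam i⌉₊ : ℝ) ≤ 2 * (1 + S.lam i) := by
      have := Nat.ceil_lt_add_one h0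
      linarith
    have h3 : (1 + (⌈S.lam i⌉₊ : ℝ)) ^ (n + 2) ≤ 2 ^ (n + 2) * (1 + S.lam i) ^ (n + 2) := by
      rw [← mul_pow]; gcongr
    rw [← div_eq_mul_inv, inv_eq_one_div, div_le_div_iff₀ (by positivity) (by positivity)]
    linarith
  classical
  calc ∑ i ∈ F, ((1 + S.lam i) ^ (n + 2))⁻¹
      ≤ ∑ i ∈ F, 2 ^ (n + 2) * ((1 + (⌈S.lam i⌉₊ : ℝ)) ^ (n + 2))⁻¹ :=
        Finset.sum_le_sum fun i _ => h1 i
    _ = 2 ^ (n + 2) * ∑ i ∈ F, ((1 + (⌈S.lam i⌉₊ : ℝ)) ^ (n + 2))⁻¹ := by rw [Finset.mul_sum]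
    _ ≤ 2 ^ (n + 2) * (C * ∑' m : ℕ, ((1 + (m : ℝ)) ^ 2)⁻¹) := by
        gcongr
        rw [Finset.sum_comp (fun m : ℕ => ((1 + (m : ℝ)) ^ (n + 2))⁻¹) (fun i => ⌈S.lam i⌉₊)]
        calc _ ≤ ∑ m ∈ F.image fun i => ⌈S.lam i⌉₊, C * ((1 + (m : ℝ)) ^ 2)⁻¹ := by
              refine Finset.sum_le_sum fun m _ => ?_
              have := h m (F.filter fun i => ⌈S.lam i⌉₊ = m) m.cast_nonneg (fun i hi => by
                rw [← (Finset.mem_filter.1 hi).2]; exact Nat.le_ceil _)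
              rw [nsmul_eq_mul]
              calc _ ≤ C * (1 + (m : ℝ)) ^ n * ((1 + (m : ℝ)) ^ (n + 2))⁻¹ := by gcongr
                _ = _ := by rw [pow_add]; field_simp
          _ = C * ∑ m ∈ F.image fun i => ⌈S.lam i⌉₊, ((1 + (m : ℝ)) ^ 2)⁻¹ := by
              rw [Finset.mul_sum]
          _ ≤ _ := by
              gcongr
              exact hs.sum_le_tsum _ fun m _ => by positivity

end

/-! ### Global sup bound for mollified eigenfunctions -/

section

variable {ι : Type} [Fintype ι]

lemma gradient_bumpAt_norm_le {R : ℝ} (hR : ∀ y : Eu ι, moll y ≤ R) (x z : Eu ι) {s : ℝ}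
    (hs : 0 < s) : ‖gradient (bumpAt x s) z‖ ≤ s⁻¹ * R := by
  rw [gradient_bumpAt, norm_smul, norm_neg, norm_mul, norm_inv, Real.norm_of_nonneg hs.le,
    Real.norm_of_nonneg (moll_nonneg _), mul_assoc]
  refine mul_le_mul_of_nonneg_left ?_ (by positivity)
  rcases le_or_gt 1 ‖s⁻¹ • (z - x)‖ with h | h
  · rw [moll_eq_zero h, zero_mul]
    exact (moll_nonneg 0).trans (hR 0)
  · exact (mul_le_of_le_one_right (moll_nonneg _) h.le).trans (hR _)

lemma bumpAt_le {R : ℝ} (hR : ∀ y : Eu ι, moll y ≤ R) (x z : Eu ι) (s : ℝ) :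
    bumpAt x s z ≤ R := by
  have := two_mul_bump_le_moll (s⁻¹ • (z - x))
  have := hR (s⁻¹ • (z - x))
  have := bump_nonneg (s⁻¹ • (z - x))
  unfold bumpAt
  linarith

variable {Ω : Set (Eu ι)}

lemma IsTest.norm_fn_bump_mul_le {R : ℝ} (hR : ∀ y : Eu ι, moll y ≤ R) {φ : Eu ι → ℝ}
    (h : IsTest Ω φ) (x : Eu ι) (s : ℝ) :
    ‖h10Fn (h.mul_left (contDiff_bumpAt x s)).toH10‖ ≤ R * ‖h10Fn h.toH10‖ := by
  refine Lp.norm_le_mul_norm_of_ae_le_mul ?_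
  filter_upwards [h.coeFn_h10Fn, (h.mul_left (contDiff_bumpAt x s)).coeFn_h10Fn] with z h1 h2
  rw [h1, h2, norm_mul, Real.norm_of_nonneg (bumpAt_nonneg x s z)]
  exact mul_le_mul_of_nonneg_right (bumpAt_le hR x z s) (norm_nonneg _)

lemma IsTest.norm_grad_bump_mul_le {R : ℝ} (hR : ∀ y : Eu ι, moll y ≤ R) {φ : Eu ι → ℝ}
    (h : IsTest Ω φ) (x : Eu ι) {s : ℝ} (hs : 0 < s) :
    ‖h10Grad (h.mul_left (contDiff_bumpAt x s)).toH10‖ ≤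
      R * ‖h10Grad h.toH10‖ + s⁻¹ * R * ‖h10Fn h.toH10‖ := by
  have hR0 : 0 ≤ R := (moll_nonneg 0).trans (hR 0)
  have hb := contDiff_bumpAt x s
  set F₁ : Eu ι → Eu ι := fun z => bumpAt x s z • gradient φ z with hF₁
  set F₂ : Eu ι → Eu ι := fun z => φ z • gradient (bumpAt x s) z with hF₂
  have c1 : Continuous F₁ := hb.continuous.smul (continuous_gradient h.1)
  have c2 : Continuous F₂ := h.continuous.smul (continuous_gradient hb)
  have s1 : HasCompactSupport F₁ :=
    (hasCompactSupport_gradient h.2.1).mono fun z hz hz' => hz (by simp [hF₁, hz'])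
  have s2 : HasCompactSupport F₂ := h.2.1.mono fun z hz hz' => hz (by simp [hF₂, hz'])
  have m1 : MemLp F₁ 2 (volume.restrict Ω) := (c1.memLp_of_hasCompactSupport s1).restrict _
  have m2 : MemLp F₂ 2 (volume.restrict Ω) := (c2.memLp_of_hasCompactSupport s2).restrict _
  have e0 : gradient (fun z => bumpAt x s z * φ z) = F₁ + F₂ := by
    funext z
    rw [gradient_mul (hb.differentiable (by simp) z) (h.differentiable z), Pi.add_apply]
  have e : h10Grad (h.mul_left hb).toH10 = m1.toLp F₁ + m2.toLp F₂ := by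
    rw [← MemLp.toLp_add, IsTest.h10Grad_toH10]
    exact MemLp.toLp_congr _ _ (Filter.EventuallyEq.of_eq e0)
  rw [e]
  refine (norm_add_le _ _).trans (add_le_add ?_ ?_)
  · refine Lp.norm_le_mul_norm_of_ae_le_mul ?_
    filter_upwards [h.coeFn_h10Grad, m1.coeFn_toLp] with z h1 h2
    rw [h1, h2, hF₁, norm_smul, Real.norm_of_nonneg (bumpAt_nonneg x s z)]
    exact mul_le_mul_of_nonneg_right (bumpAt_le hR x z s) (norm_nonneg _)
  · refine Lp.norm_le_mul_norm_of_ae_le_mul ?_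
    filter_upwards [h.coeFn_h10Fn, m2.coeFn_toLp] with z h1 h2
    rw [h1, h2, hF₂, norm_smul, mul_comm]
    exact mul_le_mul_of_nonneg_right (gradient_bumpAt_norm_le hR x z hs) (norm_nonneg _)

lemma norm_h10Fn_le (w : H10 Ω) : ‖h10Fn w‖ ≤ ‖w‖ := by
  refine le_of_sq_le_sq ?_ (norm_nonneg w)
  rw [← real_inner_self_eq_norm_sq w, inner_H10, real_inner_self_eq_norm_sq,
    real_inner_self_eq_norm_sq]
  nlinarith [sq_nonneg ‖h10Grad w‖]

lemma norm_h10Grad_le (w : H10 Ω) : ‖h10Grad w‖ ≤ ‖w‖ := by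
  refine le_of_sq_le_sq ?_ (norm_nonneg w)
  rw [← real_inner_self_eq_norm_sq w, inner_H10, real_inner_self_eq_norm_sq,
    real_inner_self_eq_norm_sq]
  nlinarith [sq_nonneg ‖h10Fn w‖]

lemma IsTest.setIntegral_eq {φ : Eu ι → ℝ} (h : IsTest Ω φ) {f : Eu ι → ℝ}
    (hf : ∀ z, φ z = 0 → f z = 0) : ∫ z in Ω, f z = ∫ z, f z :=
  setIntegral_eq_integral_of_forall_compl_eq_zero fun z hz => hf z (h.eq_zero_of_notMem hz)

/-- Testing the equation with `ψ φ` controls the derivative of the averages of `φ²`. -/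
lemma IsTest.integral_gradient_sq_le {φ : Eu ι → ℝ} (h : IsTest Ω φ) (x : Eu ι) (s : ℝ) :
    ∫ z, ⟪gradient (fun z => φ z * φ z) z, gradient (bumpAt x s) z⟫ ≤
      2 * ⟪h10Grad h.toH10, h10Grad (h.mul_left (contDiff_bumpAt x s)).toH10⟫ := by
  rw [h.h10Grad_toH10, IsTest.h10Grad_toH10, inner_toLp, ← integral_const_mul,
    setIntegral_eq_integral_of_forall_compl_eq_zero
      (fun z hz => by rw [h.gradient_eq_zero_of_notMem hz, inner_zero_left, mul_zero])]
  have hb := contDiff_bumpAt x s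
  have h2 : IsTest Ω (fun z => φ z * φ z) := h.mul_left h.1
  have h3 := h.mul_left hb
  refine integral_mono ?_ ?_ fun z => ?_
  · refine Continuous.integrable_of_hasCompactSupport
      ((continuous_gradient h2.1).inner (continuous_gradient hb)) ?_
    refine (hasCompactSupport_gradient h2.2.1).mono' ?_
    refine (Function.support_subset_iff'.2 fun z hz => ?_).trans subset_closure
    rw [Function.notMem_support.1 hz, inner_zero_left]
  · refine Continuous.integrable_of_hasCompactSupport
      (continuous_const.mul ((continuous_gradient h.1).inner (continuous_gradient h3.1))) ?_
    refine (hasCompactSupport_gradient h.2.1).mono' ?_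
    refine (Function.support_subset_iff'.2 fun z hz => ?_).trans subset_closure
    rw [Function.notMem_support.1 hz, inner_zero_left, mul_zero]
  -- Pointwise, ⟪∇(φ²), ∇ψ⟫ = 2⟪∇φ, ∇(ψφ)⟫ - 2ψ|∇φ|² with ψ the bump, and the last term has a sign.
  · simp only
    rw [gradient_mul (h.differentiable z) (h.differentiable z),
      gradient_mul (hb.differentiable (by simp) z) (h.differentiable z), inner_add_right,
      inner_add_left, real_inner_smul_left, real_inner_smul_right, real_inner_smul_right,
      real_inner_self_eq_norm_sq]
    have := mul_nonneg (bumpAt_nonneg x s z) (sq_nonneg ‖gradient φ z‖)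
    linarith

lemma IsTest.inner_bump_mul_le {φ : Eu ι → ℝ} (h : IsTest Ω φ) (x : Eu ι) {s : ℝ} (hs : 0 < s) :
    2 * ⟪h10Fn h.toH10, h10Fn (h.mul_left (contDiff_bumpAt x s)).toH10⟫ ≤
      s ^ Fintype.card ι * mAvg (fun z => φ z * φ z) x s := by
  have hb := contDiff_bumpAt x s
  rw [h.h10Fn_toH10, IsTest.h10Fn_toH10, inner_toLp, ← integral_const_mul,
    setIntegral_eq_integral_of_forall_compl_eq_zero
      (fun z hz => by rw [h.eq_zero_of_notMem hz, inner_zero_left, mul_zero]), mAvg_eq _ _ hs,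
    ← mul_assoc, mul_inv_cancel₀ (by positivity), one_mul]
  refine integral_mono ?_ ?_ fun z => ?_
  · refine Continuous.integrable_of_hasCompactSupport
      (continuous_const.mul (h.continuous.inner (hb.continuous.mul h.continuous))) ?_
    refine h.2.1.mono fun z hz hz' => hz ?_
    simp [hz']
  · refine Continuous.integrable_of_hasCompactSupport
      ((continuous_moll.comp (by fun_prop)).mul (h.continuous.mul h.continuous)) ?_
    refine h.2.1.mono fun z hz hz' => hz ?_
    simp [hz']
  · simp only [RCLike.inner_apply, conj_trivial]
    have := mul_le_mul_of_nonneg_right (two_mul_bump_le_moll (s⁻¹ • (z - x)))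
      (mul_self_nonneg (φ z))
    simp only [bumpAt]
    linarith

lemma hasDerivAt_mAvg' {g : Eu ι → ℝ} (hg : ContDiff ℝ (⊤ : ℕ∞) g) (hc : HasCompactSupport g)
    (x : Eu ι) {s : ℝ} (hs : 0 < s) :
    HasDerivAt (mAvg g x)
      (-(s * (s ^ Fintype.card ι)⁻¹ * ∫ z, ⟪gradient g z, gradient (bumpAt x s) z⟫)) s := by
  rw [← integral_moll_inner_gradient _ _ hs]
  exact hasDerivAt_mAvg hg hc x s

/-- Almost monotonicity in `s` of the averages of `φ²`, for `φ` close to an eigenfunction. -/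
lemma exists_mAvg_sq_le (w : H10 Ω) {lam : ℝ} (hlam : 0 ≤ lam)
    (hw : ∀ v : H10 Ω, ⟪h10Grad w, h10Grad v⟫ = lam * ⟪h10Fn w, h10Fn v⟫)
    {δ ε : ℝ} (hδ : 0 < δ) (hδε : δ ≤ ε) :
    ∃ K : ℝ, ∀ (φ : Eu ι → ℝ) (h : IsTest Ω φ) (x : Eu ι),
      Real.exp (lam * δ ^ 2 / 2) * mAvg (fun z => φ z * φ z) x δ ≤
        Real.exp (lam * ε ^ 2 / 2) * mAvg (fun z => φ z * φ z) x ε +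
          K * (‖h.toH10 - w‖ * ‖h.toH10‖) := by
  obtain ⟨R, hR0, hR⟩ := exists_moll_le ι
  have hε : 0 < ε := hδ.trans_le hδε
  set n := Fintype.card ι
  set K₁ : ℝ := 2 * (R + δ⁻¹ * R + lam * R) with hK₁
  set K₂ : ℝ := Real.exp (lam * ε ^ 2 / 2) * (ε * (δ ^ n)⁻¹ * K₁) with hK₂
  have hK₁0 : 0 ≤ K₁ := by positivity
  refine ⟨K₂ * (ε - δ), fun φ h x => ?_⟩
  set g : Eu ι → ℝ := fun z => φ z * φ z
  have hg : IsTest Ω g := h.mul_left h.1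
  set E : ℝ := ‖h.toH10 - w‖ * ‖h.toH10‖ with hE
  have hE0 : 0 ≤ E := by positivity
  -- The eigenvalue equation for `w` is tested with bump · φ, which lies in H¹₀ wherever the ball
  -- sits; hence no condition relating x to the boundary. Replacing φ by `w` in the first slot costs
  -- `K₁ * E`.
  have key : ∀ s ∈ Icc δ ε, ∫ z, ⟪gradient g z, gradient (bumpAt x s) z⟫ ≤
      lam * (s ^ n * mAvg g x s) + K₁ * E := by
    intro s hs
    have hs0 : 0 < s := hδ.trans_le hs.1
    have h1 := h.integral_gradient_sq_le x s
    have h2 := h.inner_bump_mul_le x hs0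
    have h3 := h.norm_fn_bump_mul_le hR x s
    have h4 := h.norm_grad_bump_mul_le hR x hs0
    set v := (h.mul_left (contDiff_bumpAt x s)).toH10
    set p := h.toH10
    have h5 : ⟪h10Grad p, h10Grad v⟫ = ⟪h10Grad (p - w), h10Grad v⟫ -
        lam * ⟪h10Fn (p - w), h10Fn v⟫ + lam * ⟪h10Fn p, h10Fn v⟫ := by
      have e1 : h10Grad (p - w) = h10Grad p - h10Grad w := rfl
      have e2 : h10Fn (p - w) = h10Fn p - h10Fn w := rfl
      rw [e1, e2, inner_sub_left, inner_sub_left, hw]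
      ring
    have hsδ : s⁻¹ ≤ δ⁻¹ := inv_anti₀ hδ hs.1
    have h6 : ⟪h10Grad (p - w), h10Grad v⟫ ≤ ‖p - w‖ * ((R + δ⁻¹ * R) * ‖p‖) := by
      refine (real_inner_le_norm _ _).trans ?_
      refine mul_le_mul (norm_h10Grad_le _) (h4.trans ?_) (norm_nonneg _) (norm_nonneg _)
      rw [add_mul]
      exact add_le_add (by gcongr; exact norm_h10Grad_le _) (by gcongr; exact norm_h10Fn_le _)
    have h7 : -⟪h10Fn (p - w), h10Fn v⟫ ≤ ‖p - w‖ * (R * ‖p‖) := by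
      refine (neg_le_abs _).trans ((abs_real_inner_le_norm _ _).trans ?_)
      refine mul_le_mul (norm_h10Fn_le _) (h3.trans ?_) (norm_nonneg _) (norm_nonneg _)
      gcongr
      exact norm_h10Fn_le _
    have h8 := mul_le_mul_of_nonneg_left h7 hlam
    have h9 := mul_le_mul_of_nonneg_left h2 hlam
    rw [hK₁, hE]
    linarith
  -- Up to the error term, `key` says that the average has derivative at least -λs times itself. The
  -- exponential is the integrating factor.
  set f : ℝ → ℝ := fun s => Real.exp (lam * s ^ 2 / 2) * mAvg g x s
  set D : ℝ → ℝ := fun s => ∫ z, ⟪gradient g z, gradient (bumpAt x s) z⟫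
  have hf : ∀ s, 0 < s → HasDerivAt f (Real.exp (lam * s ^ 2 / 2) * (lam * s) * mAvg g x s +
      Real.exp (lam * s ^ 2 / 2) * (-(s * (s ^ n)⁻¹ * D s))) s := by
    intro s hs
    have h1 : HasDerivAt (fun s : ℝ => lam * s ^ 2 / 2) (lam * s) s := by
      have := (((hasDerivAt_id s).pow 2).const_mul lam).div_const 2
      refine this.congr_deriv ?_
      simp
      ring
    exact h1.exp.mul (hasDerivAt_mAvg' hg.1 hg.2.1 x hs)
  have hmv := (convex_Icc δ ε).mul_sub_le_image_sub_of_le_deriv (f := f) (C := -(K₂ * E))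
    (fun s hs => (hf s (hδ.trans_le hs.1)).continuousAt.continuousWithinAt)
    (fun s hs => (hf s (hδ.trans_le (interior_subset hs).1)).differentiableAt.differentiableWithinAt)
    (fun s hs => by
      replace hs := interior_subset hs
      have hs0 : 0 < s := hδ.trans_le hs.1
      rw [(hf s hs0).deriv]
      have h1 := key s hs
      have h2 : s * (s ^ n)⁻¹ * D s ≤ lam * s * mAvg g x s + ε * (δ ^ n)⁻¹ * K₁ * E := by
        calc s * (s ^ n)⁻¹ * D s ≤ s * (s ^ n)⁻¹ * (lam * (s ^ n * mAvg g x s) + K₁ * E) := by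
              gcongr
          _ = lam * s * mAvg g x s + s * (s ^ n)⁻¹ * (K₁ * E) := by field_simp
          _ ≤ lam * s * mAvg g x s + ε * (δ ^ n)⁻¹ * (K₁ * E) := by
              gcongr
              exacts [hs.2, hs.1]
          _ = _ := by ring
      have h3 : Real.exp (lam * s ^ 2 / 2) ≤ Real.exp (lam * ε ^ 2 / 2) := by
        gcongr
        exact hs.2
      have h4 : Real.exp (lam * s ^ 2 / 2) * (s * (s ^ n)⁻¹ * D s) ≤
          Real.exp (lam * s ^ 2 / 2) * (lam * s * mAvg g x s + ε * (δ ^ n)⁻¹ * K₁ * E) :=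
        mul_le_mul_of_nonneg_left h2 (Real.exp_pos _).le
      have h5 : Real.exp (lam * s ^ 2 / 2) * (ε * (δ ^ n)⁻¹ * K₁ * E) ≤ K₂ * E := by
        rw [hK₂, mul_assoc (Real.exp _)]
        exact mul_le_mul_of_nonneg_right h3 (by positivity)
      linarith)
    δ ⟨le_rfl, hδε⟩ ε ⟨hδε, le_rfl⟩ hδε
  simp only [f] at hmv
  linarith

/-- Jensen's inequality for the normalised mollifier, read off from the nonnegativity of the
variance. -/
lemma sq_mAvg_le {φ : Eu ι → ℝ} (h : IsTest Ω φ) (x : Eu ι) (s : ℝ) :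
    ((mollMass ι)⁻¹ * mAvg φ x s) ^ 2 ≤ (mollMass ι)⁻¹ * mAvg (fun z => φ z * φ z) x s := by
  have hm := mollMass_pos ι
  set a := (mollMass ι)⁻¹ * mAvg φ x s with ha
  have hc : Continuous fun y : Eu ι => φ (x + s • y) := h.continuous.comp (by fun_prop)
  have i1 : Integrable fun y : Eu ι => moll y * (φ (x + s • y) * φ (x + s • y)) :=
    (continuous_moll.mul (hc.mul hc)).integrable_of_hasCompactSupport
      hasCompactSupport_moll.mul_right
  have i2 : Integrable fun y : Eu ι => moll y * φ (x + s • y) :=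
    (continuous_moll.mul hc).integrable_of_hasCompactSupport hasCompactSupport_moll.mul_right
  have h0 : 0 ≤ ∫ y : Eu ι, moll y * (φ (x + s • y) - a) ^ 2 :=
    integral_nonneg fun y => mul_nonneg (moll_nonneg y) (sq_nonneg _)
  have e : (fun y : Eu ι => moll y * (φ (x + s • y) - a) ^ 2) = fun y =>
      (moll y * (φ (x + s • y) * φ (x + s • y)) - 2 * a * (moll y * φ (x + s • y))) +
        a ^ 2 * moll y := by
    funext y; ring
  have e' : ∫ y : Eu ι, moll y * (φ (x + s • y) - a) ^ 2 =
      (∫ y : Eu ι, moll y * (φ (x + s • y) * φ (x + s • y))) -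
        2 * a * (∫ y : Eu ι, moll y * φ (x + s • y)) + a ^ 2 * mollMass ι := by
    rw [e, integral_add, integral_sub, integral_const_mul, integral_const_mul, ← mollMass]
    exacts [i1, i2.const_mul _, i1.sub (i2.const_mul _), integrable_moll.const_mul _]
  rw [e'] at h0
  have h1 : ∫ y : Eu ι, moll y * φ (x + s • y) = mollMass ι * a := by
    rw [ha, ← mul_assoc, mul_inv_cancel₀ hm.ne', one_mul]; rfl
  rw [h1] at h0
  change a ^ 2 ≤ (mollMass ι)⁻¹ * ∫ y : Eu ι, moll y * (φ (x + s • y) * φ (x + s • y))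
  rw [inv_mul_eq_div, le_div_iff₀ hm]
  linarith

variable [IsFiniteMeasure ((volume : Measure (Eu ι)).restrict Ω)]

omit [IsFiniteMeasure ((volume : Measure (Eu ι)).restrict Ω)] in
lemma IsTest.mAvg_sq_le {R : ℝ}
    (hR : ∀ (x : Eu ι) (s : ℝ), 0 < s → ∀ z, kerFn x s z ≤ R * (s ^ Fintype.card ι)⁻¹)
    {φ : Eu ι → ℝ} (h : IsTest Ω φ) (x : Eu ι) {s : ℝ} (hs : 0 < s) :
    (mollMass ι)⁻¹ * mAvg (fun z => φ z * φ z) x s ≤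
      R * (s ^ Fintype.card ι)⁻¹ * ‖h10Fn h.toH10‖ ^ 2 := by
  rw [← integral_kerFn_mul _ _ hs, h.h10Fn_toH10, norm_sq_toLp, h.setIntegral_eq (by simp),
    ← integral_const_mul]
  refine integral_mono ?_ ?_ fun z => ?_
  · refine ((continuous_kerFn_right x s).mul
      (h.continuous.mul h.continuous)).integrable_of_hasCompactSupport ?_
    exact h.2.1.mono fun z hz hz' => hz (by simp [hz'])
  · refine (continuous_const.mul (h.continuous.pow 2)).integrable_of_hasCompactSupport ?_
    exact h.2.1.mono fun z hz hz' => hz (by simp [hz'])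
  · simp only [← pow_two]
    exact mul_le_mul_of_nonneg_right (hR x s hs z) (sq_nonneg _)

lemma tendsto_jAvg {s : ℝ} (hs : 0 < s) {f : ℕ → L2 Ω} {g : L2 Ω}
    (h : Filter.Tendsto f Filter.atTop (nhds g)) (x : Eu ι) :
    Filter.Tendsto (fun m => jAvg Ω s (f m) x) Filter.atTop (nhds (jAvg Ω s g x)) := by
  simp only [jAvg_eq_inner hs]
  exact tendsto_const_nhds.inner h

/-- Sup bound for the mollifications of an eigenfunction. -/
lemma sq_jAvg_le {R : ℝ}
    (hR : ∀ (x : Eu ι) (s : ℝ), 0 < s → ∀ z, kerFn x s z ≤ R * (s ^ Fintype.card ι)⁻¹)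
    (w : H10 Ω) {lam : ℝ} (hlam : 0 ≤ lam)
    (hw : ∀ v : H10 Ω, ⟪h10Grad w, h10Grad v⟫ = lam * ⟪h10Fn w, h10Fn v⟫)
    {δ ε : ℝ} (hδ : 0 < δ) (hδε : δ ≤ ε) (x : Eu ι) :
    jAvg Ω δ (h10Fn w) x ^ 2 ≤
      Real.exp (lam * ε ^ 2 / 2) * (R * (ε ^ Fintype.card ι)⁻¹ * ‖h10Fn w‖ ^ 2) := by
  obtain ⟨K, hK⟩ := exists_mAvg_sq_le w hlam hw hδ hδε
  obtain ⟨φ, hφ, hlim⟩ := H10.exists_seq w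
  have hfn : Filter.Tendsto (fun m => h10Fn (hφ m).toH10) Filter.atTop (nhds (h10Fn w)) :=
    (continuous_h10Fn.tendsto w).comp hlim
  have hm := mollMass_pos ι
  have hL := (tendsto_jAvg hδ hfn x).pow 2
  -- The constant K depends on δ, but δ is fixed while the test functions converge to `w`, so the
  -- error term disappears in the limit.
  have hRt : Filter.Tendsto (fun m => Real.exp (lam * ε ^ 2 / 2) *
      (R * (ε ^ Fintype.card ι)⁻¹ * ‖h10Fn (hφ m).toH10‖ ^ 2) +
      (mollMass ι)⁻¹ * (K * (‖(hφ m).toH10 - w‖ * ‖(hφ m).toH10‖))) Filter.atTop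
      (nhds (Real.exp (lam * ε ^ 2 / 2) * (R * (ε ^ Fintype.card ι)⁻¹ * ‖h10Fn w‖ ^ 2) +
        (mollMass ι)⁻¹ * (K * (‖w - w‖ * ‖w‖)))) :=
    (((hfn.norm.pow 2).const_mul _).const_mul _).add
      ((((hlim.sub_const w).norm.mul hlim.norm).const_mul _).const_mul _)
  simp only [sub_self, norm_zero, zero_mul, mul_zero, add_zero] at hRt
  refine le_of_tendsto_of_tendsto' hL hRt fun m => ?_
  rw [(hφ m).jAvg_eq hδ]
  have h1 := sq_mAvg_le (hφ m) x δ
  have h2 := hK (φ m) (hφ m) x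
  have h3 := (hφ m).mAvg_sq_le hR x (hδ.trans_le hδε)
  have h4 : 0 ≤ mAvg (fun z => φ m z * φ m z) x δ :=
    integral_nonneg fun y => mul_nonneg (moll_nonneg y) (mul_self_nonneg _)
  have h5 : mAvg (fun z => φ m z * φ m z) x δ ≤
      Real.exp (lam * δ ^ 2 / 2) * mAvg (fun z => φ m z * φ m z) x δ :=
    le_mul_of_one_le_left h4 (Real.one_le_exp (by positivity))
  calc _ ≤ (mollMass ι)⁻¹ * mAvg (fun z => φ m z * φ m z) x δ := h1
    _ ≤ (mollMass ι)⁻¹ * (Real.exp (lam * ε ^ 2 / 2) * mAvg (fun z => φ m z * φ m z) x ε +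
          K * (‖(hφ m).toH10 - w‖ * ‖(hφ m).toH10‖)) := by gcongr; exact h5.trans h2
    _ = Real.exp (lam * ε ^ 2 / 2) * ((mollMass ι)⁻¹ * mAvg (fun z => φ m z * φ m z) x ε) +
          (mollMass ι)⁻¹ * (K * (‖(hφ m).toH10 - w‖ * ‖(hφ m).toH10‖)) := by ring
    _ ≤ _ := by gcongr

end

/-! ### Continuous representatives of eigenfunctions -/

section

variable {ι : Type} [Fintype ι] {Ω : Set (Eu ι)}
  [IsFiniteMeasure ((volume : Measure (Eu ι)).restrict Ω)]

lemma exists_subseq_jAvg_tendsto (w : H10 Ω) : ∃ ns : ℕ → ℕ, StrictMono ns ∧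
    ∀ᵐ x ∂(volume.restrict Ω), Filter.Tendsto
      (fun k => jAvg Ω (1 / ((ns k : ℝ) + 1)) (h10Fn w) x) Filter.atTop (nhds (h10Fn w x)) := by
  have hpos : ∀ k : ℕ, (0 : ℝ) < 1 / ((k : ℝ) + 1) := fun k => by positivity
  have h1 : Filter.Tendsto (fun k : ℕ => jOp Ω (hpos k) (h10Fn w)) Filter.atTop
      (nhds (h10Fn w)) := by
    rw [tendsto_iff_norm_sub_tendsto_zero]
    have h2 := (tendsto_one_div_add_atTop_nhds_zero_nat (𝕜 := ℝ)).mul_const ‖h10Grad w‖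
    rw [zero_mul] at h2
    refine squeeze_zero (fun k => norm_nonneg _) (fun k => ?_) h2
    rw [norm_sub_rev]
    exact norm_sub_jOp_le (hpos k) w
  obtain ⟨ns, hns, hae⟩ := (tendstoInMeasure_of_tendsto_Lp h1).exists_seq_tendsto_ae
  refine ⟨ns, hns, ?_⟩
  have h3 : ∀ᵐ x ∂(volume.restrict Ω), ∀ k : ℕ,
      jOp Ω (hpos k) (h10Fn w) x = jAvg Ω (1 / ((k : ℝ) + 1)) (h10Fn w) x :=
    ae_all_iff.2 fun k => (memLp_jAvg (hpos k) (h10Fn w)).coeFn_toLp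
  filter_upwards [hae, h3] with x hx hx3
  simpa only [hx3] using hx

omit [IsFiniteMeasure ((volume : Measure (Eu ι)).restrict Ω)] in
-- The bump is dominated by the rescaled mollifier, whose integral is s^n times `mollMass ι`. The
-- power s^n cancels the singular prefactor in the scale derivative of an average.
lemma abs_inner_bumpAt_le (f : L2 Ω) {B : ℝ} (hB : 0 ≤ B)
    (hf : ∀ᵐ z ∂(volume.restrict Ω), |f z| ≤ B) {x : Eu ι} {s : ℝ} (hs : 0 < s)
    (h : IsTest Ω (bumpAt x s)) :
    |⟪f, h10Fn h.toH10⟫| ≤ B * (s ^ Fintype.card ι * mollMass ι) := by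
  rw [h.h10Fn_toH10, inner_toLp_right]
  have hi : Integrable fun z => moll (s⁻¹ • (z - x)) := by
    refine (continuous_moll.comp (by fun_prop)).integrable_of_hasCompactSupport ?_
    refine HasCompactSupport.intro (isCompact_closedBall x s) fun z hz => ?_
    rw [Metric.mem_closedBall, not_le] at hz
    exact moll_smul_sub_eq_zero hs hz.le
  have h1 : ∫ z, moll (s⁻¹ • (z - x)) = s ^ Fintype.card ι * mollMass ι := by
    have h2 := mAvg_eq (fun _ => 1) x hs
    simp only [mAvg, mul_one] at h2
    rw [mollMass, h2, ← mul_assoc, mul_inv_cancel₀ (by positivity), one_mul]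
  rw [← h1, ← integral_const_mul]
  rw [← Real.norm_eq_abs]
  refine (norm_integral_le_of_norm_le (μ := volume.restrict Ω)
    (g := fun z => B * moll (s⁻¹ • (z - x))) (hi.const_mul B).integrableOn ?_).trans
    (setIntegral_le_integral (hi.const_mul B) (Filter.Eventually.of_forall fun z =>
      mul_nonneg hB (moll_nonneg _)))
  filter_upwards [hf] with z hz
  rw [real_inner_comm, norm_inner_symm]
  refine (norm_inner_le_norm _ _).trans ?_
  refine mul_le_mul hz ?_ (norm_nonneg _) hB
  rw [Real.norm_of_nonneg (bumpAt_nonneg x s z)]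
  have := two_mul_bump_le_moll (s⁻¹ • (z - x))
  have := bump_nonneg (s⁻¹ • (z - x))
  unfold bumpAt
  linarith

/-- Only uniformity in x and s ≥ δ matters: the constant will multiply the distance of a test
function to the eigenfunction, which tends to zero with δ fixed. -/
lemma exists_norm_bumpAt_le (Ω : Set (Eu ι))
    [IsFiniteMeasure ((volume : Measure (Eu ι)).restrict Ω)] {δ : ℝ} (hδ : 0 < δ) :
    ∃ K : ℝ, 0 ≤ K ∧ ∀ (x : Eu ι) (s : ℝ), δ ≤ s → ∀ h : IsTest Ω (bumpAt x s),
      ‖h10Grad h.toH10‖ ≤ K := by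
  obtain ⟨R, hR0, hR⟩ := exists_moll_le ι
  refine ⟨(measureUnivNNReal ((volume : Measure (Eu ι)).restrict Ω) : ℝ) ^
        (2 : ℝ≥0∞).toReal⁻¹ * (δ⁻¹ * R), by positivity, fun x s hs h => ?_⟩
  refine Lp.norm_le_of_ae_bound (by positivity) ?_
  filter_upwards [h.coeFn_h10Grad] with z hz
  rw [hz]
  refine (gradient_bumpAt_norm_le hR x z (hδ.trans_le hs)).trans ?_
  gcongr

/-- In the interior, the mollifications of an eigenfunction are uniformly Cauchy. -/
lemma abs_jAvg_sub_le (w : H10 Ω) {lam : ℝ} (hlam : 0 ≤ lam)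
    (hw : ∀ v : H10 Ω, ⟪h10Grad w, h10Grad v⟫ = lam * ⟪h10Fn w, h10Fn v⟫)
    {B : ℝ} (hB : 0 ≤ B) (hf : ∀ᵐ z ∂(volume.restrict Ω), |h10Fn w z| ≤ B)
    {δ ε : ℝ} (hδ : 0 < δ) (hδε : δ ≤ ε) {x : Eu ι} (hx : Metric.closedBall x ε ⊆ Ω) :
    |jAvg Ω ε (h10Fn w) x - jAvg Ω δ (h10Fn w) x| ≤ lam * B * ε ^ 2 := by
  obtain ⟨K, hK0, hK⟩ := exists_norm_bumpAt_le Ω hδ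
  have hε : 0 < ε := hδ.trans_le hδε
  have hm := mollMass_pos ι
  set n := Fintype.card ι
  obtain ⟨φ, hφ, hlim⟩ := H10.exists_seq w
  have hfn : Filter.Tendsto (fun m => h10Fn (hφ m).toH10) Filter.atTop (nhds (h10Fn w)) :=
    (continuous_h10Fn.tendsto w).comp hlim
  have hL := ((tendsto_jAvg hε hfn x).sub (tendsto_jAvg hδ hfn x)).abs
  have hR : Filter.Tendsto (fun m => (lam * B * ε + (mollMass ι)⁻¹ * (ε * (δ ^ n)⁻¹ *
      (‖(hφ m).toH10 - w‖ * K))) * (ε - δ)) Filter.atTop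
      (nhds ((lam * B * ε + (mollMass ι)⁻¹ * (ε * (δ ^ n)⁻¹ * (‖w - w‖ * K))) * (ε - δ))) :=
    ((((((hlim.sub_const w).norm.mul_const K).const_mul _).const_mul _).const_add _).mul_const _)
  simp only [sub_self, norm_zero, zero_mul, mul_zero, add_zero] at hR
  have hfin : lam * B * ε * (ε - δ) ≤ lam * B * ε ^ 2 := by
    have : 0 ≤ lam * B * ε * δ := by positivity
    nlinarith
  refine le_trans (le_of_tendsto_of_tendsto' hL hR fun m => ?_) hfin
  rw [(hφ m).jAvg_eq hδ, (hφ m).jAvg_eq hε]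
  have hder : ∀ s ∈ Icc δ ε, HasDerivWithinAt (fun s => (mollMass ι)⁻¹ * mAvg (φ m) x s)
      ((mollMass ι)⁻¹ * (-(s * (s ^ n)⁻¹ *
        ∫ z, ⟪gradient (φ m) z, gradient (bumpAt x s) z⟫))) (Icc δ ε) s := fun s hs =>
    ((hasDerivAt_mAvg' (hφ m).1 (hφ m).2.1 x (hδ.trans_le hs.1)).const_mul _).hasDerivWithinAt
  have hbd : ∀ s ∈ Icc δ ε, ‖(mollMass ι)⁻¹ * (-(s * (s ^ n)⁻¹ *
      ∫ z, ⟪gradient (φ m) z, gradient (bumpAt x s) z⟫))‖ ≤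
      lam * B * ε + (mollMass ι)⁻¹ * (ε * (δ ^ n)⁻¹ * (‖(hφ m).toH10 - w‖ * K)) := by
    intro s hs
    have hs0 : 0 < s := hδ.trans_le hs.1
    -- Here the ball must lie in Ω: the bump itself, rather than bump · φ, is the test function,
    -- because the average of φ and not of φ² is differentiated.
    have ht : IsTest Ω (bumpAt x s) :=
      isTest_bumpAt hs0 ((Metric.closedBall_subset_closedBall hs.2).trans hx)
    have e1 : ∫ z, ⟪gradient (φ m) z, gradient (bumpAt x s) z⟫ =
        ⟪h10Grad ((hφ m).toH10 - w), h10Grad ht.toH10⟫ + lam * ⟪h10Fn w, h10Fn ht.toH10⟫ := by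
      have e2 : h10Grad ((hφ m).toH10 - w) = h10Grad (hφ m).toH10 - h10Grad w := rfl
      rw [e2, inner_sub_left, hw, sub_add_cancel, (hφ m).h10Grad_toH10, ht.h10Grad_toH10,
        inner_toLp, setIntegral_eq_integral_of_forall_compl_eq_zero (fun z hz => by
          rw [(hφ m).gradient_eq_zero_of_notMem hz, inner_zero_left])]
    have h3 : |⟪h10Grad ((hφ m).toH10 - w), h10Grad ht.toH10⟫| ≤ ‖(hφ m).toH10 - w‖ * K :=
      (abs_real_inner_le_norm _ _).trans (mul_le_mul (norm_h10Grad_le _) (hK x s hs.1 ht)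
        (norm_nonneg _) (norm_nonneg _))
    have h4 := abs_inner_bumpAt_le (h10Fn w) hB hf hs0 ht
    rw [e1, norm_mul, norm_neg, Real.norm_eq_abs, Real.norm_eq_abs, abs_mul,
      abs_of_pos (inv_pos.2 hm), abs_of_pos (by positivity)]
    calc _ ≤ (mollMass ι)⁻¹ * (s * (s ^ n)⁻¹ *
          (‖(hφ m).toH10 - w‖ * K + lam * (B * (s ^ n * mollMass ι)))) := by
          gcongr
          refine (abs_add_le _ _).trans (add_le_add h3 ?_)
          rw [abs_mul, abs_of_nonneg hlam]
          gcongr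
      _ = lam * B * s + (mollMass ι)⁻¹ * (s * (s ^ n)⁻¹ * (‖(hφ m).toH10 - w‖ * K)) := by
          field_simp
          ring
      _ ≤ _ := by
          gcongr
          exacts [hs.2, hs.2, hs.1]
  have := (convex_Icc δ ε).norm_image_sub_le_of_norm_hasDerivWithin_le hder hbd
    ⟨le_rfl, hδε⟩ ⟨hδε, le_rfl⟩
  rwa [Real.norm_eq_abs, Real.norm_eq_abs, abs_of_nonneg (sub_nonneg.2 hδε)] at this

/-- Interior regularity and the global sup bound for eigenfunctions. -/
lemma EigenBasis.exists_rep (S : EigenBasis Ω) (hΩ : IsOpen Ω) :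
    ∃ (B : ℝ) (e : S.κ → Eu ι → ℝ), 0 < B ∧ ∀ i, ContinuousOn (e i) Ω ∧
      S.b i =ᵐ[volume.restrict Ω] e i ∧
      ∀ x ∈ Ω, |e i x| ≤ B * (1 + S.lam i) ^ Fintype.card ι := by
  obtain ⟨R, hR0, hR⟩ := exists_kerFn_le ι
  set n := Fintype.card ι
  have hpos : ∀ k : ℕ, (0 : ℝ) < 1 / ((k : ℝ) + 1) := fun k => by positivity
  have hto : Filter.Tendsto (fun k : ℕ => 1 / ((k : ℝ) + 1)) Filter.atTop (nhds 0) :=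
    tendsto_one_div_add_atTop_nhds_zero_nat
  have main : ∀ i, ∃ e : Eu ι → ℝ, ContinuousOn e Ω ∧ S.b i =ᵐ[volume.restrict Ω] e ∧
      ∀ x ∈ Ω, |e x| ≤ (2 * R + 1) * (1 + S.lam i) ^ n := by
    intro i
    set w := S.W i with hwdef
    have hl := S.lam_nonneg i
    have hw : ∀ v : H10 Ω, ⟪h10Grad w, h10Grad v⟫ = S.lam i * ⟪h10Fn w, h10Fn v⟫ := by
      intro v; rw [S.eigen, S.fn_W]
    have hnorm : ‖h10Fn w‖ = 1 := by rw [S.fn_W]; exact S.b.orthonormal.1 i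
    set B' := (2 * R + 1) * (1 + S.lam i) ^ n with hB'
    have hpow : 1 ≤ (1 + S.lam i) ^ n := one_le_pow₀ (by linarith)
    have hB'0 : 0 ≤ B' := by positivity
    -- The comparison scale is r⁻¹: then λ r⁻² ≤ 1 keeps the exponential factor below 2, and r^n is
    -- at most (1 + λ)^n.
    set r := √(1 + S.lam i) with hr
    have hr1 : 1 ≤ r := Real.one_le_sqrt.2 (by linarith)
    have hbd : ∀ δ : ℝ, 0 < δ → δ ≤ r⁻¹ → ∀ x, |jAvg Ω δ (h10Fn w) x| ≤ B' := by
      intro δ h0 h1 x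
      have h2 := sq_jAvg_le hR w hl hw h0 h1 x
      rw [hnorm] at h2
      have h3 : Real.exp (S.lam i * r⁻¹ ^ 2 / 2) ≤ 2 := by
        have h4 : S.lam i * r⁻¹ ^ 2 / 2 ≤ 1 / 2 := by
          rw [inv_pow, hr, Real.sq_sqrt (by linarith), ← div_eq_mul_inv]
          have : S.lam i / (1 + S.lam i) ≤ 1 := (div_le_one (by linarith)).2 (by linarith)
          linarith
        have h5 : Real.exp (1 / 2) ^ 2 ≤ 2 ^ 2 := by
          rw [← Real.exp_nat_mul]
          norm_num
          linarith [Real.exp_one_lt_d9]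
        exact (Real.exp_le_exp.2 h4).trans (le_of_sq_le_sq h5 (by norm_num))
      have h6 : (r⁻¹ ^ n)⁻¹ ≤ (1 + S.lam i) ^ n := by
        rw [← inv_pow, inv_inv]
        refine pow_le_pow_left₀ (by positivity) ?_ n
        rw [hr, Real.sqrt_le_left (by linarith)]
        nlinarith
      refine abs_le_of_sq_le_sq ?_ hB'0
      calc _ ≤ 2 * (R * (1 + S.lam i) ^ n * 1 ^ 2) := by
            refine h2.trans ?_
            gcongr
        _ ≤ B' := by rw [hB']; nlinarith
        _ ≤ B' ^ 2 := le_self_pow₀ (by rw [hB']; nlinarith) two_ne_zero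
    have hbd' : ∀ᶠ k : ℕ in Filter.atTop, ∀ x, |jAvg Ω (1 / ((k : ℝ) + 1)) (h10Fn w) x| ≤ B' := by
      filter_upwards [hto.eventually_le_const (show (0 : ℝ) < r⁻¹ by positivity)] with k hk x
      exact hbd _ (hpos k) hk x
    obtain ⟨ns, hns, hae⟩ := exists_subseq_jAvg_tendsto w
    have haebd : ∀ᵐ z ∂(volume.restrict Ω), |h10Fn w z| ≤ B' := by
      filter_upwards [hae] with z hz
      refine le_of_tendsto hz.abs ?_
      filter_upwards [hns.tendsto_atTop.eventually hbd'] with k hk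
      exact hk z
    set a : ℕ → Eu ι → ℝ := fun k => jAvg Ω (1 / ((k : ℝ) + 1)) (h10Fn w) with ha
    have hanti : ∀ {k l : ℕ}, k ≤ l → 1 / ((l : ℝ) + 1) ≤ 1 / ((k : ℝ) + 1) := fun h =>
      one_div_le_one_div_of_le (by positivity) (by gcongr)
    have hca : ∀ (x : Eu ι) (k : ℕ), Metric.closedBall x (1 / ((k : ℝ) + 1)) ⊆ Ω → ∀ l : ℕ, k ≤ l →
        |a k x - a l x| ≤ S.lam i * B' * (1 / ((k : ℝ) + 1)) ^ 2 := fun x k hx l hkl =>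
      abs_jAvg_sub_le w hl hw hB'0 haebd (hpos l) (hanti hkl) hx
    have herr : Filter.Tendsto (fun k : ℕ => S.lam i * B' * (1 / ((k : ℝ) + 1)) ^ 2)
        Filter.atTop (nhds 0) := by
      simpa using (hto.pow 2).const_mul (S.lam i * B')
    have hlim : ∀ x ∈ Ω, ∃ y, Filter.Tendsto (fun k => a k x) Filter.atTop (nhds y) := by
      intro x hx
      refine cauchySeq_tendsto_of_complete (Metric.cauchySeq_iff'.2 fun ε hε => ?_)
      obtain ⟨ρ, hρ, hsub⟩ := Metric.isOpen_iff.1 hΩ x hx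
      obtain ⟨k, hk1, hk2⟩ := ((herr.eventually_lt_const hε).and
        (hto.eventually_lt_const hρ)).exists
      refine ⟨k, fun l hl => ?_⟩
      rw [dist_comm, Real.dist_eq]
      exact (hca x k ((Metric.closedBall_subset_ball hk2).trans hsub) l hl).trans_lt hk1
    set e : Eu ι → ℝ := fun x => Filter.limUnder Filter.atTop fun k => a k x
    have hE : ∀ x ∈ Ω, Filter.Tendsto (fun k => a k x) Filter.atTop (nhds (e x)) :=
      fun x hx => tendsto_nhds_limUnder (hlim x hx)
    refine ⟨e, ?_, ?_, ?_⟩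
    · refine TendstoLocallyUniformlyOn.continuousOn (F := a) (p := Filter.atTop) ?_
        (Filter.Frequently.of_forall fun k => (continuous_jAvg (hpos k) _).continuousOn)
      rw [Metric.tendstoLocallyUniformlyOn_iff]
      intro ε hε x hx
      obtain ⟨ρ, hρ, hsub⟩ := Metric.isOpen_iff.1 hΩ x hx
      -- Half the radius is left over so that small balls around every nearby y still lie in Ω,
      -- where the Cauchy estimate applies.
      refine ⟨Metric.ball x (ρ / 2), mem_nhdsWithin_of_mem_nhds
        (Metric.ball_mem_nhds x (by positivity)), ?_⟩
      filter_upwards [herr.eventually_lt_const hε,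
        hto.eventually_lt_const (show 0 < ρ / 2 by positivity)] with k hk1 hk2 y hy
      have hball : Metric.closedBall y (1 / ((k : ℝ) + 1)) ⊆ Ω := by
        refine Subset.trans (fun z hz => ?_) hsub
        rw [Metric.mem_ball] at hy ⊢
        rw [Metric.mem_closedBall] at hz
        linarith [dist_triangle z y x]
      have hyΩ : y ∈ Ω := hball (Metric.mem_closedBall_self (hpos k).le)
      rw [dist_comm, Real.dist_eq]
      refine lt_of_le_of_lt (le_of_tendsto ((hE y hyΩ).const_sub (a k y)).abs ?_) hk1
      filter_upwards [Filter.eventually_ge_atTop k] with l hkl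
      exact hca y k hball l hkl
    · rw [← S.fn_W]
      filter_upwards [hae, ae_restrict_mem hΩ.measurableSet] with x hx hxΩ
      exact tendsto_nhds_unique hx ((hE x hxΩ).comp hns.tendsto_atTop)
    · intro x hx
      refine le_of_tendsto (hE x hx).abs ?_
      filter_upwards [hbd'] with k hk
      exact hk x
  choose e he using main
  exact ⟨2 * R + 1, e, by positivity, he⟩

end

/-! ### Splitting ℝ^{ι ⊕ κ} and tensor products of L² functions -/

section

variable {ι κ : Type} [Fintype ι] [Fintype κ]

variable (ι κ) in
/-- The first projection `ℝ^{ι ⊕ κ} → ℝ^ι`. -/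
def pL : Eu (ι ⊕ κ) →L[ℝ] Eu ι :=
  (WithLp.fstL 2 ℝ (Eu ι) (Eu κ)).comp
    (PiLp.sumPiLpEquivProdLpPiLp 2 (fun _ : ι ⊕ κ => ℝ) : Eu (ι ⊕ κ) ≃ₗᵢ[ℝ] _).toContinuousLinearEquiv.toContinuousLinearMap

variable (ι κ) in
/-- The second projection `ℝ^{ι ⊕ κ} → ℝ^κ`. -/
def pR : Eu (ι ⊕ κ) →L[ℝ] Eu κ :=
  (WithLp.sndL 2 ℝ (Eu ι) (Eu κ)).comp
    (PiLp.sumPiLpEquivProdLpPiLp 2 (fun _ : ι ⊕ κ => ℝ) : Eu (ι ⊕ κ) ≃ₗᵢ[ℝ] _).toContinuousLinearEquiv.toContinuousLinearMap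

/-- The point of `ℝ^{ι ⊕ κ}` with given projections. -/
def join (x : Eu ι) (y : Eu κ) : Eu (ι ⊕ κ) := WithLp.toLp 2 (Sum.elim x y)

@[simp] lemma pL_join (x : Eu ι) (y : Eu κ) : pL ι κ (join x y) = x := rfl

@[simp] lemma pR_join (x : Eu ι) (y : Eu κ) : pR ι κ (join x y) = y := rfl

@[simp] lemma join_pL_pR (z : Eu (ι ⊕ κ)) : join (pL ι κ z) (pR ι κ z) = z := by
  ext i
  rcases i with i | i <;> rfl

lemma join_add (x x' : Eu ι) (y y' : Eu κ) : join (x + x') (y + y') = join x y + join x' y' := by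
  ext i
  rcases i with i | i <;> rfl

lemma join_smul (c : ℝ) (x : Eu ι) (y : Eu κ) : join (c • x) (c • y) = c • join x y := by
  ext i
  rcases i with i | i <;> rfl

lemma inner_join (x : Eu ι) (y : Eu κ) (z : Eu (ι ⊕ κ)) :
    ⟪join x y, z⟫ = ⟪x, pL ι κ z⟫ + ⟪y, pR ι κ z⟫ := by
  rw [PiLp.inner_apply, PiLp.inner_apply, PiLp.inner_apply, Fintype.sum_sum_type]
  rfl

variable (ι κ) in
/-- The first inclusion `ℝ^ι → ℝ^{ι ⊕ κ}`. -/
def inL : Eu ι →L[ℝ] Eu (ι ⊕ κ) :=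
  LinearMap.toContinuousLinearMap
    { toFun := fun x => join x 0
      map_add' := fun x y => by rw [← join_add, add_zero]
      map_smul' := fun c x => by rw [RingHom.id_apply, ← join_smul, smul_zero] }

variable (ι κ) in
/-- The second inclusion `ℝ^κ → ℝ^{ι ⊕ κ}`. -/
def inR : Eu κ →L[ℝ] Eu (ι ⊕ κ) :=
  LinearMap.toContinuousLinearMap
    { toFun := fun x => join 0 x
      map_add' := fun x y => by rw [← join_add, add_zero]
      map_smul' := fun c x => by rw [RingHom.id_apply, ← join_smul, smul_zero] }

lemma inL_apply (x : Eu ι) : inL ι κ x = join x 0 := rfl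

lemma inR_apply (y : Eu κ) : inR ι κ y = join 0 y := rfl

lemma join_eq_add (x : Eu ι) (y : Eu κ) : join x y = inL ι κ x + inR ι κ y := by
  rw [inL_apply, inR_apply, ← join_add, add_zero, zero_add]

lemma inner_inL (x : Eu ι) (z : Eu (ι ⊕ κ)) : ⟪inL ι κ x, z⟫ = ⟪x, pL ι κ z⟫ := by
  rw [inL_apply, inner_join, inner_zero_left, add_zero]

lemma inner_inR (y : Eu κ) (z : Eu (ι ⊕ κ)) : ⟪inR ι κ y, z⟫ = ⟪y, pR ι κ z⟫ := by
  rw [inR_apply, inner_join, inner_zero_left, zero_add]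

lemma norm_inL (x : Eu ι) : ‖inL ι κ x‖ = ‖x‖ := by
  refine (sq_eq_sq₀ (norm_nonneg _) (norm_nonneg _)).1 ?_
  rw [← real_inner_self_eq_norm_sq, inner_inL, inL_apply, pL_join, real_inner_self_eq_norm_sq]

lemma norm_inR (y : Eu κ) : ‖inR ι κ y‖ = ‖y‖ := by
  refine (sq_eq_sq₀ (norm_nonneg _) (norm_nonneg _)).1 ?_
  rw [← real_inner_self_eq_norm_sq, inner_inR, inR_apply, pR_join, real_inner_self_eq_norm_sq]

variable (ι κ) in
/-- The measurable equivalence `ℝ^{ι ⊕ κ} ≃ ℝ^ι × ℝ^κ`. -/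
def splitE : Eu (ι ⊕ κ) ≃ᵐ Eu ι × Eu κ :=
  (PiLp.sumPiLpEquivProdLpPiLp 2 (fun _ : ι ⊕ κ => ℝ) :
    Eu (ι ⊕ κ) ≃ₗᵢ[ℝ] WithLp 2 (Eu ι × Eu κ)).toMeasurableEquiv.trans
    (MeasurableEquiv.toLp 2 (Eu ι × Eu κ)).symm

lemma splitE_apply (z : Eu (ι ⊕ κ)) : splitE ι κ z = (pL ι κ z, pR ι κ z) := rfl

lemma measurePreserving_splitE : MeasurePreserving (splitE ι κ) volume (volume.prod volume) :=
  (LinearIsometryEquiv.measurePreserving _).trans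
    (WithLp.volume_preserving_symm_measurableEquiv_toLp_prod (Eu ι) (Eu κ))

lemma join_mem_prodSet {A : Set (Eu ι)} {B : Set (Eu κ)} {x : Eu ι} {y : Eu κ} :
    join x y ∈ prodSet A B ↔ x ∈ A ∧ y ∈ B := Iff.rfl

lemma prodSet_eq_preimage (A : Set (Eu ι)) (B : Set (Eu κ)) :
    prodSet A B = splitE ι κ ⁻¹' (A ×ˢ B) := rfl

lemma isOpen_prodSet {A : Set (Eu ι)} {B : Set (Eu κ)} (hA : IsOpen A) (hB : IsOpen B) :
    IsOpen (prodSet A B) :=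
  (hA.preimage (pL ι κ).continuous).inter (hB.preimage (pR ι κ).continuous)

lemma measurePreserving_splitE_restrict (A : Set (Eu ι)) (B : Set (Eu κ)) :
    MeasurePreserving (splitE ι κ) (volume.restrict (prodSet A B))
      ((volume.restrict A).prod (volume.restrict B)) := by
  rw [Measure.prod_restrict, prodSet_eq_preimage]
  exact measurePreserving_splitE.restrict_preimage_emb (splitE ι κ).measurableEmbedding (A ×ˢ B)

lemma integral_prodSet {E : Type*} [NormedAddCommGroup E] [NormedSpace ℝ E] (A : Set (Eu ι))
    (B : Set (Eu κ)) (f : Eu (ι ⊕ κ) → E) : ∫ z in prodSet A B, f z =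
      ∫ p, f (join p.1 p.2) ∂((volume.restrict A).prod (volume.restrict B)) := by
  rw [← (measurePreserving_splitE_restrict A B).integral_comp (splitE ι κ).measurableEmbedding]
  simp [splitE_apply]

lemma integrable_prodSet_iff {E : Type*} [NormedAddCommGroup E] (A : Set (Eu ι))
    (B : Set (Eu κ)) (f : Eu (ι ⊕ κ) → E) : Integrable f (volume.restrict (prodSet A B)) ↔
      Integrable (fun p => f (join p.1 p.2)) ((volume.restrict A).prod (volume.restrict B)) := by
  rw [← (measurePreserving_splitE_restrict A B).integrable_comp_emb
    (splitE ι κ).measurableEmbedding]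
  simp [Function.comp_def, splitE_apply]

lemma ae_pL {A : Set (Eu ι)} {B : Set (Eu κ)} {p : Eu ι → Prop}
    (h : ∀ᵐ x ∂(volume.restrict A), p x) : ∀ᵐ z ∂(volume.restrict (prodSet A B)), p (pL ι κ z) :=
  (measurePreserving_splitE_restrict A B).quasiMeasurePreserving.ae
    (Measure.quasiMeasurePreserving_fst.ae h)

lemma ae_pR {A : Set (Eu ι)} {B : Set (Eu κ)} {p : Eu κ → Prop}
    (h : ∀ᵐ x ∂(volume.restrict B), p x) : ∀ᵐ z ∂(volume.restrict (prodSet A B)), p (pR ι κ z) :=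
  (measurePreserving_splitE_restrict A B).quasiMeasurePreserving.ae
    (Measure.quasiMeasurePreserving_snd.ae h)

section tensor

variable {E F G : Type} [NormedAddCommGroup E] [NormedSpace ℝ E] [NormedAddCommGroup F]
  [NormedSpace ℝ F] [NormedAddCommGroup G] [NormedSpace ℝ G] (A : Set (Eu ι)) (B : Set (Eu κ))
  (b : E →L[ℝ] F →L[ℝ] G)

variable {A B}

/-- The pointwise product of functions of the two groups of variables. -/
def tensFn (f : Eu ι → E) (g : Eu κ → F) (z : Eu (ι ⊕ κ)) : G := b (f (pL ι κ z)) (g (pR ι κ z))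

lemma aestronglyMeasurable_tensFn {f : Eu ι → E} {g : Eu κ → F}
    (hf : AEStronglyMeasurable f (volume.restrict A))
    (hg : AEStronglyMeasurable g (volume.restrict B)) :
    AEStronglyMeasurable (tensFn b f g) (volume.restrict (prodSet A B)) := by
  have hq := (measurePreserving_splitE_restrict A B).quasiMeasurePreserving
  exact b.aestronglyMeasurable_comp₂
    (hf.comp_quasiMeasurePreserving (Measure.quasiMeasurePreserving_fst.comp hq))
    (hg.comp_quasiMeasurePreserving (Measure.quasiMeasurePreserving_snd.comp hq))

variable {b} in
-- Tonelli on the product. A general bilinear map `b` serves function times function and both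
-- products of a function with a vector field.
lemma lintegral_tensFn_le (hb : ∀ x y, ‖b x y‖ ≤ ‖x‖ * ‖y‖) {f : Eu ι → E} {g : Eu κ → F}
    (hf : AEStronglyMeasurable f (volume.restrict A))
    (hg : AEStronglyMeasurable g (volume.restrict B)) :
    ∫⁻ z in prodSet A B, ‖tensFn b f g z‖ₑ ^ 2 ≤
      (∫⁻ x in A, ‖f x‖ₑ ^ 2) * ∫⁻ y in B, ‖g y‖ₑ ^ 2 := by
  rw [← lintegral_prod_mul (hf.enorm.pow_const 2) (hg.enorm.pow_const 2),
    ← (measurePreserving_splitE_restrict A B).lintegral_comp_emb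
      (splitE ι κ).measurableEmbedding]
  refine lintegral_mono fun z => ?_
  rw [← mul_pow, splitE_apply]
  gcongr
  rw [← enorm_norm (f _), ← enorm_norm (g _), ← enorm_mul, enorm_le_iff_norm_le, norm_mul,
    norm_norm, norm_norm]
  exact hb _ _

variable {b} in
lemma memLp_tensFn (hb : ∀ x y, ‖b x y‖ ≤ ‖x‖ * ‖y‖) {f : Eu ι → E} {g : Eu κ → F}
    (hf : MemLp f 2 (volume.restrict A)) (hg : MemLp g 2 (volume.restrict B)) :
    MemLp (tensFn b f g) 2 (volume.restrict (prodSet A B)) := by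
  refine ⟨aestronglyMeasurable_tensFn b hf.1 hg.1, ?_⟩
  have key : ∀ {X E : Type} [MeasurableSpace X] [NormedAddCommGroup E] {μ : Measure X} {f : X → E},
      eLpNorm f 2 μ < ⊤ ↔ ∫⁻ x, ‖f x‖ₑ ^ 2 ∂μ < ⊤ := by
    intro X E _ _ μ f
    rw [eLpNorm_lt_top_iff_lintegral_rpow_enorm_lt_top (by norm_num) (by norm_num)]
    norm_num
  exact key.2 ((lintegral_tensFn_le hb hf.1 hg.1).trans_lt
    (ENNReal.mul_lt_top (key.1 hf.2) (key.1 hg.2)))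

variable {b}

/-- Tensor product of `L²` functions. -/
def tensLp (hb : ∀ x y, ‖b x y‖ ≤ ‖x‖ * ‖y‖) (f : Lp E 2 (volume.restrict A))
    (g : Lp F 2 (volume.restrict B)) : Lp G 2 (volume.restrict (prodSet A B)) :=
  (memLp_tensFn hb (Lp.memLp f) (Lp.memLp g)).toLp _

lemma coeFn_tensLp (hb : ∀ x y, ‖b x y‖ ≤ ‖x‖ * ‖y‖) (f : Lp E 2 (volume.restrict A))
    (g : Lp F 2 (volume.restrict B)) :
    tensLp hb f g =ᵐ[volume.restrict (prodSet A B)] tensFn b f g :=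
  (memLp_tensFn hb (Lp.memLp f) (Lp.memLp g)).coeFn_toLp

lemma tensLp_add_left (hb : ∀ x y, ‖b x y‖ ≤ ‖x‖ * ‖y‖) (f f' : Lp E 2 (volume.restrict A))
    (g : Lp F 2 (volume.restrict B)) : tensLp hb (f + f') g = tensLp hb f g + tensLp hb f' g := by
  refine Lp.ext ?_
  filter_upwards [coeFn_tensLp hb (f + f') g, coeFn_tensLp hb f g, coeFn_tensLp hb f' g,
    Lp.coeFn_add (tensLp hb f g) (tensLp hb f' g), ae_pL (B := B) (Lp.coeFn_add f f')]
    with z h1 h2 h3 h4 h5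
  rw [h1, h4, Pi.add_apply, h2, h3, tensFn, h5, Pi.add_apply, map_add,
    add_apply]
  rfl

lemma tensLp_add_right (hb : ∀ x y, ‖b x y‖ ≤ ‖x‖ * ‖y‖) (f : Lp E 2 (volume.restrict A))
    (g g' : Lp F 2 (volume.restrict B)) :
    tensLp hb f (g + g') = tensLp hb f g + tensLp hb f g' := by
  refine Lp.ext ?_
  filter_upwards [coeFn_tensLp hb f (g + g'), coeFn_tensLp hb f g, coeFn_tensLp hb f g',
    Lp.coeFn_add (tensLp hb f g) (tensLp hb f g'), ae_pR (A := A) (Lp.coeFn_add g g')]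
    with z h1 h2 h3 h4 h5
  rw [h1, h4, Pi.add_apply, h2, h3, tensFn, h5, Pi.add_apply, map_add]
  rfl

lemma tensLp_smul_left (hb : ∀ x y, ‖b x y‖ ≤ ‖x‖ * ‖y‖) (c : ℝ)
    (f : Lp E 2 (volume.restrict A)) (g : Lp F 2 (volume.restrict B)) :
    tensLp hb (c • f) g = c • tensLp hb f g := by
  refine Lp.ext ?_
  filter_upwards [coeFn_tensLp hb (c • f) g, coeFn_tensLp hb f g,
    Lp.coeFn_smul c (tensLp hb f g), ae_pL (B := B) (Lp.coeFn_smul c f)] with z h1 h2 h3 h4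
  rw [h1, h3, Pi.smul_apply, h2, tensFn, h4, Pi.smul_apply, map_smul,
    smul_apply]
  rfl

lemma tensLp_smul_right (hb : ∀ x y, ‖b x y‖ ≤ ‖x‖ * ‖y‖) (c : ℝ)
    (f : Lp E 2 (volume.restrict A)) (g : Lp F 2 (volume.restrict B)) :
    tensLp hb f (c • g) = c • tensLp hb f g := by
  refine Lp.ext ?_
  filter_upwards [coeFn_tensLp hb f (c • g), coeFn_tensLp hb f g,
    Lp.coeFn_smul c (tensLp hb f g), ae_pR (A := A) (Lp.coeFn_smul c g)] with z h1 h2 h3 h4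
  rw [h1, h3, Pi.smul_apply, h2, tensFn, h4, Pi.smul_apply, map_smul]
  rfl

lemma norm_tensLp_le (hb : ∀ x y, ‖b x y‖ ≤ ‖x‖ * ‖y‖) (f : Lp E 2 (volume.restrict A))
    (g : Lp F 2 (volume.restrict B)) : ‖tensLp hb f g‖ ≤ ‖f‖ * ‖g‖ := by
  refine enorm_le_of_sq_le (norm_nonneg f) ?_
  rw [ofReal_norm, tensLp, enorm_sq_toLp, enorm_sq_L2, enorm_sq_L2]
  exact lintegral_tensFn_le hb (Lp.aestronglyMeasurable f) (Lp.aestronglyMeasurable g)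

variable (b) in
/-- Tensor product of `L²` functions, as a bounded bilinear map. -/
def tens (hb : ∀ x y, ‖b x y‖ ≤ ‖x‖ * ‖y‖) (A : Set (Eu ι)) (B : Set (Eu κ)) :
    Lp E 2 (volume.restrict A) →L[ℝ] Lp F 2 (volume.restrict B) →L[ℝ]
      Lp G 2 (volume.restrict (prodSet A B)) :=
  LinearMap.mkContinuous₂
    (LinearMap.mk₂ ℝ (tensLp hb) (tensLp_add_left hb) (tensLp_smul_left hb)
      (tensLp_add_right hb) (tensLp_smul_right hb)) 1
    (fun f g => by rw [one_mul]; exact norm_tensLp_le hb f g)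

lemma tens_apply (hb : ∀ x y, ‖b x y‖ ≤ ‖x‖ * ‖y‖) (f : Lp E 2 (volume.restrict A))
    (g : Lp F 2 (volume.restrict B)) :
    tens b hb A B f g = (memLp_tensFn hb (Lp.memLp f) (Lp.memLp g)).toLp _ := rfl

lemma coeFn_tens (hb : ∀ x y, ‖b x y‖ ≤ ‖x‖ * ‖y‖) (f : Lp E 2 (volume.restrict A))
    (g : Lp F 2 (volume.restrict B)) :
    tens b hb A B f g =ᵐ[volume.restrict (prodSet A B)] tensFn b f g :=
  (memLp_tensFn hb (Lp.memLp f) (Lp.memLp g)).coeFn_toLp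

lemma tens_toLp (hb : ∀ x y, ‖b x y‖ ≤ ‖x‖ * ‖y‖) {f : Eu ι → E} {g : Eu κ → F}
    (hf : MemLp f 2 (volume.restrict A)) (hg : MemLp g 2 (volume.restrict B)) :
    tens b hb A B (hf.toLp f) (hg.toLp g) = (memLp_tensFn hb hf hg).toLp _ := by
  rw [tens_apply]
  refine MemLp.toLp_congr _ _ ?_
  filter_upwards [ae_pL (B := B) hf.coeFn_toLp, ae_pR (A := A) hg.coeFn_toLp] with z h1 h2
  rw [tensFn, tensFn, h1, h2]

end tensor

end

/-! ### Separation of variables in H¹₀ and completeness of tensor products -/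

section

variable {ι κ : Type} [Fintype ι] [Fintype κ]

/-- `(x, c) ↦ c x` with values in `ℝ^{ι ⊕ κ}`. -/
def bL : Eu ι →L[ℝ] ℝ →L[ℝ] Eu (ι ⊕ κ) :=
  (ContinuousLinearMap.lsmul ℝ ℝ : ℝ →L[ℝ] Eu (ι ⊕ κ) →L[ℝ] Eu (ι ⊕ κ)).flip.bilinearComp
    (inL ι κ) (ContinuousLinearMap.id ℝ ℝ)

/-- `(c, y) ↦ c y` with values in `ℝ^{ι ⊕ κ}`. -/
def bR : ℝ →L[ℝ] Eu κ →L[ℝ] Eu (ι ⊕ κ) :=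
  (ContinuousLinearMap.lsmul ℝ ℝ : ℝ →L[ℝ] Eu (ι ⊕ κ) →L[ℝ] Eu (ι ⊕ κ)).bilinearComp
    (ContinuousLinearMap.id ℝ ℝ) (inR ι κ)

lemma bL_apply (x : Eu ι) (c : ℝ) : (bL x c : Eu (ι ⊕ κ)) = c • inL ι κ x := rfl

lemma bR_apply (c : ℝ) (y : Eu κ) : (bR c y : Eu (ι ⊕ κ)) = c • inR ι κ y := rfl

lemma norm_bL_le (x : Eu ι) (c : ℝ) : ‖(bL x c : Eu (ι ⊕ κ))‖ ≤ ‖x‖ * ‖c‖ := by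
  rw [bL_apply, norm_smul, norm_inL, mul_comm]

lemma norm_bR_le (c : ℝ) (y : Eu κ) : ‖(bR c y : Eu (ι ⊕ κ))‖ ≤ ‖c‖ * ‖y‖ := by
  rw [bR_apply, norm_smul, norm_inR]

lemma norm_mul_apply_le (x y : ℝ) : ‖ContinuousLinearMap.mul ℝ ℝ x y‖ ≤ ‖x‖ * ‖y‖ :=
  norm_mul_le x y

/-- `f ⊗ g` for scalar functions. -/
def tS (A : Set (Eu ι)) (B : Set (Eu κ)) : L2 A →L[ℝ] L2 B →L[ℝ] L2 (prodSet A B) :=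
  tens (ContinuousLinearMap.mul ℝ ℝ) norm_mul_apply_le A B

/-- `F ⊗ g` for a vector field `F` in the first variables. -/
def tL (A : Set (Eu ι)) (B : Set (Eu κ)) : L2Vec A →L[ℝ] L2 B →L[ℝ] L2Vec (prodSet A B) :=
  tens (bL (ι := ι) (κ := κ)) norm_bL_le A B

/-- `f ⊗ G` for a vector field `G` in the second variables. -/
def tR (A : Set (Eu ι)) (B : Set (Eu κ)) : L2 A →L[ℝ] L2Vec B →L[ℝ] L2Vec (prodSet A B) :=
  tens (bR (ι := ι) (κ := κ)) norm_bR_le A B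

variable {A : Set (Eu ι)} {B : Set (Eu κ)}

lemma coeFn_tS (f : L2 A) (g : L2 B) :
    tS A B f g =ᵐ[volume.restrict (prodSet A B)] fun z => f (pL ι κ z) * g (pR ι κ z) :=
  coeFn_tens norm_mul_apply_le f g

lemma coeFn_tL (f : L2Vec A) (g : L2 B) :
    tL A B f g =ᵐ[volume.restrict (prodSet A B)] fun z => g (pR ι κ z) • inL ι κ (f (pL ι κ z)) :=
  coeFn_tens (b := bL (ι := ι) (κ := κ)) norm_bL_le f g

lemma coeFn_tR (f : L2 A) (g : L2Vec B) :
    tR A B f g =ᵐ[volume.restrict (prodSet A B)] fun z => f (pL ι κ z) • inR ι κ (g (pR ι κ z)) :=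
  coeFn_tens (b := bR (ι := ι) (κ := κ)) norm_bR_le f g

lemma gradient_comp_pL {φ : Eu ι → ℝ} {z : Eu (ι ⊕ κ)} (h : Differentiable ℝ φ) :
    gradient (fun z => φ (pL ι κ z)) z = inL ι κ (gradient φ (pL ι κ z)) := by
  refine HasGradientAt.gradient ?_
  rw [hasGradientAt_iff_hasFDerivAt]
  refine ((h _).hasFDerivAt.comp z (pL ι κ).hasFDerivAt).congr_fderiv ?_
  ext v
  rw [InnerProductSpace.toDual_apply_apply, inner_inL, inner_gradient_left]
  rfl

lemma gradient_comp_pR {φ : Eu κ → ℝ} {z : Eu (ι ⊕ κ)} (h : Differentiable ℝ φ) :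
    gradient (fun z => φ (pR ι κ z)) z = inR ι κ (gradient φ (pR ι κ z)) := by
  refine HasGradientAt.gradient ?_
  rw [hasGradientAt_iff_hasFDerivAt]
  refine ((h _).hasFDerivAt.comp z (pR ι κ).hasFDerivAt).congr_fderiv ?_
  ext v
  rw [InnerProductSpace.toDual_apply_apply, inner_inR, inner_gradient_left]
  rfl

lemma continuous_join : Continuous fun p : Eu ι × Eu κ => join p.1 p.2 := by
  simp only [join_eq_add]
  fun_prop

lemma IsTest.tensor {φ : Eu ι → ℝ} {ψ : Eu κ → ℝ} (h : IsTest A φ) (h' : IsTest B ψ) :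
    IsTest (prodSet A B) (fun z => φ (pL ι κ z) * ψ (pR ι κ z)) := by
  set K : Set (Eu (ι ⊕ κ)) := (fun p : Eu ι × Eu κ => join p.1 p.2) '' (tsupport φ ×ˢ tsupport ψ)
  have hK : IsCompact K := (h.2.1.prod h'.2.1).image continuous_join
  have hsub : tsupport (fun z => φ (pL ι κ z) * ψ (pR ι κ z)) ⊆ K := by
    refine closure_minimal (fun z hz => ?_) hK.isClosed
    have hz' := mul_ne_zero_iff.1 hz
    exact ⟨(pL ι κ z, pR ι κ z), ⟨subset_tsupport _ hz'.1, subset_tsupport _ hz'.2⟩,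
      join_pL_pR z⟩
  refine ⟨(h.1.comp (pL ι κ).contDiff).mul (h'.1.comp (pR ι κ).contDiff),
    hK.of_isClosed_subset (isClosed_tsupport _) hsub, hsub.trans ?_⟩
  rintro z ⟨p, ⟨h1, h2⟩, rfl⟩
  exact join_mem_prodSet.2 ⟨h.2.2 h1, h'.2.2 h2⟩

/-- The pair `(f, ∇f)` for `f = w₁ ⊗ w₂`. -/
def tensPair (w₁ : H10 A) (w₂ : H10 B) :
    WithLp 2 (L2 (prodSet A B) × L2Vec (prodSet A B)) :=
  WithLp.toLp 2 (tS A B (h10Fn w₁) (h10Fn w₂),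
    tL A B (h10Grad w₁) (h10Fn w₂) + tR A B (h10Fn w₁) (h10Grad w₂))

lemma continuous_tensPair_left (w₂ : H10 B) : Continuous fun w₁ : H10 A => tensPair w₁ w₂ := by
  refine (WithLp.prodContinuousLinearEquiv 2 ℝ _ _).symm.continuous.comp (Continuous.prodMk ?_ ?_)
  · exact ((tS A B).continuous.comp continuous_h10Fn).clm_apply continuous_const
  · exact (((tL A B).continuous.comp continuous_h10Grad).clm_apply continuous_const).add
      (((tR A B).continuous.comp continuous_h10Fn).clm_apply continuous_const)

lemma continuous_tensPair_right (w₁ : H10 A) : Continuous fun w₂ : H10 B => tensPair w₁ w₂ := by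
  refine (WithLp.prodContinuousLinearEquiv 2 ℝ _ _).symm.continuous.comp (Continuous.prodMk ?_ ?_)
  · exact (tS A B (h10Fn w₁)).continuous.comp continuous_h10Fn
  · exact ((tL A B (h10Grad w₁)).continuous.comp continuous_h10Fn).add
      ((tR A B (h10Fn w₁)).continuous.comp continuous_h10Grad)

/-- Products of test functions are test functions on the product, with gradient given by the Leibniz
rule. Approximating one factor at a time suffices since the target space is closed. -/
lemma tensPair_mem (w₁ : H10 A) (w₂ : H10 B) : tensPair w₁ w₂ ∈ H10 (prodSet A B) := by
  have hcl : IsClosed ((H10 (prodSet A B) : Submodule ℝ _) :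
      Set (WithLp 2 (L2 (prodSet A B) × L2Vec (prodSet A B)))) :=
    Submodule.isClosed_topologicalClosure _
  induction w₁ using H10.induction with
  | hp => exact hcl.preimage (continuous_tensPair_left w₂)
  | h φ h =>
  induction w₂ using H10.induction with
  | hp => exact hcl.preimage (continuous_tensPair_right h.toH10)
  | h ψ h' =>
  have e : tensPair h.toH10 h'.toH10 = (h.tensor h').pair := by
    apply (WithLp.equiv 2 _).injective
    refine Prod.ext ?_ ?_
    · exact (tens_toLp norm_mul_apply_le h.memLp h'.memLp).trans rfl
    · change tL A B (h10Grad h.toH10) (h10Fn h'.toH10) + tR A B (h10Fn h.toH10) (h10Grad h'.toH10)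
        = (h.tensor h').memLp_gradient.toLp _
      rw [h.h10Grad_toH10, h'.h10Grad_toH10, h.h10Fn_toH10, h'.h10Fn_toH10, tL, tR, tens_toLp,
        tens_toLp, ← MemLp.toLp_add]
      refine MemLp.toLp_congr _ _ (Filter.Eventually.of_forall fun z => ?_)
      have d1 : DifferentiableAt ℝ (fun z => φ (pL ι κ z)) z :=
        (h.differentiable _).comp z (pL ι κ).differentiableAt
      have d2 : DifferentiableAt ℝ (fun z => ψ (pR ι κ z)) z :=
        (h'.differentiable _).comp z (pR ι κ).differentiableAt
      rw [gradient_mul d1 d2, gradient_comp_pL h.differentiable,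
        gradient_comp_pR h'.differentiable, add_comm]
      rfl
  rw [e]
  exact h.tensor h' |>.toH10.2

/-- Tensor product of `H¹₀` functions. -/
def tensH10 (w₁ : H10 A) (w₂ : H10 B) : H10 (prodSet A B) := ⟨tensPair w₁ w₂, tensPair_mem w₁ w₂⟩

lemma h10Fn_tensH10 (w₁ : H10 A) (w₂ : H10 B) :
    h10Fn (tensH10 w₁ w₂) = tS A B (h10Fn w₁) (h10Fn w₂) := rfl

lemma h10Grad_tensH10 (w₁ : H10 A) (w₂ : H10 B) : h10Grad (tensH10 w₁ w₂) =
    tL A B (h10Grad w₁) (h10Fn w₂) + tR A B (h10Fn w₁) (h10Grad w₂) := rfl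

/-- Slices of a test function are admissible in the weak equation of one factor. Compact support
survives because the slice inclusion is a closed embedding. -/
lemma IsTest.slice_left {v : Eu (ι ⊕ κ) → ℝ} (h : IsTest (prodSet A B) v) (y : Eu κ) :
    IsTest A (fun x => v (join x y)) := by
  have hd : ContDiff ℝ (⊤ : ℕ∞) fun x : Eu ι => join x y := by
    simp only [join_eq_add]
    exact (inL ι κ).contDiff.add contDiff_const
  have he : Topology.IsClosedEmbedding fun x : Eu ι => join x y := by
    refine Isometry.isClosedEmbedding (Isometry.of_dist_eq fun x x' => ?_)
    rw [join_eq_add, join_eq_add, dist_add_right, dist_eq_norm, ← map_sub, norm_inL, dist_eq_norm]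
  refine ⟨h.1.comp hd, h.2.1.comp_isClosedEmbedding he, fun x hx => ?_⟩
  exact (join_mem_prodSet.1 (h.2.2 (tsupport_comp_subset_preimage v he.continuous hx))).1

lemma IsTest.slice_right {v : Eu (ι ⊕ κ) → ℝ} (h : IsTest (prodSet A B) v) (x : Eu ι) :
    IsTest B (fun y => v (join x y)) := by
  have hd : ContDiff ℝ (⊤ : ℕ∞) fun y : Eu κ => join x y := by
    simp only [join_eq_add]
    exact contDiff_const.add (inR ι κ).contDiff
  have he : Topology.IsClosedEmbedding fun y : Eu κ => join x y := by
    refine Isometry.isClosedEmbedding (Isometry.of_dist_eq fun y y' => ?_)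
    rw [join_eq_add, join_eq_add, dist_add_left, dist_eq_norm, ← map_sub, norm_inR, dist_eq_norm]
  refine ⟨h.1.comp hd, h.2.1.comp_isClosedEmbedding he, fun y hy => ?_⟩
  exact (join_mem_prodSet.1 (h.2.2 (tsupport_comp_subset_preimage v he.continuous hy))).2

lemma gradient_slice_left {v : Eu (ι ⊕ κ) → ℝ} (h : Differentiable ℝ v) (x : Eu ι) (y : Eu κ) :
    gradient (fun x => v (join x y)) x = pL ι κ (gradient v (join x y)) := by
  refine HasGradientAt.gradient ?_
  rw [hasGradientAt_iff_hasFDerivAt]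
  have h1 : HasFDerivAt (fun x : Eu ι => join x y) (inL ι κ) x := by
    simp only [join_eq_add]
    exact (inL ι κ).hasFDerivAt.add_const _
  refine ((h _).hasFDerivAt.comp x h1).congr_fderiv ?_
  ext u
  rw [InnerProductSpace.toDual_apply_apply, real_inner_comm, ← inner_inL, real_inner_comm,
    inner_gradient_left]
  rfl

lemma gradient_slice_right {v : Eu (ι ⊕ κ) → ℝ} (h : Differentiable ℝ v) (x : Eu ι) (y : Eu κ) :
    gradient (fun y => v (join x y)) y = pR ι κ (gradient v (join x y)) := by
  refine HasGradientAt.gradient ?_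
  rw [hasGradientAt_iff_hasFDerivAt]
  have h1 : HasFDerivAt (fun y : Eu κ => join x y) (inR ι κ) y := by
    simp only [join_eq_add]
    exact (inR ι κ).hasFDerivAt.const_add _
  refine ((h _).hasFDerivAt.comp y h1).congr_fderiv ?_
  ext u
  rw [InnerProductSpace.toDual_apply_apply, real_inner_comm, ← inner_inR, real_inner_comm,
    inner_gradient_left]
  rfl

/-- Separation of variables in the first group of variables. -/
lemma inner_tL_eq {w : H10 A} {lam : ℝ}
    (hw : ∀ v : H10 A, ⟪h10Grad w, h10Grad v⟫ = lam * ⟪h10Fn w, h10Fn v⟫) (g : L2 B)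
    (v : H10 (prodSet A B)) :
    ⟪tL A B (h10Grad w) g, h10Grad v⟫ = lam * ⟪tS A B (h10Fn w) g, h10Fn v⟫ := by
  induction v using H10.induction with
  | hp =>
    exact isClosed_eq (continuous_const.inner continuous_h10Grad)
      (continuous_const.mul (continuous_const.inner continuous_h10Fn))
  | h v h =>
  -- With `v` a test function, Fubini reduces the identity to the weak equation for `w` on each
  -- slice with y fixed, multiplied by g(y).
  have i1 : Integrable (fun z => ⟪tL A B (h10Grad w) g z, gradient v z⟫)
      (volume.restrict (prodSet A B)) := by
    refine (L2.integrable_inner (𝕜 := ℝ) (tL A B (h10Grad w) g) (h10Grad h.toH10)).congr ?_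
    filter_upwards [h.coeFn_h10Grad] with z hz
    rw [hz]
  have i2 : Integrable (fun z => ⟪tS A B (h10Fn w) g z, v z⟫)
      (volume.restrict (prodSet A B)) := by
    refine (L2.integrable_inner (𝕜 := ℝ) (tS A B (h10Fn w) g) (h10Fn h.toH10)).congr ?_
    filter_upwards [h.coeFn_h10Fn] with z hz
    rw [hz]
  have c1 : (fun z => ⟪tL A B (h10Grad w) g z, gradient v z⟫) =ᵐ[volume.restrict (prodSet A B)]
      fun z => g (pR ι κ z) * ⟪h10Grad w (pL ι κ z), pL ι κ (gradient v z)⟫ := by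
    filter_upwards [coeFn_tL (h10Grad w) g] with z hz
    rw [hz, real_inner_smul_left, inner_inL]
  have c2 : (fun z => ⟪tS A B (h10Fn w) g z, v z⟫) =ᵐ[volume.restrict (prodSet A B)]
      fun z => g (pR ι κ z) * ⟪h10Fn w (pL ι κ z), v z⟫ := by
    filter_upwards [coeFn_tS (h10Fn w) g] with z hz
    rw [hz, mul_comm, ← smul_eq_mul, real_inner_smul_left]
  rw [h.h10Grad_toH10, h.h10Fn_toH10, inner_toLp_right, inner_toLp_right, integral_congr_ae c1,
    integral_congr_ae c2, integral_prodSet, integral_prodSet,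
    integral_prod_symm _ ((integrable_prodSet_iff _ _ _).1 (i1.congr c1)),
    integral_prod_symm _ ((integrable_prodSet_iff _ _ _).1 (i2.congr c2)), ← integral_const_mul]
  refine integral_congr_ae (Filter.Eventually.of_forall fun y => ?_)
  simp only [pL_join, pR_join]
  rw [integral_const_mul, integral_const_mul]
  have h2 := h.slice_left y
  have h1 := hw h2.toH10
  rw [h2.h10Grad_toH10, h2.h10Fn_toH10, inner_toLp_right, inner_toLp_right] at h1
  simp only [gradient_slice_left h.differentiable] at h1
  rw [h1]
  ring

/-- Separation of variables in the second group of variables. -/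
lemma inner_tR_eq {w : H10 B} {lam : ℝ}
    (hw : ∀ v : H10 B, ⟪h10Grad w, h10Grad v⟫ = lam * ⟪h10Fn w, h10Fn v⟫) (f : L2 A)
    (v : H10 (prodSet A B)) :
    ⟪tR A B f (h10Grad w), h10Grad v⟫ = lam * ⟪tS A B f (h10Fn w), h10Fn v⟫ := by
  induction v using H10.induction with
  | hp =>
    exact isClosed_eq (continuous_const.inner continuous_h10Grad)
      (continuous_const.mul (continuous_const.inner continuous_h10Fn))
  | h v h =>
  have i1 : Integrable (fun z => ⟪tR A B f (h10Grad w) z, gradient v z⟫)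
      (volume.restrict (prodSet A B)) := by
    refine (L2.integrable_inner (𝕜 := ℝ) (tR A B f (h10Grad w)) (h10Grad h.toH10)).congr ?_
    filter_upwards [h.coeFn_h10Grad] with z hz
    rw [hz]
  have i2 : Integrable (fun z => ⟪tS A B f (h10Fn w) z, v z⟫)
      (volume.restrict (prodSet A B)) := by
    refine (L2.integrable_inner (𝕜 := ℝ) (tS A B f (h10Fn w)) (h10Fn h.toH10)).congr ?_
    filter_upwards [h.coeFn_h10Fn] with z hz
    rw [hz]
  have c1 : (fun z => ⟪tR A B f (h10Grad w) z, gradient v z⟫) =ᵐ[volume.restrict (prodSet A B)]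
      fun z => f (pL ι κ z) * ⟪h10Grad w (pR ι κ z), pR ι κ (gradient v z)⟫ := by
    filter_upwards [coeFn_tR f (h10Grad w)] with z hz
    rw [hz, real_inner_smul_left, inner_inR]
  have c2 : (fun z => ⟪tS A B f (h10Fn w) z, v z⟫) =ᵐ[volume.restrict (prodSet A B)]
      fun z => f (pL ι κ z) * ⟪h10Fn w (pR ι κ z), v z⟫ := by
    filter_upwards [coeFn_tS f (h10Fn w)] with z hz
    rw [hz, ← smul_eq_mul, real_inner_smul_left]
  rw [h.h10Grad_toH10, h.h10Fn_toH10, inner_toLp_right, inner_toLp_right, integral_congr_ae c1,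
    integral_congr_ae c2, integral_prodSet, integral_prodSet,
    integral_prod _ ((integrable_prodSet_iff _ _ _).1 (i1.congr c1)),
    integral_prod _ ((integrable_prodSet_iff _ _ _).1 (i2.congr c2)), ← integral_const_mul]
  refine integral_congr_ae (Filter.Eventually.of_forall fun x => ?_)
  simp only [pL_join, pR_join]
  rw [integral_const_mul, integral_const_mul]
  have h2 := h.slice_right x
  have h1 := hw h2.toH10
  rw [h2.h10Grad_toH10, h2.h10Fn_toH10, inner_toLp_right, inner_toLp_right] at h1
  simp only [gradient_slice_right h.differentiable] at h1
  rw [h1]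
  ring

lemma tensH10_eigen {w₁ : H10 A} {w₂ : H10 B} {lam μ : ℝ}
    (h₁ : ∀ v : H10 A, ⟪h10Grad w₁, h10Grad v⟫ = lam * ⟪h10Fn w₁, h10Fn v⟫)
    (h₂ : ∀ v : H10 B, ⟪h10Grad w₂, h10Grad v⟫ = μ * ⟪h10Fn w₂, h10Fn v⟫)
    (v : H10 (prodSet A B)) : ⟪h10Grad (tensH10 w₁ w₂), h10Grad v⟫ =
      (lam + μ) * ⟪h10Fn (tensH10 w₁ w₂), h10Fn v⟫ := by
  rw [h10Grad_tensH10, inner_add_left, inner_tL_eq h₁, inner_tR_eq h₂, h10Fn_tensH10, add_mul]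

lemma inner_tS (f f' : L2 A) (g g' : L2 B) :
    ⟪tS A B f g, tS A B f' g'⟫ = ⟪f, f'⟫ * ⟪g, g'⟫ := by
  rw [L2.inner_def, L2.inner_def, L2.inner_def, ← integral_prod_mul]
  have : ∫ z in prodSet A B, ⟪tS A B f g z, tS A B f' g' z⟫ = ∫ z in prodSet A B,
      ⟪f (pL ι κ z), f' (pL ι κ z)⟫ * ⟪g (pR ι κ z), g' (pR ι κ z)⟫ := by
    refine integral_congr_ae ?_
    filter_upwards [coeFn_tS f g, coeFn_tS f' g'] with z h1 h2
    rw [h1, h2]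
    simp only [RCLike.inner_apply, conj_trivial]
    ring
  rw [this, integral_prodSet]
  rfl

section complete

variable [IsFiniteMeasure ((volume : Measure (Eu ι)).restrict A)]
  [IsFiniteMeasure ((volume : Measure (Eu κ)).restrict B)]

instance : IsFiniteMeasure ((volume : Measure (Eu (ι ⊕ κ))).restrict (prodSet A B)) := by
  have h := (measurePreserving_splitE_restrict A B).measure_preimage
    (MeasurableSet.univ.nullMeasurableSet)
  refine ⟨?_⟩
  rw [preimage_univ] at h
  rw [h]
  exact measure_lt_top _ _

/-- Testing with indicators shows that f integrates to zero over rectangles. Hence the measures with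
densities the positive and negative parts of f agree on rectangles, so everywhere, and f vanishes
almost everywhere. -/
lemma eq_zero_of_inner_tS_eq_zero (f : L2 (prodSet A B))
    (h : ∀ (g₁ : L2 A) (g₂ : L2 B), ⟪tS A B g₁ g₂, f⟫ = 0) : f = 0 := by
  set P := ((volume : Measure (Eu ι)).restrict A).prod ((volume : Measure (Eu κ)).restrict B)
  set F : Eu ι × Eu κ → ℝ := fun p => f (join p.1 p.2) with hF
  have hfi : Integrable f (volume.restrict (prodSet A B)) := (Lp.memLp f).integrable (by norm_num)
  have hFi : Integrable F P := (integrable_prodSet_iff A B f).1 hfi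
  have hrect : ∀ s : Set (Eu ι), ∀ t : Set (Eu κ), MeasurableSet s → MeasurableSet t →
      ∫ p in s ×ˢ t, F p ∂P = 0 := by
    intro s t hs ht
    have m1 : MemLp (s.indicator fun _ => (1 : ℝ)) 2 ((volume : Measure (Eu ι)).restrict A) :=
      memLp_indicator_const 2 hs 1 (Or.inr (measure_ne_top _ _))
    have m2 : MemLp (t.indicator fun _ => (1 : ℝ)) 2 ((volume : Measure (Eu κ)).restrict B) :=
      memLp_indicator_const 2 ht 1 (Or.inr (measure_ne_top _ _))
    rw [← integral_indicator (hs.prod ht), ← h (m1.toLp _) (m2.toLp _), L2.inner_def]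
    have e : ∫ z in prodSet A B, ⟪tS A B (m1.toLp _) (m2.toLp _) z, f z⟫ = ∫ z in prodSet A B,
        (s ×ˢ t).indicator F (pL ι κ z, pR ι κ z) := by
      refine integral_congr_ae ?_
      filter_upwards [coeFn_tS (m1.toLp _) (m2.toLp _), ae_pL (B := B) m1.coeFn_toLp,
        ae_pR (A := A) m2.coeFn_toLp] with z h1 h2 h3
      rw [h1, h2, h3]
      by_cases h4 : pL ι κ z ∈ s <;> by_cases h5 : pR ι κ z ∈ t <;>
        simp [indicator, h4, h5, hF]
    rw [e, integral_prodSet]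
    rfl
  have hm : P.withDensity (fun p => ENNReal.ofReal (F p)) =
      P.withDensity (fun p => ENNReal.ofReal (-F p)) := by
    have : IsFiniteMeasure (P.withDensity fun p => ENNReal.ofReal (F p)) :=
      isFiniteMeasure_withDensity_ofReal hFi.2
    refine Measure.ext_prod fun {s t} hs ht => ?_
    rw [withDensity_apply _ (hs.prod ht), withDensity_apply _ (hs.prod ht)]
    have h1 := hrect s t hs ht
    rw [integral_eq_lintegral_pos_part_sub_lintegral_neg_part hFi.integrableOn, sub_eq_zero] at h1
    refine (ENNReal.toReal_eq_toReal_iff' ?_ ?_).1 h1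
    · exact (hFi.integrableOn.lintegral_lt_top).ne
    · exact (hFi.neg.integrableOn.lintegral_lt_top).ne
  have hF0 : F =ᵐ[P] 0 := by
    refine hFi.ae_eq_zero_of_forall_setIntegral_eq_zero fun s hs _ => ?_
    rw [integral_eq_lintegral_pos_part_sub_lintegral_neg_part hFi.integrableOn,
      ← withDensity_apply _ hs, ← withDensity_apply _ hs, hm, sub_self]
  rw [Lp.eq_zero_iff_ae_eq_zero]
  have := (measurePreserving_splitE_restrict A B).quasiMeasurePreserving.ae hF0
  filter_upwards [this] with z hz
  simpa [hF, splitE_apply] using hz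

/-- The tensor eigenbasis of a product domain. -/
lemma exists_tensor_hilbertBasis (S : EigenBasis A) (R : EigenBasis B) :
    ∃ b : HilbertBasis (S.κ × R.κ) ℝ (L2 (prodSet A B)),
      ∀ i, b i = tS A B (S.b i.1) (R.b i.2) := by
  classical
  have ho : Orthonormal ℝ fun i : S.κ × R.κ => tS A B (S.b i.1) (R.b i.2) := by
    rw [orthonormal_iff_ite]
    rintro ⟨i, k⟩ ⟨i', k'⟩
    rw [inner_tS, orthonormal_iff_ite.1 S.b.orthonormal, orthonormal_iff_ite.1 R.b.orthonormal]
    by_cases h1 : i = i' <;> by_cases h2 : k = k' <;> simp [h1, h2]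
  have hc : (Submodule.span ℝ (Set.range fun i : S.κ × R.κ => tS A B (S.b i.1) (R.b i.2)))ᗮ = ⊥ := by
    rw [Submodule.eq_bot_iff]
    intro f hf
    rw [Submodule.mem_orthogonal'] at hf
    have h0 : ∀ i k, ⟪f, tS A B (S.b i) (R.b k)⟫ = 0 := fun i k =>
      hf _ (Submodule.subset_span ⟨(i, k), rfl⟩)
    have h1 : ∀ g₁ k, ⟪f, tS A B g₁ (R.b k)⟫ = 0 := by
      intro g₁ k
      have h2 := (S.b.hasSum_repr g₁).mapL ((innerSL ℝ f).comp ((tS A B).flip (R.b k)))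
      have h3 : (fun i => ((innerSL ℝ f).comp ((tS A B).flip (R.b k)))
          ((S.b.repr g₁) i • S.b i)) = fun _ => 0 := by
        funext i
        rw [map_smul]
        simp [h0]
      rw [h3] at h2
      exact h2.unique hasSum_zero
    refine eq_zero_of_inner_tS_eq_zero f fun g₁ g₂ => ?_
    rw [real_inner_comm]
    have h2 := (R.b.hasSum_repr g₂).mapL ((innerSL ℝ f).comp (tS A B g₁))
    have h3 : (fun k => ((innerSL ℝ f).comp (tS A B g₁)) ((R.b.repr g₂) k • R.b k)) =
        fun _ => 0 := by
      funext k
      rw [map_smul]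
      simp [h1]
    rw [h3] at h2
    exact h2.unique hasSum_zero
  refine ⟨HilbertBasis.mkOfOrthogonalEqBot ho hc, fun i => ?_⟩
  rw [HilbertBasis.coe_mkOfOrthogonalEqBot]

end complete

end

/-! ### Heat solutions along eigenfunctions, and continuous representatives -/

section

variable {ι κ : Type} [Fintype ι] [Fintype κ] {Ω : Set (Eu ι)}

lemma toHm1_apply (f : L2 Ω) (w : H10 Ω) : toHm1 f w = ⟪f, h10Fn w⟫ := rfl

lemma interval_dual_apply {V : Type*} [NormedAddCommGroup V] [NormedSpace ℝ V] {T : ℝ}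
    {dU : ℝ → V →L[ℝ] ℝ} (hdU : MemLp dU 2 (volume.restrict (Ioo 0 T))) {s : ℝ}
    (hs : s ∈ Icc 0 T) (w : V) :
    (∫ r in (0 : ℝ)..s, dU r) w = ∫ r in (0 : ℝ)..s, dU r w := by
  refine ContinuousLinearMap.intervalIntegral_apply ?_ w
  rw [intervalIntegrable_iff_integrableOn_Ioo_of_le hs.1]
  have : IntegrableOn dU (Ioo 0 T) := hdU.integrable (by norm_num)
  exact this.mono_set (Ioo_subset_Ioo_right hs.2)

/-- The components of a solution of the heat equation along eigenfunctions. -/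
lemma IsHeatSolution.inner_eq {T : ℝ} {u₀ : L2 Ω} {u : ℝ → L2 Ω} (h : IsHeatSolution Ω T u₀ u)
    {w : H10 Ω} {ν : ℝ} (hw : ∀ v : H10 Ω, ⟪h10Grad w, h10Grad v⟫ = ν * ⟪h10Fn w, h10Fn v⟫)
    {t : ℝ} (ht : t ∈ Icc 0 T) :
    ⟪h10Fn w, u t⟫ = Real.exp (-ν * t) * ⟪h10Fn w, u₀⟫ := by
  obtain ⟨U, dU, -, hdU, hU, hint, hweak⟩ := h.weak
  have hT : 0 ≤ T := ht.1.trans ht.2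
  set g : ℝ → ℝ := fun t => ⟪h10Fn w, u t⟫ with hg
  have hgc : ContinuousOn g (Icc 0 T) := continuousOn_const.inner h.continuousOn
  -- A continuous extension to the whole line makes the primitive `Φ` differentiable at every point,
  -- including the endpoint 0.
  set G : ℝ → ℝ := IccExtend hT ((Icc 0 T).domRestrict g)
  have hGc : Continuous G := hgc.domRestrict.Icc_extend'
  have hGg : ∀ s ∈ Icc 0 T, G s = g s := fun s hs => IccExtend_of_mem hT _ hs
  have key : ∀ s ∈ Icc 0 T, g s = g 0 + ∫ r in (0 : ℝ)..s, -ν * G r := by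
    intro s hs
    have hsub : Ioo 0 s ⊆ Ioo 0 T := Ioo_subset_Ioo_right hs.2
    have h1 : toHm1 (u s) w = toHm1 u₀ w + (∫ r in (0 : ℝ)..s, dU r) w := by
      rw [hint s hs]
      rfl
    rw [interval_dual_apply hdU hs, toHm1_apply, toHm1_apply, real_inner_comm,
      real_inner_comm (h10Fn w) u₀] at h1
    simp only [hg]
    rw [h1, h.initial]
    congr 1
    rw [intervalIntegral.integral_of_le hs.1, intervalIntegral.integral_of_le hs.1,
      integral_Ioc_eq_integral_Ioo, integral_Ioc_eq_integral_Ioo]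
    refine integral_congr_ae ?_
    filter_upwards [ae_restrict_of_ae_restrict_of_subset hsub hU,
      ae_restrict_of_ae_restrict_of_subset hsub hweak, ae_restrict_mem measurableSet_Ioo]
      with r h2 h3 hr
    have h4 := h3 w
    rw [real_inner_comm, hw, h2] at h4
    rw [hGg r ⟨hr.1.le, hr.2.le.trans hs.2⟩]
    simp only [hg]
    linarith
  set Φ : ℝ → ℝ := fun s => g 0 + ∫ r in (0 : ℝ)..s, -ν * G r
  have hΦ : ∀ s, HasDerivAt Φ (-ν * G s) s := fun s =>
    (((continuous_const.mul hGc).integral_hasStrictDerivAt 0 s).hasDerivAt).const_add _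
  -- The coefficient satisfies the integrated form of g' = -νg; the integrating factor makes the
  -- product constant.
  have hψ : ∀ s ∈ Ico 0 T, HasDerivAt (fun s => Real.exp (ν * s) * Φ s) 0 s := by
    intro s hs
    have hs' : s ∈ Icc 0 T := Ico_subset_Icc_self hs
    have h1 : HasDerivAt (fun s => Real.exp (ν * s)) (Real.exp (ν * s) * ν) s := by
      simpa using ((hasDerivAt_id s).const_mul ν).exp
    refine (h1.mul (hΦ s)).congr_deriv ?_
    rw [hGg s hs', key s hs']
    ring
  have hc := constant_of_has_deriv_right_zero (f := fun s => Real.exp (ν * s) * Φ s) (a := 0)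
    (b := T) (fun s _ => by
      have : Continuous fun s => Real.exp (ν * s) * Φ s :=
        (by fun_prop : Continuous fun s => Real.exp (ν * s)).mul
          (continuous_iff_continuousAt.2 fun s => (hΦ s).continuousAt)
      exact this.continuousWithinAt) (fun s hs => (hψ s hs).hasDerivWithinAt) t ht
  have h0 : Φ 0 = ⟪h10Fn w, u₀⟫ := by
    simp only [Φ, intervalIntegral.integral_same, add_zero, hg, h.initial]
  have h1 : g t = Φ t := key t ht
  simp only [mul_zero, Real.exp_zero, one_mul, h0] at hc
  change g t = _
  rw [h1, ← hc, ← mul_assoc, ← Real.exp_add]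
  simp

lemma memLp_Ioo_of_continuous {E : Type*} [NormedAddCommGroup E]
    {f : ℝ → E} (hf : Continuous f) (a b : ℝ) : MemLp f 2 (volume.restrict (Ioo a b)) := by
  obtain ⟨C, hC⟩ := isCompact_Icc.exists_bound_of_continuousOn (hf.continuousOn (s := Icc a b))
  refine MemLp.of_bound hf.aestronglyMeasurable C ?_
  filter_upwards [ae_restrict_mem measurableSet_Ioo] with x hx
  exact hC x (Ioo_subset_Icc_self hx)

/-- Exponential sums with values in a normed space. -/
lemma hasDerivAt_sum_exp_smul {I E : Type*} [NormedAddCommGroup E] [NormedSpace ℝ E] (F : Finset I)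
    (a lam : I → ℝ) (x : I → E) (t : ℝ) :
    HasDerivAt (fun t => ∑ i ∈ F, (a i * Real.exp (-lam i * t)) • x i)
        (∑ i ∈ F, (-lam i * (a i * Real.exp (-lam i * t))) • x i) t := by
  refine HasDerivAt.fun_sum fun i _ => HasDerivAt.smul_const ?_ _
  have h1 := ((((hasDerivAt_id t).const_mul (-lam i)).exp).const_mul (a i))
  refine h1.congr_deriv ?_
  simp only [id]
  ring

lemma continuous_sum_exp_smul {I E : Type*} [NormedAddCommGroup E] [NormedSpace ℝ E] (F : Finset I)
    (a lam : I → ℝ) (x : I → E) :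
    Continuous (fun t => ∑ i ∈ F, (a i * Real.exp (-lam i * t)) • x i) := by
  fun_prop
lemma continuous_sum_deriv_exp_smul {I E : Type*} [NormedAddCommGroup E] [NormedSpace ℝ E] (F : Finset I)
    (a lam : I → ℝ) (x : I → E) :
    Continuous (fun t => ∑ i ∈ F, (-lam i * (a i * Real.exp (-lam i * t))) • x i) := by
  fun_prop

lemma integral_sum_exp_smul {I E : Type*} [NormedAddCommGroup E] [NormedSpace ℝ E] [CompleteSpace E]
    (F : Finset I)
    (a lam : I → ℝ) (x : I → E) (t : ℝ) :
    ∑ i ∈ F, (a i * Real.exp (-lam i * t)) • x i =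
      ∑ i ∈ F, a i • x i + ∫ s in (0 : ℝ)..t, (∑ i ∈ F, (-lam i * (a i * Real.exp (-lam i * s))) • x i) := by
  rw [intervalIntegral.integral_eq_sub_of_hasDerivAt (fun s _ => hasDerivAt_sum_exp_smul F a lam x s)
      ((continuous_sum_deriv_exp_smul F a lam x).intervalIntegrable _ _)]
  simp

lemma toHm1_sum {I : Type*} (F : Finset I) (c : I → ℝ) (f : I → L2 Ω) :
    toHm1 (∑ i ∈ F, c i • f i) = ∑ i ∈ F, c i • toHm1 (f i) := by
  ext v
  simp [toHm1_apply, sum_inner, real_inner_smul_left]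

lemma h10Fn_sum {I : Type*} (F : Finset I) (c : I → ℝ) (w : I → H10 Ω) :
    h10Fn (∑ i ∈ F, c i • w i) = ∑ i ∈ F, c i • h10Fn (w i) := by
  change fnL Ω _ = _
  rw [map_sum]
  exact Finset.sum_congr rfl fun i _ => map_smul _ _ _

lemma h10Grad_sum {I : Type*} (F : Finset I) (c : I → ℝ) (w : I → H10 Ω) :
    h10Grad (∑ i ∈ F, c i • w i) = ∑ i ∈ F, c i • h10Grad (w i) := by
  change gradL Ω _ = _
  rw [map_sum]
  exact Finset.sum_congr rfl fun i _ => map_smul _ _ _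

lemma EigenBasis.weak_sum (S : EigenBasis Ω) (F : Finset S.κ) (c : S.κ → ℝ) (v : H10 Ω) :
    (∑ i ∈ F, (-S.lam i * c i) • toHm1 (S.b i)) v +
      ⟪h10Grad (∑ i ∈ F, c i • S.W i), h10Grad v⟫ = 0 := by
  rw [← toHm1_sum, toHm1_apply, h10Grad_sum, sum_inner, sum_inner, ← Finset.sum_add_distrib]
  refine Finset.sum_eq_zero fun i _ => ?_
  rw [real_inner_smul_left, real_inner_smul_left, S.eigen]
  ring

/-- Finite eigenfunction expansions solve the heat equation. -/
lemma EigenBasis.isHeatSolution_sum (S : EigenBasis Ω) (F : Finset S.κ) (a : S.κ → ℝ) (T : ℝ) :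
    IsHeatSolution Ω T (∑ i ∈ F, a i • S.b i)
      (fun t => ∑ i ∈ F, (a i * Real.exp (-S.lam i * t)) • S.b i) where
  continuousOn := (continuous_sum_exp_smul F a S.lam S.b).continuousOn
  initial := by simp
  weak := by
    refine ⟨fun t => ∑ i ∈ F, (a i * Real.exp (-S.lam i * t)) • S.W i,
      fun t => ∑ i ∈ F, (-S.lam i * (a i * Real.exp (-S.lam i * t))) • toHm1 (S.b i),
      memLp_Ioo_of_continuous (continuous_sum_exp_smul F a S.lam S.W) _ _,
      memLp_Ioo_of_continuous (continuous_sum_deriv_exp_smul F a S.lam fun i => toHm1 (S.b i)) _ _,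
      Filter.Eventually.of_forall fun t => ?_, fun t _ => ?_,
      Filter.Eventually.of_forall fun t v => S.weak_sum F _ v⟩
    · rw [h10Fn_sum]
      exact Finset.sum_congr rfl fun i _ => by rw [S.fn_W]
    · rw [toHm1_sum, toHm1_sum]
      exact integral_sum_exp_smul F a S.lam (fun i => toHm1 (S.b i)) t

/-- Continuous functions that agree almost everywhere on an open set agree on it, so the choice made
in `contRep` is immaterial. -/
lemma contRep_eqOn (hΩ : IsOpen Ω) {f : L2 Ω} {g : Eu ι → ℝ} (hg : ContinuousOn g Ω)
    (hfg : f =ᵐ[volume.restrict Ω] g) : EqOn (contRep f) g Ω := by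
  have h : ∃ g : Eu ι → ℝ, ContinuousOn g Ω ∧ f =ᵐ[volume.restrict Ω] g := ⟨g, hg, hfg⟩
  rw [contRep, dif_pos h]
  exact Measure.eqOn_open_of_ae_eq (h.choose_spec.2.symm.trans hfg) hΩ h.choose_spec.1 hg

lemma supOn_eq (hΩ : IsOpen Ω) {ω : Set (Eu ι)} (hω : ω ⊆ Ω) {f : L2 Ω} {g : Eu ι → ℝ}
    (hg : ContinuousOn g Ω) (hfg : f =ᵐ[volume.restrict Ω] g) : supOn ω f = ⨆ x ∈ ω, ‖g x‖ₑ := by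
  refine biSup_congr fun x hx => ?_
  rw [contRep_eqOn hΩ hg hfg (hω hx)]

lemma coeFn_finsetSum {α I : Type*} [MeasurableSpace α] {μ : Measure α} (F : Finset I) (c : I → ℝ)
    {f : I → Lp ℝ 2 μ} {e : I → α → ℝ} (h : ∀ i, f i =ᵐ[μ] e i) :
    ((∑ i ∈ F, c i • f i : Lp ℝ 2 μ) : α → ℝ) =ᵐ[μ] fun x => ∑ i ∈ F, c i * e i x := by
  classical
  induction F using Finset.induction_on with
  | empty =>
    simp only [Finset.sum_empty]
    exact Lp.coeFn_zero _ _ _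
  | insert i F hi ih =>
    rw [Finset.sum_insert hi]
    filter_upwards [ih, Lp.coeFn_add (c i • f i) (∑ i ∈ F, c i • f i), Lp.coeFn_smul (c i) (f i),
      h i] with x h1 h2 h3 h4
    rw [h2, Pi.add_apply, h1, h3, Pi.smul_apply, h4, Finset.sum_insert hi, smul_eq_mul]

/-- The continuous representative of a rapidly convergent eigenfunction expansion. -/
lemma ae_eq_tsum_of_summable [IsFiniteMeasure ((volume : Measure (Eu ι)).restrict Ω)]
    (hΩ : IsOpen Ω) {I : Type} (b : HilbertBasis I ℝ (L2 Ω)) {e : I → Eu ι → ℝ} {m : I → ℝ}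
    (he : ∀ i, ContinuousOn (e i) Ω) (hbe : ∀ i, b i =ᵐ[volume.restrict Ω] e i)
    (f : L2 Ω) (hm : Summable m) (hme : ∀ i, ∀ x ∈ Ω, ‖⟪b i, f⟫ * e i x‖ ≤ m i) :
    ContinuousOn (fun x => ∑' i, ⟪b i, f⟫ * e i x) Ω ∧
      f =ᵐ[volume.restrict Ω] fun x => ∑' i, ⟪b i, f⟫ * e i x := by
  have hc : ContinuousOn (fun x => ∑' i, ⟪b i, f⟫ * e i x) Ω :=
    continuousOn_tsum (fun i => continuousOn_const.mul (he i)) hm hme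
  refine ⟨hc, ?_⟩
  have hLp : MemLp (fun x => ∑' i, ⟪b i, f⟫ * e i x) 2 (volume.restrict Ω) := by
    refine MemLp.of_bound (hc.aestronglyMeasurable hΩ.measurableSet) (∑' i, m i) ?_
    filter_upwards [ae_restrict_mem hΩ.measurableSet] with x hx
    exact tsum_of_norm_bounded hm.hasSum fun i => hme i x hx
  -- Uniform convergence on a set of finite measure implies L² convergence. The pointwise sum is
  -- then identified with f by uniqueness of the limit of its basis expansion.
  have ht : Filter.Tendsto (fun F : Finset I => ∑ i ∈ F, ⟪b i, f⟫ • b i) Filter.atTop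
      (nhds (hLp.toLp _)) := by
    set K : ℝ := (measureUnivNNReal ((volume : Measure (Eu ι)).restrict Ω) : ℝ) ^
      ((2 : ℝ≥0∞).toReal⁻¹)
    have hK : 0 ≤ K := by positivity
    rw [Metric.tendsto_nhds]
    intro ε hε
    have hu := tendstoUniformlyOn_tsum hm hme
    rw [Metric.tendstoUniformlyOn_iff] at hu
    filter_upwards [hu (ε / (K + 1)) (by positivity)] with F hF
    rw [dist_comm, dist_eq_norm]
    have h1 : ‖hLp.toLp _ - ∑ i ∈ F, ⟪b i, f⟫ • b i‖ ≤ K * (ε / (K + 1)) := by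
      refine Lp.norm_le_of_ae_bound (by positivity) ?_
      filter_upwards [Lp.coeFn_sub (hLp.toLp _) (∑ i ∈ F, ⟪b i, f⟫ • b i), hLp.coeFn_toLp,
        coeFn_finsetSum F (fun i => ⟪b i, f⟫) hbe, ae_restrict_mem hΩ.measurableSet]
        with x h1 h2 h3 h4
      rw [h1, Pi.sub_apply, h2, h3, ← dist_eq_norm]
      exact (hF x h4).le
    refine h1.trans_lt ?_
    rw [mul_div_assoc', div_lt_iff₀ (by positivity)]
    nlinarith
  have hs : HasSum (fun i => ⟪b i, f⟫ • b i) f := by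
    simpa only [b.repr_apply_apply] using b.hasSum_repr f
  have hf : f = hLp.toLp _ := tendsto_nhds_unique hs ht
  have := hLp.coeFn_toLp
  rwa [← hf] at this

/-- Low frequency functions are fixed by the spectral projector. -/
lemma EigenBasis.specProj_sum (S : EigenBasis Ω) (F : Finset S.κ) (a : S.κ → ℝ) {Λ : ℝ}
    (hF : ∀ i ∈ F, S.lam i ≤ Λ) : specProj Ω Λ (∑ i ∈ F, a i • S.b i) = ∑ i ∈ F, a i • S.b i := by
  rw [specProj, Submodule.starProjection_eq_self_iff]
  refine Submodule.sum_mem _ fun i hi => Submodule.smul_mem _ _ ?_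
  refine Submodule.le_topologicalClosure _ (Submodule.subset_span ⟨S.lam i, hF i hi, S.W i,
    S.fn_W i, fun v => ?_⟩)
  rw [S.eigen, S.fn_W]

lemma norm_sq_sum_smul {I H : Type*} [NormedAddCommGroup H] [InnerProductSpace ℝ H] {b : I → H}
    (hb : Orthonormal ℝ b) (F : Finset I) (a : I → ℝ) :
    ‖∑ i ∈ F, a i • b i‖ ^ 2 = ∑ i ∈ F, a i ^ 2 := by
  rw [← real_inner_self_eq_norm_sq, hb.inner_sum]
  exact Finset.sum_congr rfl fun i _ => by simp [sq]

section tensor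

variable {A : Set (Eu ι)} {B : Set (Eu κ)} [IsFiniteMeasure ((volume : Measure (Eu ι)).restrict A)]
  [IsFiniteMeasure ((volume : Measure (Eu κ)).restrict B)]

/-- The eigenbasis of a product domain given by separation of variables. -/
def EigenBasis.tensor (S : EigenBasis A) (R : EigenBasis B) : EigenBasis (prodSet A B) where
  κ := S.κ × R.κ
  b := (exists_tensor_hilbertBasis S R).choose
  W i := tensH10 (S.W i.1) (R.W i.2)
  lam i := S.lam i.1 + R.lam i.2
  fn_W i := by
    rw [(exists_tensor_hilbertBasis S R).choose_spec, h10Fn_tensH10, S.fn_W, R.fn_W]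
  eigen i v := by
    rw [(exists_tensor_hilbertBasis S R).choose_spec, ← S.fn_W, ← R.fn_W, ← h10Fn_tensH10]
    exact tensH10_eigen (fun v => by rw [S.eigen, S.fn_W]) (fun v => by rw [R.eigen, R.fn_W]) v

lemma EigenBasis.coeFn_tensor (S : EigenBasis A) (R : EigenBasis B) {e : S.κ → Eu ι → ℝ}
    {e' : R.κ → Eu κ → ℝ} (he : ∀ i, S.b i =ᵐ[volume.restrict A] e i)
    (he' : ∀ k, R.b k =ᵐ[volume.restrict B] e' k) (i : S.κ × R.κ) :
    (S.tensor R).b i =ᵐ[volume.restrict (prodSet A B)]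
      fun z => e i.1 (pL ι κ z) * e' i.2 (pR ι κ z) := by
  have h : (S.tensor R).b i = tS A B (S.b i.1) (R.b i.2) :=
    (exists_tensor_hilbertBasis S R).choose_spec i
  rw [h]
  filter_upwards [coeFn_tS (S.b i.1) (R.b i.2), ae_pL (B := B) (he i.1), ae_pR (A := A) (he' i.2)]
    with z h1 h2 h3
  rw [h1, h2, h3]

end tensor

end

/-! ### Decay of coefficients, and the two hypotheses in terms of coefficients -/

section

variable {ι κ : Type} [Fintype ι] [Fintype κ] {Ω : Set (Eu ι)}

/-- The semigroup law, coefficient by coefficient, from the explicit formula at two times;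
restarting the equation at time t is avoided. -/
lemma EigenBasis.inner_heat (S : EigenBasis Ω) {T : ℝ} {u₀ : L2 Ω} {u : ℝ → L2 Ω}
    (h : IsHeatSolution Ω T u₀ u) (i : S.κ) {t r : ℝ} (ht : 0 ≤ t) (hr : 0 ≤ r) (htr : t + r ≤ T) :
    ⟪S.b i, u (t + r)⟫ = Real.exp (-S.lam i * r) * ⟪S.b i, u t⟫ := by
  have hw : ∀ v : H10 Ω, ⟪h10Grad (S.W i), h10Grad v⟫ = S.lam i * ⟪h10Fn (S.W i), h10Fn v⟫ :=
    fun v => by rw [S.eigen, S.fn_W]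
  have h1 := h.inner_eq hw (t := t + r) ⟨by positivity, htr⟩
  have h2 := h.inner_eq hw (t := t) ⟨ht, by linarith⟩
  rw [S.fn_W] at h1 h2
  rw [h1, h2, ← mul_assoc, ← Real.exp_add]
  ring_nf

lemma hasSum_sq_inner {I H : Type*} [NormedAddCommGroup H] [InnerProductSpace ℝ H]
    (b : HilbertBasis I ℝ H) (f : H) : HasSum (fun i => ⟪b i, f⟫ ^ 2) (‖f‖ ^ 2) := by
  have h := b.hasSum_inner_mul_inner f f
  rw [real_inner_self_eq_norm_sq] at h
  refine h.congr_fun fun i => ?_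
  rw [real_inner_comm, sq]

lemma abs_inner_basis_le {I H : Type*} [NormedAddCommGroup H] [InnerProductSpace ℝ H]
    (b : HilbertBasis I ℝ H) (i : I) (f : H) : |⟪b i, f⟫| ≤ ‖f‖ := by
  have := abs_real_inner_le_norm (b i) f
  rwa [b.orthonormal.1 i, one_mul] at this

lemma EigenBasis.norm_heat_le (S : EigenBasis Ω) {T : ℝ} {u₀ : L2 Ω} {u : ℝ → L2 Ω}
    (h : IsHeatSolution Ω T u₀ u) {t r : ℝ} (ht : 0 ≤ t) (hr : 0 ≤ r) (htr : t + r ≤ T) :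
    ‖u (t + r)‖ ≤ ‖u t‖ := by
  refine le_of_sq_le_sq ?_ (norm_nonneg _)
  refine hasSum_le (fun i => ?_) (hasSum_sq_inner S.b (u (t + r))) (hasSum_sq_inner S.b (u t))
  rw [S.inner_heat h i ht hr htr, mul_pow]
  refine mul_le_of_le_one_left (sq_nonneg _) (pow_le_one₀ (Real.exp_pos _).le ?_)
  rw [Real.exp_le_one_iff, neg_mul, neg_nonpos]
  exact mul_nonneg (S.lam_nonneg i) hr

/-- Splitting of a solution into low and high frequencies. -/
lemma EigenBasis.norm_sq_heat_le (S : EigenBasis Ω) {T : ℝ} {u₀ : L2 Ω} {u : ℝ → L2 Ω}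
    (h : IsHeatSolution Ω T u₀ u) {t r : ℝ} (ht : 0 ≤ t) (hr : 0 ≤ r) (htr : t + r ≤ T)
    (F : Finset S.κ) {Λ : ℝ} (hF : ∀ i ∉ F, Λ ≤ S.lam i) :
    ‖u (t + r)‖ ^ 2 ≤
      ∑ i ∈ F, ⟪S.b i, u (t + r)⟫ ^ 2 + Real.exp (-2 * Λ * r) * ‖u t‖ ^ 2 := by
  classical
  have h1 : HasSum (fun i => if i ∈ F then ⟪S.b i, u (t + r)⟫ ^ 2 else 0)
      (∑ i ∈ F, ⟪S.b i, u (t + r)⟫ ^ 2) := by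
    rw [← Finset.sum_congr rfl fun i (hi : i ∈ F) => if_pos hi]
    exact hasSum_sum_of_ne_finset_zero fun i hi => if_neg hi
  refine hasSum_le (fun i => ?_) (hasSum_sq_inner S.b (u (t + r)))
    (h1.add ((hasSum_sq_inner S.b (u t)).mul_left _))
  split_ifs with hi
  · exact le_add_of_nonneg_right (by positivity)
  · rw [zero_add, S.inner_heat h i ht hr htr, mul_pow]
    refine mul_le_mul_of_nonneg_right ?_ (sq_nonneg _)
    rw [← Real.exp_nat_mul, Real.exp_le_exp]
    push_cast
    nlinarith [mul_le_mul_of_nonneg_right (hF i hi) hr]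

/-- One term of the exponential series at r(1 + l); since r ≤ 1, the extra r in the exponent costs
at most a factor e. -/
lemma pow_mul_exp_neg_le (q : ℕ) {r l : ℝ} (hr : 0 < r) (hr1 : r ≤ 1) (hl : 0 ≤ l) :
    Real.exp (-l * r) * (1 + l) ^ q ≤ q.factorial * Real.exp 1 / r ^ q := by
  have h1 := Real.pow_div_factorial_le_exp (x := r * (1 + l)) (by positivity) q
  have h2 : Real.exp (r * (1 + l)) ≤ Real.exp 1 * Real.exp (l * r) := by
    rw [← Real.exp_add, Real.exp_le_exp]
    linarith
  rw [div_le_iff₀ (by positivity), mul_pow] at h1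
  rw [le_div_iff₀ (by positivity), neg_mul, Real.exp_neg, inv_mul_eq_div, div_mul_eq_mul_div,
    div_le_iff₀ (Real.exp_pos _)]
  calc (1 + l) ^ q * r ^ q ≤ Real.exp (r * (1 + l)) * q.factorial := by rwa [mul_comm]
    _ ≤ Real.exp 1 * Real.exp (l * r) * q.factorial := by gcongr
    _ = _ := by ring

variable [IsFiniteMeasure ((volume : Measure (Eu ι)).restrict Ω)]

/-- Heat trace type bound. -/
lemma EigenBasis.exists_tsum_exp_le (S : EigenBasis Ω) : ∃ K : ℝ, 0 ≤ K ∧ ∀ r : ℝ, 0 < r → r ≤ 1 →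
    Summable (fun i => Real.exp (-S.lam i * r) * (1 + S.lam i) ^ Fintype.card ι) ∧
      ∑' i, Real.exp (-S.lam i * r) * (1 + S.lam i) ^ Fintype.card ι ≤
        K / r ^ (2 * Fintype.card ι + 2) := by
  set n := Fintype.card ι
  set q := 2 * n + 2 with hq
  have hs := S.summable_inv_pow
  refine ⟨q.factorial * Real.exp 1 * ∑' i, ((1 + S.lam i) ^ (n + 2))⁻¹, ?_, fun r hr hr1 => ?_⟩
  · exact mul_nonneg (by positivity) (tsum_nonneg fun i => by have := S.lam_nonneg i; positivity)
  have hle : ∀ i, Real.exp (-S.lam i * r) * (1 + S.lam i) ^ n ≤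
      q.factorial * Real.exp 1 / r ^ q * ((1 + S.lam i) ^ (n + 2))⁻¹ := by
    intro i
    have hl := S.lam_nonneg i
    rw [← div_eq_mul_inv, le_div_iff₀ (by positivity), mul_assoc, ← pow_add]
    have h2 : n + (n + 2) = q := by omega
    rw [h2]
    exact pow_mul_exp_neg_le q hr hr1 hl
  have hs' : Summable fun i => q.factorial * Real.exp 1 / r ^ q * ((1 + S.lam i) ^ (n + 2))⁻¹ :=
    hs.mul_left _
  have hs2 := Summable.of_nonneg_of_le
    (fun i => by have := S.lam_nonneg i; positivity) hle hs'
  refine ⟨hs2, (hs2.tsum_le_tsum hle hs').trans_eq ?_⟩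
  rw [tsum_mul_left]
  ring

/-- Low frequencies of a smooth function are controlled by the function. -/
lemma EigenBasis.exists_low_freq_le (S : EigenBasis Ω) (hΩ : IsOpen Ω) {e : S.κ → Eu ι → ℝ} {B : ℝ}
    (hB : 0 ≤ B) (he : ∀ i, ContinuousOn (e i) Ω) (hbe : ∀ i, S.b i =ᵐ[volume.restrict Ω] e i)
    (heB : ∀ i, ∀ x ∈ Ω, |e i x| ≤ B * (1 + S.lam i) ^ Fintype.card ι) :
    ∃ K : ℝ, 0 ≤ K ∧ ∀ (r N : ℝ) (f : L2 Ω), 0 < r → r ≤ 1 → 0 ≤ N →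
      (∀ i, |⟪S.b i, f⟫| ≤ N * Real.exp (-S.lam i * r)) →
      ∀ (Λ : ℝ) (F : Finset S.κ), (∀ i ∉ F, Λ ≤ S.lam i) → ∀ ω ⊆ Ω, ∀ x ∈ ω,
        ‖∑ i ∈ F, ⟪S.b i, f⟫ * e i x‖ₑ ≤ supOn ω f + ENNReal.ofReal
          (N * (K / r ^ (2 * Fintype.card ι + 2)) * Real.exp (-(Λ * r / 2))) := by
  classical
  obtain ⟨K, hK, h⟩ := S.exists_tsum_exp_le
  set n := Fintype.card ι
  set q := 2 * n + 2 with hq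
  refine ⟨B * (K * 2 ^ q), by positivity, fun r N f hr hr1 hN hf Λ F hF ω hω x hx => ?_⟩
  have hl := S.lam_nonneg
  obtain ⟨hs, -⟩ := h r hr hr1
  obtain ⟨hs2, hK2⟩ := h (r / 2) (by positivity) (by linarith)
  have hle : ∀ i, ∀ x ∈ Ω, ‖⟪S.b i, f⟫ * e i x‖ ≤
      N * B * (Real.exp (-S.lam i * r) * (1 + S.lam i) ^ n) := by
    intro i x hx
    rw [norm_mul, Real.norm_eq_abs, Real.norm_eq_abs]
    refine (mul_le_mul (hf i) (heB i x hx) (abs_nonneg _) (by positivity)).trans_eq ?_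
    ring
  obtain ⟨hc, hae⟩ := ae_eq_tsum_of_summable hΩ S.b he hbe f (hs.mul_left (N * B)) hle
  have hsx : Summable fun i => ⟪S.b i, f⟫ * e i x :=
    Summable.of_norm_bounded (hs.mul_left (N * B)) fun i => hle i x (hω hx)
  have hsplit := hsx.sum_add_tsum_compl (s := F)
  have hrem : ‖∑' i : ((F : Set S.κ)ᶜ : Set S.κ), ⟪S.b i, f⟫ * e i x‖ ≤
      N * (B * (K * 2 ^ q) / r ^ q) * Real.exp (-(Λ * r / 2)) := by
    -- Half of the decay e^{-λr} yields the factor e^{-Λr/2} off `F`; the other half keeps the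
    -- series summable.
    have hle2 : ∀ i : ((F : Set S.κ)ᶜ : Set S.κ), ‖⟪S.b i, f⟫ * e i x‖ ≤
        N * B * Real.exp (-(Λ * r / 2)) *
          (Real.exp (-S.lam i * (r / 2)) * (1 + S.lam i) ^ n) := by
      intro i
      refine (hle i x (hω hx)).trans ?_
      have h1 : Real.exp (-S.lam i * r) ≤
          Real.exp (-(Λ * r / 2)) * Real.exp (-S.lam i * (r / 2)) := by
        rw [← Real.exp_add, Real.exp_le_exp]
        have := hF i.1 fun hi => i.2 (Finset.mem_coe.2 hi)
        nlinarith
      have := hl i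
      calc _ ≤ N * B * (Real.exp (-(Λ * r / 2)) * Real.exp (-S.lam i * (r / 2)) *
            (1 + S.lam i) ^ n) := by gcongr
        _ = _ := by ring
    have hsc : Summable fun i : ((F : Set S.κ)ᶜ : Set S.κ) =>
        Real.exp (-S.lam i * (r / 2)) * (1 + S.lam i) ^ n := hs2.subtype _
    refine (tsum_of_norm_bounded (hsc.mul_left _).hasSum hle2).trans ?_
    rw [tsum_mul_left]
    have h3 : ∑' i : ((F : Set S.κ)ᶜ : Set S.κ),
        Real.exp (-S.lam i * (r / 2)) * (1 + S.lam i) ^ n ≤ K / (r / 2) ^ q :=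
      (Summable.tsum_subtype_le (fun i => Real.exp (-S.lam i * (r / 2)) * (1 + S.lam i) ^ n) _
        (fun i => by have := hl i; positivity) hs2).trans hK2
    refine (mul_le_mul_of_nonneg_left h3 (by positivity)).trans_eq ?_
    rw [div_pow]
    field_simp
  rw [supOn_eq hΩ hω hc hae]
  have hsum : ∑ i ∈ F, ⟪S.b i, f⟫ * e i x = (∑' i, ⟪S.b i, f⟫ * e i x) -
      ∑' i : ((F : Set S.κ)ᶜ : Set S.κ), ⟪S.b i, f⟫ * e i x := by
    rw [← hsplit]
    ring
  rw [hsum]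
  refine (enorm_sub_le).trans (add_le_add ?_ ?_)
  · exact le_iSup₂ (f := fun x _ => ‖∑' i, ⟪S.b i, f⟫ * e i x‖ₑ) x hx
  · rw [← ofReal_norm]
    exact ENNReal.ofReal_le_ofReal hrem

omit [IsFiniteMeasure ((volume : Measure (Eu ι)).restrict Ω)]

lemma enorm_sq_eq_ofReal {E : Type*} [SeminormedAddGroup E] (x : E) :
    ‖x‖ₑ ^ 2 = ENNReal.ofReal (‖x‖ ^ 2) := by
  rw [← ofReal_norm, ENNReal.ofReal_pow (norm_nonneg _)]

lemma EigenBasis.supOn_sum (S : EigenBasis Ω) (hΩ : IsOpen Ω) {ω : Set (Eu ι)} (hω : ω ⊆ Ω)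
    {e : S.κ → Eu ι → ℝ} (he : ∀ i, ContinuousOn (e i) Ω)
    (hbe : ∀ i, S.b i =ᵐ[volume.restrict Ω] e i) (F : Finset S.κ) (a : S.κ → ℝ) :
    supOn ω (∑ i ∈ F, a i • S.b i) = ⨆ x ∈ ω, ‖∑ i ∈ F, a i * e i x‖ₑ :=
  supOn_eq hΩ hω (continuousOn_finsetSum _ fun i _ => continuousOn_const.mul (he i))
    (coeFn_finsetSum F a hbe)

/-- The spectral inequality in terms of coefficients. -/
lemma Spec.sum_sq_le {ω : Set (Eu ι)} {C β : ℝ} (h : Spec Ω ω C β) (S : EigenBasis Ω)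
    (hΩ : IsOpen Ω) (hω : ω ⊆ Ω) {e : S.κ → Eu ι → ℝ} (he : ∀ i, ContinuousOn (e i) Ω)
    (hbe : ∀ i, S.b i =ᵐ[volume.restrict Ω] e i) {Λ : ℝ} (hΛ : 0 < Λ) (F : Finset S.κ)
    (hF : ∀ i ∈ F, S.lam i ≤ Λ) (a : S.κ → ℝ) :
    ENNReal.ofReal (∑ i ∈ F, a i ^ 2) ≤ (ENNReal.ofReal (C * Real.exp (C * Λ ^ β)) *
      ⨆ x ∈ ω, ‖∑ i ∈ F, a i * e i x‖ₑ) ^ 2 := by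
  have h1 := h Λ hΛ (∑ i ∈ F, a i • S.b i)
  rw [S.specProj_sum F a hF, S.supOn_sum hΩ hω he hbe] at h1
  rw [← norm_sq_sum_smul S.b.orthonormal, ← enorm_sq_eq_ofReal]
  gcongr

/-- The observability inequality in terms of coefficients. -/
lemma EigenBasis.obs_sum_sq_le (S : EigenBasis Ω) (hΩ : IsOpen Ω) {ω : Set (Eu ι)} (hω : ω ⊆ Ω)
    {e : S.κ → Eu ι → ℝ} (he : ∀ i, ContinuousOn (e i) Ω)
    (hbe : ∀ i, S.b i =ᵐ[volume.restrict Ω] e i) {T C α τ : ℝ}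
    (h : ∀ (v₀ : L2 Ω) (v : ℝ → L2 Ω), IsHeatSolution Ω T v₀ v → ObsIneq ω C α τ v)
    (F : Finset S.κ) (a : S.κ → ℝ) :
    ENNReal.ofReal (∑ i ∈ F, (a i * Real.exp (-S.lam i * τ)) ^ 2) ≤
      ENNReal.ofReal (C * Real.exp (C / τ ^ α)) *
        ∫⁻ s in Ioo 0 τ, (⨆ x ∈ ω, ‖∑ i ∈ F, a i * Real.exp (-S.lam i * s) * e i x‖ₑ) ^ 2 := by
  have h1 := h _ _ (S.isHeatSolution_sum F a T)
  rw [ObsIneq, enorm_sq_eq_ofReal, norm_sq_sum_smul S.b.orthonormal] at h1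
  simpa only [S.supOn_sum hΩ hω he hbe] using h1

end

/-! ### One step of the iteration -/

section

variable {ι κ : Type} [Fintype ι] [Fintype κ]

/-- The counting bound limits the size of every finite subset. Negative Λ is covered by comparing
with max Λ 0. -/
lemma EigenBasis.finite_lam_le {Ω : Set (Eu ι)}
    [IsFiniteMeasure ((volume : Measure (Eu ι)).restrict Ω)] (S : EigenBasis Ω) (Λ : ℝ) :
    {i | S.lam i ≤ Λ}.Finite := by
  obtain ⟨C, hC, h⟩ := S.exists_card_le
  by_contra hinf
  rw [Set.not_finite] at hinf
  obtain ⟨m, hm⟩ := exists_nat_gt (C * (1 + max Λ 0) ^ Fintype.card ι)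
  obtain ⟨F, hF, hcard⟩ := hinf.exists_subset_card_eq m
  have := h (max Λ 0) F (le_max_right _ _) fun i hi => (hF hi).trans (le_max_left _ _)
  rw [hcard] at this
  exact absurd hm (not_lt.2 this)

lemma enn_add_sq_le (a b : ℝ≥0∞) : (a + b) ^ 2 ≤ 4 * (a ^ 2 + b ^ 2) := by
  rcases le_total a b with h | h
  · calc (a + b) ^ 2 ≤ (b + b) ^ 2 := by gcongr
      _ = 4 * b ^ 2 := by ring
      _ ≤ _ := by gcongr; exact le_add_self
  · calc (a + b) ^ 2 ≤ (a + a) ^ 2 := by gcongr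
      _ = 4 * a ^ 2 := by ring
      _ ≤ _ := by gcongr; exact le_self_add

lemma lintegral_Ioo_translate (G : ℝ → ℝ≥0∞) (a σ : ℝ) :
    ∫⁻ s in Ioo 0 σ, G (a + s) = ∫⁻ t in Ioo a (a + σ), G t := by
  have h := (measurePreserving_add_left (volume : Measure ℝ) a).setLIntegral_comp_preimage_emb
    (MeasurableEquiv.addLeft a).measurableEmbedding G (Ioo a (a + σ))
  rw [← h]
  simp [Set.preimage_const_add_Ioo]

variable {A : Set (Eu ι)} {B : Set (Eu κ)} [IsFiniteMeasure ((volume : Measure (Eu ι)).restrict A)]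
  [IsFiniteMeasure ((volume : Measure (Eu κ)).restrict B)]

/-- Observation of the components of a solution along the eigenfunctions of the second factor. -/
lemma sum_sq_heat_le (S : EigenBasis A) (R : EigenBasis B) (hA : IsOpen A) {ω : Set (Eu ι)}
    (hω : ω ⊆ A) {e : S.κ → Eu ι → ℝ} (he : ∀ i, ContinuousOn (e i) A)
    (hbe : ∀ i, S.b i =ᵐ[volume.restrict A] e i) {T C α σ : ℝ}
    (h : ∀ (v₀ : L2 A) (v : ℝ → L2 A), IsHeatSolution A T v₀ v → ObsIneq ω C α σ v)
    {u₀ : L2 (prodSet A B)} {u : ℝ → L2 (prodSet A B)}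
    (hu : IsHeatSolution (prodSet A B) T u₀ u) {t : ℝ} (ht : 0 ≤ t) (hσ : 0 ≤ σ) (hT : t + σ ≤ T)
    (F : Finset S.κ) (k : R.κ) :
    ENNReal.ofReal (∑ j ∈ F, ⟪(S.tensor R).b (j, k), u (t + σ)⟫ ^ 2) ≤
      ENNReal.ofReal (C * Real.exp (C / σ ^ α)) * ∫⁻ s in Ioo 0 σ,
        (⨆ x ∈ ω, ‖∑ j ∈ F, ⟪(S.tensor R).b (j, k), u (t + s)⟫ * e j x‖ₑ) ^ 2 := by
  have hk := R.lam_nonneg k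
  have hlam : ∀ j, (S.tensor R).lam (j, k) = S.lam j + R.lam k := fun j => rfl
  have hc : ∀ j s, 0 ≤ s → s ≤ σ → ⟪(S.tensor R).b (j, k), u (t + s)⟫ =
      Real.exp (-(S.lam j + R.lam k) * s) * ⟪(S.tensor R).b (j, k), u t⟫ := fun j s h0 h1 => by
    rw [(S.tensor R).inner_heat hu (j, k) ht h0 (by linarith), hlam]
  -- The factor e^{-μ_k σ} in the initial coefficients makes the solution on the first factor match
  -- the components of u at the final time σ. At an earlier time s it differs from them by
  -- e^{-μ_k(σ-s)} ≤ 1, which can be dropped under the integral.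
  have h1 := S.obs_sum_sq_le hA hω he hbe h F
    (fun j => Real.exp (-R.lam k * σ) * ⟪(S.tensor R).b (j, k), u t⟫)
  have e1 : ∀ j, Real.exp (-R.lam k * σ) * ⟪(S.tensor R).b (j, k), u t⟫ *
      Real.exp (-S.lam j * σ) = ⟪(S.tensor R).b (j, k), u (t + σ)⟫ := by
    intro j
    rw [hc j σ hσ le_rfl, mul_right_comm, ← Real.exp_add]
    ring_nf
  simp only [e1] at h1
  refine h1.trans (mul_le_mul' le_rfl ?_)
  refine setLIntegral_mono_ae' measurableSet_Ioo (Filter.Eventually.of_forall fun s hs => ?_)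
  gcongr with x hx
  have e2 : ∑ j ∈ F, Real.exp (-R.lam k * σ) * ⟪(S.tensor R).b (j, k), u t⟫ *
      Real.exp (-S.lam j * s) * e j x = Real.exp (-R.lam k * (σ - s)) *
        ∑ j ∈ F, ⟪(S.tensor R).b (j, k), u (t + s)⟫ * e j x := by
    rw [Finset.mul_sum]
    refine Finset.sum_congr rfl fun j _ => ?_
    have e3 : Real.exp (-R.lam k * σ) * Real.exp (-S.lam j * s) =
        Real.exp (-R.lam k * (σ - s)) * Real.exp (-(S.lam j + R.lam k) * s) := by
      rw [← Real.exp_add, ← Real.exp_add]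
      ring_nf
    rw [hc j s hs.1.le hs.2.le]
    linear_combination (⟪(S.tensor R).b (j, k), u t⟫ * e j x) * e3
  rw [e2, enorm_mul]
  refine mul_le_of_le_one_left' ?_
  rw [← ofReal_norm, Real.norm_of_nonneg (Real.exp_pos _).le, ENNReal.ofReal_le_one,
    Real.exp_le_one_iff]
  nlinarith [hs.2]

/-- One step of the iteration. -/
lemma exists_heat_step (hA : IsOpen A) (hB : IsOpen B) {ω : Set (Eu ι)} {ω' : Set (Eu κ)}
    (hω : ω ⊆ A) (hω' : ω' ⊆ B) {β C' : ℝ} (hspec : Spec B ω' C' β) (C α : ℝ) (hC : 0 ≤ C)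
    (hC' : 0 ≤ C') :
    ∃ (K N : ℝ) (n q : ℕ), 0 ≤ K ∧ 0 ≤ N ∧ ∀ (T : ℝ) (u₀ : L2 (prodSet A B))
      (u : ℝ → L2 (prodSet A B)), IsHeatSolution (prodSet A B) T u₀ u →
      ∀ t τ Λ : ℝ, 0 ≤ t → 0 < τ → τ ≤ 1 → t + τ ≤ T → 0 < Λ →
      (∀ (v₀ : L2 A) (v : ℝ → L2 A), IsHeatSolution A T v₀ v → ObsIneq ω C α (τ / 2) v) →
      ‖u (t + τ)‖ₑ ^ 2 ≤
        ENNReal.ofReal (N * (1 + Λ) ^ n * (C * Real.exp (C / (τ / 2) ^ α)) *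
          (C' * Real.exp (C' * Λ ^ β)) ^ 2 * 4) *
          ((∫⁻ s in Ioo t (t + τ), supOn (prodSet ω ω') (u s) ^ 2) + ENNReal.ofReal
            ((‖u t‖ * (K / (τ / 2) ^ q) * Real.exp (-(Λ * (τ / 2) / 2))) ^ 2)) +
          ENNReal.ofReal (Real.exp (-2 * Λ * τ) * ‖u t‖ ^ 2) := by
  classical
  obtain ⟨S⟩ := exists_eigenBasis hA
  obtain ⟨R⟩ := exists_eigenBasis hB
  obtain ⟨B₁, e, hB₁, hrep⟩ := S.exists_rep hA
  obtain ⟨B₂, e', hB₂, hrep'⟩ := R.exists_rep hB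
  obtain ⟨N, hN, hcard⟩ := R.exists_card_le
  set P := S.tensor R with hP
  have hl := S.lam_nonneg
  have hl' := R.lam_nonneg
  obtain ⟨K, hK, hlow⟩ := P.exists_low_freq_le (isOpen_prodSet hA hB) (B := B₁ * B₂)
    (e := fun p z => e p.1 (pL ι κ z) * e' p.2 (pR ι κ z)) (by positivity)
    (fun p => ((hrep p.1).1.comp (pL ι κ).continuous.continuousOn fun z hz => hz.1).mul
      ((hrep' p.2).1.comp (pR ι κ).continuous.continuousOn fun z hz => hz.2))
    (fun p => S.coeFn_tensor R (fun i => (hrep i).2.1) (fun k => (hrep' k).2.1) p)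
    (fun p z hz => by
      have h1 := hl p.1
      have h2 := hl' p.2
      have h3 : P.lam p = S.lam p.1 + R.lam p.2 := rfl
      rw [abs_mul, h3, Fintype.card_sum, pow_add]
      calc _ ≤ (B₁ * (1 + S.lam p.1) ^ Fintype.card ι) * (B₂ * (1 + R.lam p.2) ^ Fintype.card κ) :=
            mul_le_mul ((hrep p.1).2.2 _ hz.1) ((hrep' p.2).2.2 _ hz.2) (abs_nonneg _)
              (by positivity)
        _ ≤ (B₁ * (1 + (S.lam p.1 + R.lam p.2)) ^ Fintype.card ι) *
            (B₂ * (1 + (S.lam p.1 + R.lam p.2)) ^ Fintype.card κ) := by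
          gcongr <;> linarith
        _ = _ := by ring)
  set q := 2 * Fintype.card (ι ⊕ κ) + 2
  refine ⟨K, N, Fintype.card κ, q, hK, hN.le, fun T u₀ u hu t τ Λ ht hτ hτ1 hT hΛ hobs => ?_⟩
  set σ := τ / 2 with hσ
  have hσ0 : 0 < σ := by positivity
  have hτσ : τ = σ + σ := by rw [hσ]; ring
  set F₁ := (S.finite_lam_le Λ).toFinset
  set F₂ := (R.finite_lam_le Λ).toFinset
  have hF₂ : ∀ k ∈ F₂, R.lam k ≤ Λ := fun k hk => by simpa [F₂] using hk
  set F : Finset P.κ := (F₁ ×ˢ F₂ : Finset (S.κ × R.κ)) with hF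
  -- Both eigenvalues are nonnegative, so if their sum is below Λ each of them is; outside the
  -- product of the two cutoffs the sum is at least Λ.
  have hFc : ∀ p ∉ F, Λ ≤ P.lam p := by
    rintro ⟨j, k⟩ hp
    have h3 : P.lam (j, k) = S.lam j + R.lam k := rfl
    have h1 := hl j
    have h2 := hl' k
    by_contra hlt
    refine hp (Finset.mem_product.2 ⟨?_, ?_⟩)
    · simp only [F₁, Finite.mem_toFinset, mem_ofPred_eq]
      linarith
    · simp only [F₂, Finite.mem_toFinset, mem_ofPred_eq]
      linarith
  set E := C' * Real.exp (C' * Λ ^ β) with hE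
  have hE0 : 0 ≤ E := by positivity
  set K₁ := C * Real.exp (C / σ ^ α) with hK₁
  have hK₁0 : 0 ≤ K₁ := by positivity
  set Rm := ‖u t‖ * (K / σ ^ q) * Real.exp (-(Λ * σ / 2)) with hRm
  have hRm0 : 0 ≤ Rm := by positivity
  clear_value E K₁ Rm
  set G : ℝ → ℝ≥0∞ := fun s => supOn (prodSet ω ω') (u s) with hG
  -- Observation takes place in the second half of the interval. The first half, of length σ, is
  -- spent on smoothing, which controls the high-frequency remainder pointwise.
  have hpt : ∀ s ∈ Ioo 0 σ, ∀ k ∈ F₂,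
      (⨆ x ∈ ω, ‖∑ j ∈ F₁, ⟪P.b (j, k), u (t + σ + s)⟫ * e j x‖ₑ) ^ 2 ≤
        ENNReal.ofReal (E ^ 2 * 4) * (G (t + σ + s) ^ 2 + ENNReal.ofReal (Rm ^ 2)) := by
    intro s hs k hk
    have hcoef : ∀ p, |⟪P.b p, u (t + σ + s)⟫| ≤ ‖u t‖ * Real.exp (-P.lam p * σ) := by
      intro p
      have hp := P.lam_nonneg p
      rw [add_assoc, P.inner_heat hu p ht (by linarith [hs.1]) (by linarith [hs.2]), abs_mul,
        Real.abs_exp, mul_comm]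
      refine mul_le_mul (abs_inner_basis_le _ _ _) (Real.exp_le_exp.2 ?_) (Real.exp_pos _).le
        (norm_nonneg _)
      nlinarith [hs.1]
    have hsup : (⨆ x ∈ ω, ‖∑ j ∈ F₁, ⟪P.b (j, k), u (t + σ + s)⟫ * e j x‖ₑ) ≤
        ENNReal.ofReal E * (G (t + σ + s) + ENNReal.ofReal Rm) := by
      refine iSup₂_le fun x hx => ?_
      -- The spectral inequality in y with x frozen: the coefficients are the values at x of the
      -- components along the second eigenbasis.
      have h1 := hspec.sum_sq_le R hB hω' (fun k => (hrep' k).1) (fun k => (hrep' k).2.1) hΛ F₂ hF₂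
        (fun k => ∑ j ∈ F₁, ⟪P.b (j, k), u (t + σ + s)⟫ * e j x)
      rw [← hE] at h1
      have h2 : (⨆ y ∈ ω', ‖∑ k ∈ F₂, (∑ j ∈ F₁, ⟪P.b (j, k), u (t + σ + s)⟫ * e j x) *
          e' k y‖ₑ) ≤ G (t + σ + s) + ENNReal.ofReal Rm := by
        refine iSup₂_le fun y hy => ?_
        have h3 := hlow σ ‖u t‖ (u (t + σ + s)) hσ0 (by linarith) (norm_nonneg _) hcoef Λ F hFc
          (prodSet ω ω') (fun z hz => ⟨hω hz.1, hω' hz.2⟩) (join x y)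
          (join_mem_prodSet.2 ⟨hx, hy⟩)
        rw [← hRm] at h3
        refine le_of_eq_of_le ?_ h3
        congr 1
        simp only [pL_join, pR_join]
        rw [hF]
        refine Eq.trans ?_ (Finset.sum_product_right F₁ F₂ _).symm
        refine Finset.sum_congr rfl fun k _ => ?_
        rw [Finset.sum_mul]
        exact Finset.sum_congr rfl fun j _ => mul_assoc _ _ _
      have h4 : ‖∑ j ∈ F₁, ⟪P.b (j, k), u (t + σ + s)⟫ * e j x‖ₑ ^ 2 ≤
          (ENNReal.ofReal E * (G (t + σ + s) + ENNReal.ofReal Rm)) ^ 2 := by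
        -- A single k is bounded by the whole sum over `F₂`. The supremum over x must be taken for
        -- each k separately, so the final summation over k costs the cardinality of `F₂`,
        -- polynomial in Λ.
        refine le_trans ?_ (h1.trans (by gcongr))
        rw [enorm_sq_eq_ofReal, Real.norm_eq_abs, sq_abs]
        exact ENNReal.ofReal_le_ofReal (Finset.single_le_sum
          (f := fun k => (∑ j ∈ F₁, ⟪P.b (j, k), u (t + σ + s)⟫ * e j x) ^ 2)
          (fun k _ => sq_nonneg _) hk)
      exact (ENNReal.pow_le_pow_left_iff two_ne_zero).1 h4
    refine (pow_le_pow_left' hsup 2).trans ?_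
    rw [mul_pow, ENNReal.ofReal_mul (by positivity), ENNReal.ofReal_pow hE0, mul_assoc,
      ENNReal.ofReal_pow hRm0, ENNReal.ofReal_ofNat]
    gcongr
    exact enn_add_sq_le _ _
  have hint : ∀ k ∈ F₂, ENNReal.ofReal (∑ j ∈ F₁, ⟪P.b (j, k), u (t + τ)⟫ ^ 2) ≤
      ENNReal.ofReal K₁ * (ENNReal.ofReal (E ^ 2 * 4) *
        ((∫⁻ s in Ioo t (t + τ), G s ^ 2) + ENNReal.ofReal (Rm ^ 2))) := by
    intro k hk
    have h1 := sum_sq_heat_le S R hA hω (fun j => (hrep j).1) (fun j => (hrep j).2.1) hobs hu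
      (t := t + σ) (by positivity) hσ0.le (by linarith) F₁ k
    rw [← hK₁] at h1
    rw [hτσ, ← add_assoc]
    refine h1.trans ?_
    gcongr
    refine (setLIntegral_mono_ae' measurableSet_Ioo
      (Filter.Eventually.of_forall fun s hs => hpt s hs k hk)).trans ?_
    rw [lintegral_const_mul' _ _ ENNReal.ofReal_ne_top, lintegral_add_right _ measurable_const,
      lintegral_const, lintegral_Ioo_translate (fun s => G s ^ 2)]
    gcongr
    · linarith
    · rw [Measure.restrict_apply_univ, Real.volume_Ioo, sub_zero]
      refine mul_le_of_le_one_right' ?_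
      rw [ENNReal.ofReal_le_one]
      linarith
  have hsplit := P.norm_sq_heat_le hu ht hτ.le hT F hFc
  rw [enorm_sq_eq_ofReal]
  refine (ENNReal.ofReal_le_ofReal hsplit).trans (ENNReal.ofReal_add_le.trans ?_)
  gcongr
  have hsum : ∑ i ∈ F, ⟪P.b i, u (t + τ)⟫ ^ 2 =
      ∑ k ∈ F₂, ∑ j ∈ F₁, ⟪P.b (j, k), u (t + τ)⟫ ^ 2 := Finset.sum_product_right F₁ F₂ _
  rw [hsum, ENNReal.ofReal_sum_of_nonneg fun k _ => Finset.sum_nonneg fun j _ => sq_nonneg _]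
  refine (Finset.sum_le_sum hint).trans ?_
  rw [Finset.sum_const, nsmul_eq_mul, ← mul_assoc, ← mul_assoc]
  gcongr
  rw [← ENNReal.ofReal_natCast, ← ENNReal.ofReal_mul (Nat.cast_nonneg _),
    ← ENNReal.ofReal_mul (mul_nonneg (Nat.cast_nonneg _) hK₁0)]
  refine ENNReal.ofReal_le_ofReal ?_
  rw [mul_assoc _ (E ^ 2) 4]
  gcongr
  exact hcard Λ F₂ hΛ.le hF₂

end

/-! ### Choice of the cutoff and telescoping in time -/

section

lemma le_exp_self (c : ℝ) : c ≤ Real.exp c := by linarith [Real.add_one_le_exp c]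

/-- A logarithm is dominated by any positive power; this lets powers of 1/τ be absorbed into
exponentials of τ^{-α}. -/
lemma inv_le_exp_rpow {τ α : ℝ} (hτ : 0 < τ) (hα : 0 < α) :
    τ⁻¹ ≤ Real.exp (τ ^ (-α) / α) := by
  have h := Real.log_le_rpow_div (x := τ⁻¹) (by positivity) hα
  rw [Real.inv_rpow hτ.le, ← Real.rpow_neg hτ.le] at h
  exact (Real.log_le_iff_le_exp (by positivity)).1 h

set_option maxHeartbeats 800000 in
/-- The constants of the iteration with frequency cutoff `M τ^{-(1 + α)}`. -/
lemma exists_exp_bounds {N C C' K β α : ℝ} (n q : ℕ) (hN : 0 ≤ N) (hC : 0 ≤ C) (hC' : 0 ≤ C')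
    (hK : 0 ≤ K) (hβ : 0 < β) (hα : 0 < α) (hαβ : (1 + α) * β = α) :
    ∃ D : ℝ, 0 < D ∧ ∀ M τ : ℝ, 1 ≤ M → 0 < τ → τ ≤ 1 →
      N * (1 + M * τ ^ (-(1 + α))) ^ n * (C * Real.exp (C / (τ / 2) ^ α)) *
          (C' * Real.exp (C' * (M * τ ^ (-(1 + α))) ^ β)) ^ 2 * 4 ≤
        Real.exp (D * (1 + M ^ β) * τ ^ (-α)) ∧
      N * (1 + M * τ ^ (-(1 + α))) ^ n * (C * Real.exp (C / (τ / 2) ^ α)) *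
          (C' * Real.exp (C' * (M * τ ^ (-(1 + α))) ^ β)) ^ 2 * 4 *
          (K / (τ / 2) ^ q * Real.exp (-(M * τ ^ (-(1 + α)) * (τ / 2) / 2))) ^ 2 +
          Real.exp (-2 * (M * τ ^ (-(1 + α))) * τ) ≤
        Real.exp (D * (1 + M ^ β) * τ ^ (-α)) * Real.exp (-(M * τ ^ (-α) / 2)) := by
  -- Each factor of the cost is at most the exponential of a multiple of Z = (1 + M^β) τ^{-α} ≥ 1,
  -- and `D₁` adds up the multiples; n/β comes from log Λ ≤ Λ^β/β. `D₂` does the same for the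
  -- squared remainder, whence its factors 2.
  set D₁ : ℝ := N + n + n / β + C + C * 2 ^ α + 4 * C' + 4 with hD₁
  set D₂ : ℝ := 2 * K + 2 * q + 2 * q / α with hD₂
  have hD₁0 : 0 ≤ D₁ := by positivity
  have hD₂0 : 0 ≤ D₂ := by positivity
  -- The extra 1 absorbs the factor 2 from adding the pointwise remainder and the L² high-frequency
  -- term, since 2 ≤ e^Z.
  refine ⟨D₁ + D₂ + 1, by positivity, fun M τ hM hτ hτ1 => ?_⟩
  set X := τ ^ (-α) with hX
  set Λ := M * τ ^ (-(1 + α)) with hΛ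
  have hX1 : 1 ≤ X := Real.one_le_rpow_of_pos_of_le_one_of_nonpos hτ hτ1 (by linarith)
  have hMβ : 1 ≤ M ^ β := Real.one_le_rpow hM hβ.le
  have hΛ1 : 1 ≤ Λ := one_le_mul_of_one_le_of_one_le hM
    (Real.one_le_rpow_of_pos_of_le_one_of_nonpos hτ hτ1 (by linarith))
  have hΛβ : Λ ^ β = M ^ β * X := by
    rw [hΛ, Real.mul_rpow (by linarith) (by positivity), ← Real.rpow_mul hτ.le, neg_mul, hαβ]
  have hΛτ : Λ * τ = M * X := by
    have : τ ^ (-(1 + α)) * τ = X := by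
      rw [← Real.rpow_add_one hτ.ne', hX]
      congr 1
      ring
    rw [hΛ, mul_assoc, this]
  have hCX : C / (τ / 2) ^ α = C * 2 ^ α * X := by
    rw [hX, Real.div_rpow hτ.le (by norm_num), Real.rpow_neg hτ.le]
    field_simp
  set Y := M ^ β * X with hY
  set Z := (1 + M ^ β) * X with hZ
  have hXZ : X ≤ Z := by nlinarith
  have hYZ : Y ≤ Z := by nlinarith
  have h1Z : 1 ≤ Z := hX1.trans hXZ
  clear_value Λ Y X Z D₁ D₂
  have h2 : (2 : ℝ) ≤ Real.exp 1 := by linarith [Real.add_one_le_exp (1 : ℝ)]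
  have hΛexp : 1 + Λ ≤ Real.exp (1 + Y / β) := by
    have h := Real.log_le_rpow_div (x := Λ) (by linarith) hβ
    rw [hΛβ] at h
    have h' := (Real.log_le_iff_le_exp (by linarith)).1 h
    rw [Real.exp_add]
    nlinarith
  have hA : N * (1 + Λ) ^ n * (C * Real.exp (C / (τ / 2) ^ α)) *
      (C' * Real.exp (C' * Λ ^ β)) ^ 2 * 4 ≤ Real.exp (D₁ * Z) := by
    rw [hCX, hΛβ]
    calc _ ≤ Real.exp N * Real.exp (1 + Y / β) ^ n * (Real.exp C * Real.exp (C * 2 ^ α * X)) *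
          (Real.exp C' * Real.exp (C' * Y)) ^ 2 * Real.exp 4 := by
          gcongr <;> exact le_exp_self _
      _ = Real.exp (N + n * (1 + Y / β) + (C + C * 2 ^ α * X) + 2 * (C' + C' * Y) + 4) := by
          rw [← Real.exp_nat_mul, ← Real.exp_add C', ← Real.exp_nat_mul, ← Real.exp_add C,
            ← Real.exp_add, ← Real.exp_add, ← Real.exp_add, ← Real.exp_add]
          push_cast
          rfl
      _ ≤ _ := by
          rw [Real.exp_le_exp, hD₁]
          have a1 : N * 1 ≤ N * Z := by gcongr
          have a2 : (n : ℝ) * 1 ≤ n * Z := by gcongr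
          have a3 : n / β * Y ≤ n / β * Z := by gcongr
          have a4 : C * 1 ≤ C * Z := by gcongr
          have a5 : C * 2 ^ α * X ≤ C * 2 ^ α * Z := by gcongr
          have a6 : C' * 1 ≤ C' * Z := by gcongr
          have a7 : C' * Y ≤ C' * Z := by gcongr
          have a8 : n * (1 + Y / β) = n * 1 + n / β * Y := by ring
          rw [a8]
          nlinarith
  have hA0 : 0 ≤ N * (1 + Λ) ^ n * (C * Real.exp (C / (τ / 2) ^ α)) *
      (C' * Real.exp (C' * Λ ^ β)) ^ 2 * 4 := by positivity
  have hpZ : ∀ c, c * (1 + M ^ β) * X = c * Z := fun c => by rw [hZ, mul_assoc]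
  refine ⟨hA.trans ?_, ?_⟩
  · rw [hpZ, Real.exp_le_exp]
    gcongr
    linarith
  have hR : K / (τ / 2) ^ q ≤ Real.exp (K + q * (1 + X / α)) := by
    have h3 : (τ / 2)⁻¹ ≤ Real.exp (1 + X / α) := by
      rw [inv_div, div_eq_mul_inv, Real.exp_add]
      exact mul_le_mul h2 (hX ▸ inv_le_exp_rpow hτ hα) (by positivity) (Real.exp_pos _).le
    rw [div_eq_mul_inv, ← inv_pow, Real.exp_add, Real.exp_nat_mul]
    gcongr
    exact le_exp_self K
  have hR2 : (K / (τ / 2) ^ q * Real.exp (-(Λ * (τ / 2) / 2))) ^ 2 ≤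
      Real.exp (D₂ * Z) * Real.exp (-(M * X / 2)) := by
    calc _ ≤ (Real.exp (K + q * (1 + X / α)) * Real.exp (-(Λ * (τ / 2) / 2))) ^ 2 := by gcongr
      _ = Real.exp (2 * (K + q * (1 + X / α))) * Real.exp (-(M * X / 2)) := by
          have h5 : ((2 : ℕ) : ℝ) * -(Λ * (τ / 2) / 2) = -(M * X / 2) := by
            rw [← hΛτ]
            push_cast
            ring
          rw [mul_pow, ← Real.exp_nat_mul, ← Real.exp_nat_mul, h5, Nat.cast_ofNat]
      _ ≤ _ := by
          refine mul_le_mul_of_nonneg_right (Real.exp_le_exp.2 ?_) (Real.exp_pos _).le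
          have a1 : K * 1 ≤ K * Z := by gcongr
          have a2 : (q : ℝ) * 1 ≤ q * Z := by gcongr
          have a3 : q / α * X ≤ q / α * Z := by gcongr
          have a4 : q * (1 + X / α) = q * 1 + q / α * X := by ring
          have a5 : 2 * q / α * Z = 2 * (q / α * Z) := by ring
          rw [hD₂, a4, add_mul, a5]
          nlinarith
  have hE : Real.exp (-2 * Λ * τ) ≤ Real.exp (-(M * X / 2)) := by
    rw [Real.exp_le_exp, mul_assoc, hΛτ]
    have : 0 ≤ M * X := mul_nonneg (by linarith) (by linarith)
    linarith
  rw [hpZ]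
  calc _ ≤ Real.exp (D₁ * Z) * (Real.exp (D₂ * Z) * Real.exp (-(M * X / 2))) +
        1 * Real.exp (-(M * X / 2)) := by
        rw [one_mul]
        gcongr
    _ ≤ Real.exp (D₁ * Z) * (Real.exp (D₂ * Z) * Real.exp (-(M * X / 2))) +
        (Real.exp (D₁ * Z) * Real.exp (D₂ * Z)) * Real.exp (-(M * X / 2)) := by
        gcongr
        exact one_le_mul_of_one_le_of_one_le (Real.one_le_exp (by positivity))
          (Real.one_le_exp (by positivity))
    _ = 2 * (Real.exp (D₁ * Z) * Real.exp (D₂ * Z)) * Real.exp (-(M * X / 2)) := by ring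
    _ ≤ Real.exp Z * (Real.exp (D₁ * Z) * Real.exp (D₂ * Z)) * Real.exp (-(M * X / 2)) := by
        gcongr
        exact h2.trans (Real.exp_le_exp.2 h1Z)
    _ = _ := by
        rw [← Real.exp_add, ← Real.exp_add, show (D₁ + D₂ + 1) * Z = Z + (D₁ * Z + D₂ * Z) by ring]

/-- M grows faster than M^β. Taking M with M^{1-β} = Q ≥ 4D·2^α gives M = Q M^β, and 1 + M^β ≤ 2M^β
finishes. -/
lemma exists_large_cutoff {D β : ℝ} (α : ℝ) (hβ : β < 1) (hβ0 : 0 < β) (hD : 0 < D) :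
    ∃ M : ℝ, 1 ≤ M ∧ D * (1 + M ^ β) * 2 ^ α ≤ M / 2 := by
  set Q := max (4 * D * 2 ^ α) 1
  have hQ1 : 1 ≤ Q := le_max_right _ _
  have h1β : 0 < 1 - β := by linarith
  have hM : 1 ≤ Q ^ (1 / (1 - β)) := Real.one_le_rpow hQ1 (by positivity)
  refine ⟨Q ^ (1 / (1 - β)), hM, ?_⟩
  set M := Q ^ (1 / (1 - β))
  have hMQ : M ^ (1 - β) = Q := by
    rw [← Real.rpow_mul (by linarith), one_div_mul_cancel h1β.ne', Real.rpow_one]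
  have hMM : M = Q * M ^ β := by
    rw [← hMQ, ← Real.rpow_add (by linarith), sub_add_cancel, Real.rpow_one]
  have h1 : 1 ≤ M ^ β := Real.one_le_rpow hM hβ0.le
  have h2 : 4 * D * 2 ^ α * M ^ β ≤ M := by
    conv_rhs => rw [hMM]
    gcongr
    exact le_max_left _ _
  have h3 : D * 2 ^ α * (1 + M ^ β) ≤ D * 2 ^ α * (M ^ β + M ^ β) := by gcongr
  linarith

lemma tendsto_ofReal_exp_neg_rpow {p α T : ℝ} (hp : 0 < p) (hα : 0 < α) (hT : 0 < T) :
    Filter.Tendsto (fun k : ℕ => ENNReal.ofReal (Real.exp (-p * (T / 2 ^ (k + 1)) ^ (-α))))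
      Filter.atTop (nhds 0) := by
  have h1 : Filter.Tendsto (fun k : ℕ => (T / 2 ^ (k + 1)) ^ (-α)) Filter.atTop Filter.atTop := by
    have h2 : Filter.Tendsto (fun k : ℕ => (2 : ℝ) ^ (k + 1) / T) Filter.atTop Filter.atTop :=
      (((tendsto_pow_atTop_atTop_of_one_lt one_lt_two).comp
        (Filter.tendsto_add_atTop_nat 1)).atTop_div_const hT)
    refine ((tendsto_rpow_atTop hα).comp h2).congr fun k => ?_
    rw [Function.comp_apply, ← inv_div, Real.inv_rpow (by positivity),
      Real.rpow_neg (by positivity)]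
  have h3 := Real.tendsto_exp_neg_atTop_nhds_zero.comp (h1.const_mul_atTop hp)
  have h4 := ENNReal.tendsto_ofReal h3
  rw [ENNReal.ofReal_zero] at h4
  refine h4.congr fun k => ?_
  simp only [Function.comp_apply, neg_mul]

/-- Telescoping of one-step estimates along a dyadic sequence of times. -/
lemma le_lintegral_of_forall_step {p α T : ℝ} (hp : 0 < p) (hα : 0 < α) (hT : 0 < T)
    {φ G : ℝ → ℝ≥0∞} {b : ℝ≥0∞} (hb : b ≠ ⊤) (hφ : ∀ t, 0 < t → t ≤ T → φ t ≤ b)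
    (h : ∀ τ, 0 < τ → 2 * τ ≤ T → φ (2 * τ) ≤ ENNReal.ofReal (Real.exp (p * τ ^ (-α))) *
      ((∫⁻ s in Ioo τ (2 * τ), G s) +
        ENNReal.ofReal (Real.exp (-p * (τ / 2) ^ (-α))) * φ τ)) :
    φ T ≤ ENNReal.ofReal (Real.exp (p * (T / 2) ^ (-α))) * ∫⁻ s in Ioo 0 T, G s := by
  -- Multiplying the step at τ by this weight removes the cost, and the coefficient left on φ(τ) is
  -- f(τ/2), exactly the weight of φ(τ) in the step at τ/2. This is why the sum telescopes.
  set f : ℝ → ℝ≥0∞ := fun τ => ENNReal.ofReal (Real.exp (-p * τ ^ (-α))) with hf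
  have hinv : ∀ τ, f τ * ENNReal.ofReal (Real.exp (p * τ ^ (-α))) = 1 := by
    intro τ
    rw [hf, ← ENNReal.ofReal_mul (Real.exp_pos _).le, ← Real.exp_add]
    simp
  have hstep : ∀ τ, 0 < τ → 2 * τ ≤ T →
      f τ * φ (2 * τ) ≤ (∫⁻ s in Ioo τ (2 * τ), G s) + f (τ / 2) * φ τ := by
    intro τ h1 h2
    refine (mul_le_mul' le_rfl (h τ h1 h2)).trans_eq ?_
    rw [← mul_assoc, hinv, one_mul]
  have hind : ∀ k : ℕ, f (T / 2) * φ T ≤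
      (∫⁻ s in Ioo (T / 2 ^ k) T, G s) + f (T / 2 ^ (k + 1)) * φ (T / 2 ^ k) := by
    intro k
    induction k with
    | zero => simp
    | succ k ih =>
      have h1 : 2 * (T / 2 ^ (k + 1)) = T / 2 ^ k := by
        rw [pow_succ]
        field_simp
      have h2 : T / 2 ^ k ≤ T := div_le_self hT.le (one_le_pow₀ one_le_two)
      have h3 := hstep (T / 2 ^ (k + 1)) (by positivity) (h1 ▸ h2)
      rw [h1] at h3
      have h4 : T / 2 ^ (k + 1) / 2 = T / 2 ^ (k + 1 + 1) := by
        rw [div_div, ← pow_succ]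
      rw [h4] at h3
      have h5 : T / 2 ^ (k + 1) ≤ T / 2 ^ k := by
        rw [← h1]
        linarith [show 0 < T / 2 ^ (k + 1) by positivity]
      have hd : Disjoint (Ioo (T / 2 ^ k) T) (Ioo (T / 2 ^ (k + 1)) (T / 2 ^ k)) :=
        Set.disjoint_left.2 fun x hx hx' => lt_asymm hx.1 hx'.2
      have h6 : (∫⁻ s in Ioo (T / 2 ^ k) T, G s) +
          ∫⁻ s in Ioo (T / 2 ^ (k + 1)) (T / 2 ^ k), G s ≤
          ∫⁻ s in Ioo (T / 2 ^ (k + 1)) T, G s := by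
        rw [← lintegral_union measurableSet_Ioo hd]
        exact lintegral_mono_set (union_subset (Ioo_subset_Ioo_left h5) (Ioo_subset_Ioo_right h2))
      calc _ ≤ _ := ih
        _ ≤ _ := add_le_add le_rfl h3
        _ ≤ _ := by
          rw [← add_assoc]
          exact add_le_add h6 le_rfl
  have hlim : f (T / 2) * φ T ≤ ∫⁻ s in Ioo 0 T, G s := by
    have ht : Filter.Tendsto (fun k : ℕ => (∫⁻ s in Ioo 0 T, G s) + f (T / 2 ^ (k + 1)) * b)
        Filter.atTop (nhds ((∫⁻ s in Ioo 0 T, G s) + 0 * b)) :=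
      (ENNReal.Tendsto.mul_const (tendsto_ofReal_exp_neg_rpow hp hα hT) (Or.inr hb)).const_add _
    rw [zero_mul, add_zero] at ht
    refine ge_of_tendsto' ht fun k => (hind k).trans (add_le_add ?_ (mul_le_mul' le_rfl ?_))
    · exact lintegral_mono_set (Ioo_subset_Ioo_left (by positivity))
    · exact hφ _ (by positivity) (div_le_self hT.le (one_le_pow₀ one_le_two))
  calc φ T = ENNReal.ofReal (Real.exp (p * (T / 2) ^ (-α))) * (f (T / 2) * φ T) := by
        rw [← mul_assoc, mul_comm _ (f _), hinv, one_mul]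
    _ ≤ _ := mul_le_mul' le_rfl hlim

end

end HeatObs

end

/-! ### Assembly of the proposition -/

theorem mainTheorem9 {n₁ n₂ : ℕ}
    (Ω₁ ω₁ : Set (EuclideanSpace ℝ (Fin n₁))) (Ω₂ ω₂ : Set (EuclideanSpace ℝ (Fin n₂)))
    (hΩ₁ : IsOpen Ω₁) (hb₁ : Bornology.IsBounded Ω₁) (hω₁ : ω₁ ⊆ Ω₁)
    (hΩ₂ : IsOpen Ω₂) (hb₂ : Bornology.IsBounded Ω₂) (hω₂ : ω₂ ⊆ Ω₂)
    (β C₁ C₂ : ℝ) (hβ : β ∈ Set.Ioo (0 : ℝ) 1) (hC₁ : 0 < C₁) (hC₂ : 0 < C₂)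
    (hspec : HeatObs.Spec Ω₂ ω₂ C₂ β) :
    ∃ C : ℝ, 0 < C ∧ ∀ T : ℝ, 0 < T →
      (∀ (v₀ : HeatObs.L2 Ω₁) (v : ℝ → HeatObs.L2 Ω₁), HeatObs.IsHeatSolution Ω₁ T v₀ v →
        ∀ τ : ℝ, 0 < τ → τ ≤ T → HeatObs.ObsIneq ω₁ C₁ (β / (1 - β)) τ v) →
      ∀ (u₀ : HeatObs.L2 (HeatObs.prodSet Ω₁ Ω₂)) (u : ℝ → HeatObs.L2 (HeatObs.prodSet Ω₁ Ω₂)),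
        HeatObs.IsHeatSolution (HeatObs.prodSet Ω₁ Ω₂) T u₀ u →
        HeatObs.ObsIneq (HeatObs.prodSet ω₁ ω₂) C (β / (1 - β)) T u := by
  have : IsFiniteMeasure ((volume : Measure (HeatObs.Eu (Fin n₁))).restrict Ω₁) :=
    ⟨by rw [Measure.restrict_apply_univ]; exact hb₁.measure_lt_top⟩
  have : IsFiniteMeasure ((volume : Measure (HeatObs.Eu (Fin n₂))).restrict Ω₂) :=
    ⟨by rw [Measure.restrict_apply_univ]; exact hb₂.measure_lt_top⟩
  have h1β : 0 < 1 - β := by linarith [hβ.2]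
  set α := β / (1 - β) with hα
  have hα0 : 0 < α := div_pos hβ.1 h1β
  have hαβ : (1 + α) * β = α := by
    rw [hα]
    field_simp
    ring
  obtain ⟨K, N, n, q, hK, hN, hstep⟩ :=
    HeatObs.exists_heat_step hΩ₁ hΩ₂ hω₁ hω₂ hspec C₁ α hC₁.le hC₂.le
  obtain ⟨D, hD, hbd⟩ := HeatObs.exists_exp_bounds n q hN hC₁.le hC₂.le hK hβ.1 hα0 hαβ
  obtain ⟨M, hM, hMD⟩ := HeatObs.exists_large_cutoff α hβ.2 hβ.1 hD
  obtain ⟨P⟩ := HeatObs.exists_eigenBasis (HeatObs.isOpen_prodSet hΩ₁ hΩ₂)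
  set p := D * (1 + M ^ β) with hp
  have hp0 : 0 < p := by positivity
  have hhalf : ∀ t : ℝ, 0 < t → (t / 2) ^ (-α) = 2 ^ α * t ^ (-α) := fun t ht => by
    rw [Real.div_rpow ht.le (by norm_num), Real.rpow_neg (by norm_num : (0 : ℝ) ≤ 2), div_inv_eq_mul,
      mul_comm]
  -- The iteration on a time T' ≤ 1 costs exp(p 2^α T'^{-α}) ≤ exp(p 2^α) exp(p 2^α / T^α). One
  -- constant must serve as prefactor and in the exponent, hence the sum.
  refine ⟨Real.exp (p * 2 ^ α) + p * 2 ^ α, by positivity, fun T hT hobs u₀ u hu => ?_⟩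
  -- The step estimate needs τ ≤ 1. For longer times the solution is observed on (0, T') only, and
  -- the norm does not increase afterwards.
  set T' := min T 1
  have hT' : 0 < T' := lt_min hT one_pos
  have hT'T : T' ≤ T := min_le_left _ _
  have hT'1 : T' ≤ 1 := min_le_right _ _
  set G : ℝ → ℝ≥0∞ := fun s => HeatObs.supOn (HeatObs.prodSet ω₁ ω₂) (u s) ^ 2
  have key := HeatObs.le_lintegral_of_forall_step (φ := fun t => ‖u t‖ₑ ^ 2) (G := G)
    (b := ‖u 0‖ₑ ^ 2) hp0 hα0 hT' (ENNReal.pow_ne_top enorm_ne_top)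
    (fun t ht htT => by
      have h1 := P.norm_heat_le hu le_rfl ht.le (by linarith : 0 + t ≤ T)
      rw [zero_add] at h1
      rw [HeatObs.enorm_sq_eq_ofReal, HeatObs.enorm_sq_eq_ofReal]
      exact ENNReal.ofReal_le_ofReal (by gcongr))
    (fun τ hτ h2τ => by
      have hτ1 : τ ≤ 1 := by linarith
      obtain ⟨hA, hAR⟩ := hbd M τ hM hτ hτ1
      -- The step runs from time τ to 2τ; the observability hypothesis is used at the single time
      -- τ/2.
      have h1 := hstep T u₀ u hu τ τ (M * τ ^ (-(1 + α))) hτ.le hτ hτ1 (by linarith)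
        (by positivity) (fun v₀ v hv => hobs v₀ v hv (τ / 2) (by positivity) (by linarith))
      rw [← two_mul] at h1
      set A := N * (1 + M * τ ^ (-(1 + α))) ^ n * (C₁ * Real.exp (C₁ / (τ / 2) ^ α)) *
        (C₂ * Real.exp (C₂ * (M * τ ^ (-(1 + α))) ^ β)) ^ 2 * 4
      have hA0 : 0 ≤ A := by positivity
      -- The choice of `M` enters here: p 2^α ≤ M/2 turns the gain into the weight at τ/2 required
      -- by the telescoping.
      have hM2 : Real.exp (-(M * τ ^ (-α) / 2)) ≤ Real.exp (-p * (τ / 2) ^ (-α)) := by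
        rw [Real.exp_le_exp, hhalf τ hτ]
        have := mul_le_mul_of_nonneg_right hMD (by positivity : 0 ≤ τ ^ (-α))
        linarith
      refine h1.trans ?_
      rw [mul_add, mul_add, add_assoc, ← ENNReal.ofReal_mul hA0,
        ← ENNReal.ofReal_add (by positivity) (by positivity)]
      refine add_le_add (mul_le_mul' (ENNReal.ofReal_le_ofReal hA) le_rfl) ?_
      rw [HeatObs.enorm_sq_eq_ofReal, ← ENNReal.ofReal_mul (Real.exp_pos _).le,
        ← ENNReal.ofReal_mul (Real.exp_pos _).le]
      refine ENNReal.ofReal_le_ofReal ?_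
      have h2 := mul_le_mul_of_nonneg_right (hAR.trans (mul_le_mul_of_nonneg_left hM2
        (Real.exp_pos _).le)) (sq_nonneg ‖u τ‖)
      linarith)
  have hcontr : ‖u T‖ₑ ^ 2 ≤ ‖u T'‖ₑ ^ 2 := by
    have h1 := P.norm_heat_le hu hT'.le (by linarith : 0 ≤ T - T') (by linarith)
    rw [add_sub_cancel] at h1
    rw [HeatObs.enorm_sq_eq_ofReal, HeatObs.enorm_sq_eq_ofReal]
    exact ENNReal.ofReal_le_ofReal (by gcongr)
  refine hcontr.trans (key.trans (mul_le_mul' (ENNReal.ofReal_le_ofReal ?_)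
    (lintegral_mono_set (Ioo_subset_Ioo_right hT'T))))
  have hT'α : T' ^ (-α) ≤ 1 + 1 / T ^ α := by
    have h0 : 0 ≤ 1 / T ^ α := by positivity
    rcases min_choice T 1 with h | h
    · change (min T 1) ^ (-α) ≤ _
      rw [h, Real.rpow_neg hT.le, one_div]
      linarith
    · change (min T 1) ^ (-α) ≤ _
      rw [h, Real.one_rpow]
      linarith
  calc Real.exp (p * (T' / 2) ^ (-α)) ≤ Real.exp (p * 2 ^ α + p * 2 ^ α / T ^ α) := by
        rw [Real.exp_le_exp, hhalf T' hT']
        have := mul_le_mul_of_nonneg_left hT'α (by positivity : 0 ≤ p * 2 ^ α)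
        calc _ = p * 2 ^ α * T' ^ (-α) := by ring
          _ ≤ _ := this
          _ = _ := by ring
    _ = Real.exp (p * 2 ^ α) * Real.exp (p * 2 ^ α / T ^ α) := Real.exp_add _ _
    _ ≤ _ := by
        gcongr
        · exact le_add_of_nonneg_right (by positivity)
        · exact le_add_of_nonneg_left (Real.exp_pos _).le
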